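/- Let $R$ be a commutative ring and $n\ge 0$ an integer. **Witt vectors.** For $\vec J\in\mathbb Z_{\ge 0}^n-0$ let $\gcd(\vec J)$ be the greatest common divisor of the non-zero entries of $\vec J$. For a commutative ring $B$ the Witt vectors $\mathbb W(B)=\mathbb W_{\mathbb Z_{\ge 0}^n-0}(B)$ have underlying set $B^{\mathbb Z_{\ge 0}^n-0}$, with the unique ring structure, functorial in $B$, for which all ghost components $w_{\vec I}(r)=\sum_{k\vec J=\vec I}\gcd(\vec J)\,r_{\vec J}^k$ (with $k\ge 1$) are ring homomorphisms $\mathbb W(B)\to B$. The functor $B\mapsto(\mathbb W(B),+)$ on commutative $R$-algebras is an affine commutative group scheme over $R$, with commutative and cocommutative Hopf algebra $H=R[a_{\vec J}:\vec J\in\mathbb Z_{\ge 0}^n-0]$. Its Cartier dual is $\mathbb W_{\mathbb Z_{\ge 0}^n-0}(R)^{\star}=\operatorname{Spf} H^{\star}$, where $H^\star=\operatorname{Hom}_R(H,R)$ has the topology of pointwise convergence ($R$ discrete), the product dual to the comultiplication of $H$, and the group law on $\operatorname{Spf}H^\star$ is dual to the multiplication of $H$. **Formal groups.** For a topological $R$-algebra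 $A$, $\operatorname{Spf}A$ is the functor sending a (discrete) commutative $R$-algebra $B$ to the set of continuous $R$-algebra homomorphisms $A\to B$. A commutative formal group over $R$ is a functor $G$ from commutative $R$-algebras to abelian groups that is a sheaf for the Zariski topology and is affine locally on $\operatorname{Spec}R$: there are elements $f$ of $R$ generating the unit ideal such that the restriction of $G$ to $R_f$-algebras is, as a set-valued functor, isomorphic to $\operatorname{Spf}A_f$ for a complete Hausdorff linearly topologized $R_f$-algebra $A_f$ in which the open $R_f$-submodules with finitely generated projective quotient form a basis of neighbourhoods of $0$. The group $\mathrm{Mor}_{\mathrm{fg}}(G_1,G_2)$ consists of the natural transformations of functors to abelian groups, added pointwise. Let $\hat{\mathbb A}^n=\operatorname{Spf}R[[t_1,\dots,t_n]]$ (with the $(t_1,\dots,t_n)$-adic topology), pointed by the ideal $(t_1,\dots,t_n)$, and let $\mathrm{Mor}_{\mathrm{fs}}(\hat{\mathbb A}^n,G)$ be the group, under pointwise addition, of the natural transformations $\hat{\mathbb A}^n\to G$ that send the base point to the identity of $G$. **Theorem.** The Cartier dual $\mathbb W_{\mathbb Z_{\ge 0}^n-0}(R)^{\star}$ is a commutative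 formal group over $R$, and it represents the functor $G\mapsto\mathrm{Mor}_{\mathrm{fs}}(\hat{\mathbb A}^n,G)$ from commutative formal groups over $R$ to abelian groups: there is an isomorphism of groups $$\mathrm{Mor}_{\mathrm{fg}}(\mathbb W_{\mathbb Z_{\ge 0}^n-0}(R)^{\star},G)\;\cong\;\mathrm{Mor}_{\mathrm{fs}}(\hat{\mathbb A}^n,G),$$ natural in the commutative formal group $G$ over $R$. -/

import Mathlib

universe u

open CategoryTheory TensorProduct

noncomputable section

namespace CartierWitt

/-! ### The additive group of the Witt vectors on `ℤ_{≥0}^n - 0` -/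

/-- The index set `ℤ_{≥0}^n - 0`. -/
abbrev Idx (n : ℕ) : Type := {J : Fin n →₀ ℕ // J ≠ 0}

/-- The greatest common divisor of the (non-zero) entries of `J`. -/
def gcdIdx {n : ℕ} (J : Idx n) : ℕ := Finset.univ.gcd J.1

theorem finite_pairs {n : ℕ} (I : Idx n) : {p : ℕ × Idx n | p.1 • p.2.1 = I.1}.Finite := by
  have hI : ∃ i, I.1 i ≠ 0 := by
    by_contra! h
    exact I.2 (Finsupp.ext h)
  obtain ⟨i, hi⟩ := hI
  have h2 : (Set.Iic I.1).Finite := Set.finite_Iic _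
  refine ((Set.finite_Iic (I.1 i)).prod (h2.preimage Subtype.val_injective.injOn)).subset ?_
  rintro ⟨k, J⟩ (h : k • J.1 = I.1)
  have hk : k ≠ 0 := by
    rintro rfl
    exact I.2 (by simpa using h.symm)
  refine ⟨?_, ?_⟩
  · have : k * J.1 i = I.1 i := by rw [← h]; simp
    have hJ : J.1 i ≠ 0 := by
      intro h0
      rw [h0, mul_zero] at this
      exact hi this.symm
    change k ≤ I.1 i
    rw [← this]
    exact Nat.le_mul_of_pos_right _ (Nat.pos_of_ne_zero hJ)
  · change J.1 ≤ I.1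
    rw [← h]
    intro j
    simpa using Nat.le_mul_of_pos_left (J.1 j) (Nat.pos_of_ne_zero hk)

/-- The finite set of pairs `(k, J)` with `k J = I`; here `k ≥ 1` is automatic as `I ≠ 0`. -/
def pairs {n : ℕ} (I : Idx n) : Finset (ℕ × Idx n) := (finite_pairs I).toFinset

theorem mem_pairs {n : ℕ} {I : Idx n} {p : ℕ × Idx n} : p ∈ pairs I ↔ p.1 • p.2.1 = I.1 := by
  simp [pairs]

/-- The ghost component `w_I = ∑_{k J = I} gcd(J) r_J ^ k`. -/
def ghost {n : ℕ} {B : Type*} [CommRing B] (r : Idx n → B) (I : Idx n) : B :=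
  ∑ p ∈ pairs I, (gcdIdx p.2 : B) * r p.2 ^ p.1

theorem map_ghost {n : ℕ} {B C : Type*} [CommRing B] [CommRing C] (f : B →+* C) (r : Idx n → B)
    (I : Idx n) : f (ghost r I) = ghost (fun J => f (r J)) I := by
  simp [ghost]

theorem pos_of_mem_pairs {n : ℕ} {I : Idx n} {p : ℕ × Idx n} (h : p ∈ pairs I) : 0 < p.1 := by
  rw [mem_pairs] at h
  refine Nat.pos_of_ne_zero fun h0 => I.2 ?_
  rw [← h, h0, zero_smul]

theorem gcdIdx_pos {n : ℕ} (I : Idx n) : 0 < gcdIdx I := by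
  refine Nat.pos_of_ne_zero fun h => I.2 ?_
  rw [gcdIdx, Finset.gcd_eq_zero_iff] at h
  exact Finsupp.ext fun i => h i (Finset.mem_univ i)

theorem gcdIdx_smul {n : ℕ} {I J : Idx n} {k : ℕ} (h : k • J.1 = I.1) :
    gcdIdx I = k * gcdIdx J := by
  have : (I.1 : Fin n → ℕ) = fun i => k * J.1 i := by
    rw [← h]; ext i; simp
  unfold gcdIdx
  rw [this, Finset.gcd_mul_left]
  simp

theorem dvd_gcdIdx_iff {n : ℕ} {I : Idx n} {p : ℕ} : p ∣ gcdIdx I ↔ ∃ J : Idx n, p • J.1 = I.1 := by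
  constructor
  · intro h
    have h1 : ∀ i, p ∣ I.1 i := fun i => h.trans (Finset.gcd_dvd (Finset.mem_univ i))
    have h2 : p • (I.1.mapRange (· / p) (by simp)) = I.1 := by
      ext i
      simpa using Nat.mul_div_cancel' (h1 i)
    refine ⟨⟨I.1.mapRange (· / p) (by simp), fun h0 => I.2 ?_⟩, h2⟩
    rw [← h2, h0, smul_zero]
  · rintro ⟨J, h⟩
    exact ⟨_, gcdIdx_smul h⟩

theorem frob_pow_dvd {P : Type*} [CommRing P] {p : ℕ} (hp : p.Prime) (φ : P →+* P)
    (hφ : ∀ a, (p : P) ∣ φ a - a ^ p) {a k g : ℕ} (h : p ^ a ∣ p * k * g) (x : P) :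
    (p ^ a : P) ∣ (g : P) * x ^ (p * k) - g * φ x ^ k := by
  rcases Nat.eq_zero_or_pos k with rfl | hk
  · simp
  rcases Nat.eq_zero_or_pos g with rfl | hg
  · simp
  obtain ⟨e, m, hm, rfl⟩ := Nat.exists_eq_pow_mul_and_not_dvd hk.ne' p hp.ne_one
  obtain ⟨c, l, hl, rfl⟩ := Nat.exists_eq_pow_mul_and_not_dvd hg.ne' p hp.ne_one
  have hle : a ≤ e + 1 + c := by
    have h1 : p * (p ^ e * m) * (p ^ c * l) = p ^ (e + 1 + c) * (m * l) := by ring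
    rw [h1] at h
    by_contra! hlt
    have h2 : p ^ (e + 1 + c) * p ∣ p ^ (e + 1 + c) * (m * l) :=
      (by rw [← pow_succ]; exact pow_dvd_pow p hlt : p ^ (e + 1 + c) * p ∣ p ^ a).trans h
    have h3 := Nat.dvd_of_mul_dvd_mul_left (pow_pos hp.pos _) h2
    exact (hp.dvd_mul.1 h3).elim hm hl
  have h4 : (p ^ (e + 1) : P) ∣ (x ^ p) ^ p ^ e - φ x ^ p ^ e := by
    have := dvd_sub_pow_of_dvd_sub (R := P) (p := p) (a := φ x) (b := x ^ p) (hφ x) e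
    rw [← neg_sub, dvd_neg]
    exact this
  have h5 : (p ^ (e + 1) : P) ∣ x ^ (p * (p ^ e * m)) - φ x ^ (p ^ e * m) := by
    have : x ^ (p * (p ^ e * m)) - φ x ^ (p ^ e * m)
        = ((x ^ p) ^ p ^ e) ^ m - (φ x ^ p ^ e) ^ m := by
      rw [← pow_mul, ← pow_mul, ← pow_mul]
    rw [this]
    exact h4.trans (sub_dvd_pow_sub_pow _ _ m)
  rw [← mul_sub]
  have h6 : (p ^ a : P) ∣ p ^ c * p ^ (e + 1) := by
    rw [← pow_add]
    exact pow_dvd_pow _ (by omega)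
  refine h6.trans (mul_dvd_mul ?_ h5)
  push_cast
  exact dvd_mul_right _ _

/-- Compatibility of ghost components with a lift of Frobenius. -/
theorem ghost_sub_frob_ghost {n : ℕ} {P : Type*} [CommRing P] {p : ℕ} (hp : p.Prime) (φ : P →+* P)
    (hφ : ∀ a, (p : P) ∣ φ a - a ^ p) {a : ℕ} {I J : Idx n} (hJ : p • J.1 = I.1)
    (ha : p ^ a ∣ gcdIdx I) (r : Idx n → P) : (p ^ a : P) ∣ ghost r I - φ (ghost r J) := by
  classical
  let f : ℕ × Idx n → ℕ × Idx n := fun q => (p * q.1, q.2)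
  have hf : Function.Injective f := by
    rintro ⟨k, K⟩ ⟨l, L⟩ h
    simp only [f, Prod.mk.injEq] at h
    exact Prod.ext (Nat.eq_of_mul_eq_mul_left hp.pos h.1) h.2
  have hsub : (pairs J).image f ⊆ pairs I := by
    intro q hq
    obtain ⟨q, hq', rfl⟩ := Finset.mem_image.1 hq
    rw [mem_pairs] at hq' ⊢
    simp only [f, mul_smul, hq', hJ]
  have key : ∀ q ∈ pairs I, q ∉ (pairs J).image f → ¬ p ∣ q.1 := by
    rintro ⟨k, K⟩ hq hn ⟨l, rfl : k = p * l⟩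
    refine hn (Finset.mem_image.2 ⟨(l, K), ?_, rfl⟩)
    rw [mem_pairs] at hq ⊢
    simp only [mul_smul, ← hJ] at hq
    ext i
    have := DFunLike.congr_fun hq i
    simp only [Finsupp.smul_apply, smul_eq_mul] at this ⊢
    exact Nat.eq_of_mul_eq_mul_left hp.pos this
  have e1 : ghost r I = ∑ q ∈ pairs I \ (pairs J).image f, (gcdIdx q.2 : P) * r q.2 ^ q.1
      + ∑ q ∈ pairs J, (gcdIdx q.2 : P) * r q.2 ^ (p * q.1) := by
    rw [ghost, ← Finset.sum_sdiff hsub, Finset.sum_image hf.injOn]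
  have e2 : φ (ghost r J) = ∑ q ∈ pairs J, (gcdIdx q.2 : P) * φ (r q.2) ^ q.1 := by
    simp [ghost]
  rw [e1, e2, add_sub_assoc, ← Finset.sum_sub_distrib]
  refine dvd_add (Finset.dvd_sum ?_) (Finset.dvd_sum ?_)
  · intro q hq
    rw [Finset.mem_sdiff] at hq
    have h1 := key q hq.1 hq.2
    have h2 := gcdIdx_smul (mem_pairs.1 hq.1)
    rw [h2] at ha
    have h3 : p ^ a ∣ gcdIdx q.2 :=
      ((Nat.Coprime.pow_left a ((Nat.Prime.coprime_iff_not_dvd hp).2 h1))).dvd_of_dvd_mul_left ha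
    exact Dvd.dvd.mul_right (by exact_mod_cast Nat.cast_dvd_cast (α := P) h3) _
  · intro q hq
    refine frob_pow_dvd hp φ hφ ?_ _
    rwa [← gcdIdx_smul (mem_pairs.1 (hsub (Finset.mem_image_of_mem f hq)))]

theorem natCast_dvd_of_prime_pow {P : Type*} [CommRing P] (x : P) (m : ℕ) (hm : 0 < m)
    (h : ∀ p : ℕ, p.Prime → ∀ a : ℕ, 0 < a → p ^ a ∣ m → (p ^ a : P) ∣ x) : (m : P) ∣ x := by
  induction m using Nat.recOnPosPrimePosCoprime with
  | zero => exact absurd hm (lt_irrefl _)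
  | one => simp
  | prime_pow p a hp ha => simpa using h p hp a ha dvd_rfl
  | coprime k l hk hl hkl ihk ihl =>
    push_cast
    refine (IsCoprime.mul_dvd ?_ (ihk (by omega) fun p hp a ha hd => h p hp a ha (hd.mul_right _))
      (ihl (by omega) fun p hp a ha hd => h p hp a ha (hd.mul_left _)))
    simpa using (Nat.isCoprime_iff_coprime.2 hkl).map (Int.castRingHom P)

theorem degree_lt {n : ℕ} {I : Idx n} {p : ℕ × Idx n} (hp : p ∈ (pairs I).erase (1, I)) :
    p.2.1.degree < I.1.degree := by
  rw [Finset.mem_erase] at hp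
  have h := mem_pairs.1 hp.2
  have h1 := pos_of_mem_pairs hp.2
  have h2 : p.1 ≠ 1 := by
    intro h0
    refine hp.1 (Prod.ext h0 (Subtype.ext ?_))
    rw [h0, one_smul] at h
    exact h
  have h3 : I.1.degree = p.1 * p.2.1.degree := by rw [← h]; simp
  have h4 : p.2.1.degree ≠ 0 := by
    rw [Ne, Finsupp.degree_eq_zero_iff]; exact p.2.2
  rw [h3]
  have : 2 ≤ p.1 := by omega
  nlinarith [Nat.pos_of_ne_zero h4]

/-- A solution `r` of the equations `w_I(r) = x_I`, found by recursion on the degree of `I`. -/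
def ghostRoot {n : ℕ} {P : Type*} [CommRing P] (x : Idx n → P) (I : Idx n) : P :=
  Classical.epsilon fun c => (gcdIdx I : P) * c +
    ∑ p ∈ ((pairs I).erase (1, I)).attach, (gcdIdx p.1.2 : P) * ghostRoot x p.1.2 ^ p.1.1 = x I
termination_by I.1.degree
decreasing_by exact degree_lt p.2

theorem one_mem_pairs {n : ℕ} (I : Idx n) : (1, I) ∈ pairs I := by simp [mem_pairs]

theorem ghost_eq {n : ℕ} {B : Type*} [CommRing B] (r : Idx n → B) (I : Idx n) :
    ghost r I = (gcdIdx I : B) * r I +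
      ∑ p ∈ (pairs I).erase (1, I), (gcdIdx p.2 : B) * r p.2 ^ p.1 := by
  rw [ghost, ← Finset.add_sum_erase _ _ (one_mem_pairs I)]
  simp

theorem ghost_ghostRoot {n : ℕ} {P : Type*} [CommRing P] (φ : ℕ → P →+* P)
    (hφ : ∀ p : ℕ, p.Prime → ∀ a, (p : P) ∣ φ p a - a ^ p) (x : Idx n → P)
    (hx : ∀ p : ℕ, p.Prime → ∀ (a : ℕ) (I J : Idx n), p • J.1 = I.1 → p ^ a ∣ gcdIdx I →
      (p ^ a : P) ∣ x I - φ p (x J)) (I : Idx n) : ghost (ghostRoot x) I = x I := by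
  induction h : I.1.degree using Nat.strong_induction_on generalizing I with
  | _ d ih =>
  subst h
  have hd : (gcdIdx I : P) ∣ x I -
      ∑ p ∈ (pairs I).erase (1, I), (gcdIdx p.2 : P) * ghostRoot x p.2 ^ p.1 := by
    have e : x I - ∑ p ∈ (pairs I).erase (1, I), (gcdIdx p.2 : P) * ghostRoot x p.2 ^ p.1
        = (x I - ghost (ghostRoot x) I) + gcdIdx I * ghostRoot x I := by
      rw [ghost_eq]; ring
    rw [e]
    refine dvd_add ?_ (dvd_mul_right _ _)
    refine natCast_dvd_of_prime_pow _ _ (gcdIdx_pos I) fun p hp a ha hpa => ?_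
    obtain ⟨J, hJ⟩ := dvd_gcdIdx_iff.1 ((dvd_pow_self p ha.ne').trans hpa)
    have hlt : J.1.degree < I.1.degree := by
      refine degree_lt (p := (p, J)) (Finset.mem_erase.2 ⟨?_, mem_pairs.2 hJ⟩)
      intro h
      exact hp.ne_one (congrArg Prod.fst h)
    have h1 := hx p hp a I J hJ hpa
    have h2 := ghost_sub_frob_ghost hp (φ p) (hφ p hp) hJ hpa (ghostRoot x)
    rw [ih _ hlt J rfl] at h2
    have := dvd_sub h1 h2
    rwa [sub_sub_sub_cancel_right] at this
  obtain ⟨c, hc⟩ := hd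
  have hs := Classical.epsilon_spec (p := fun c => (gcdIdx I : P) * c +
    ∑ p ∈ ((pairs I).erase (1, I)).attach, (gcdIdx p.1.2 : P) * ghostRoot x p.1.2 ^ p.1.1 = x I)
    ⟨c, by
      rw [Finset.sum_attach ((pairs I).erase (1, I))
        (fun p => (gcdIdx p.2 : P) * ghostRoot x p.2 ^ p.1), ← hc]
      ring⟩
  have hr : ghostRoot x I = Classical.epsilon fun c => (gcdIdx I : P) * c +
      ∑ p ∈ ((pairs I).erase (1, I)).attach,
        (gcdIdx p.1.2 : P) * ghostRoot x p.1.2 ^ p.1.1 = x I := by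
    rw [ghostRoot]
  rw [← hr, Finset.sum_attach ((pairs I).erase (1, I))
        (fun p => (gcdIdx p.2 : P) * ghostRoot x p.2 ^ p.1)] at hs
  rw [ghost_eq]
  exact hs

theorem expand_frob {σ : Type*} (p : ℕ) (hp : p.Prime) (a : MvPolynomial σ ℤ) :
    (p : MvPolynomial σ ℤ) ∣ (MvPolynomial.expand p : _ →ₐ[ℤ] _).toRingHom a - a ^ p := by
  have := Fact.mk hp
  have h : (p : MvPolynomial σ ℤ) = MvPolynomial.C (p : ℤ) := by simp
  rw [h, MvPolynomial.C_dvd_iff_zmod]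
  simp [MvPolynomial.map_expand, MvPolynomial.expand_zmod]

theorem exists_addPoly (n : ℕ) : ∃ s : Idx n → MvPolynomial (Idx n ⊕ Idx n) ℤ, ∀ I,
    ghost s I = ghost (fun J => MvPolynomial.X (Sum.inl J)) I
      + ghost (fun J => MvPolynomial.X (Sum.inr J)) I := by
  refine ⟨_, ghost_ghostRoot (fun p => (MvPolynomial.expand p : _ →ₐ[ℤ] _).toRingHom)
    expand_frob _ ?_⟩
  intro p hp a I J hJ ha
  have h1 := ghost_sub_frob_ghost hp _ (expand_frob p hp) hJ ha
    (fun J : Idx n => (MvPolynomial.X (Sum.inl J) : MvPolynomial (Idx n ⊕ Idx n) ℤ))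
  have h2 := ghost_sub_frob_ghost hp _ (expand_frob p hp) hJ ha
    (fun J : Idx n => (MvPolynomial.X (Sum.inr J) : MvPolynomial (Idx n ⊕ Idx n) ℤ))
  rw [map_add, add_sub_add_comm]
  exact dvd_add h1 h2

theorem exists_negPoly (n : ℕ) : ∃ s : Idx n → MvPolynomial (Idx n) ℤ, ∀ I,
    ghost s I = - ghost (fun J => MvPolynomial.X J) I := by
  refine ⟨_, ghost_ghostRoot (fun p => (MvPolynomial.expand p : _ →ₐ[ℤ] _).toRingHom)
    expand_frob _ ?_⟩
  intro p hp a I J hJ ha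
  have h1 := ghost_sub_frob_ghost hp _ (expand_frob p hp) hJ ha
    (fun J : Idx n => (MvPolynomial.X J : MvPolynomial (Idx n) ℤ))
  have h2 := dvd_neg.2 h1
  rw [neg_sub] at h2
  rw [map_neg, sub_neg_eq_add, neg_add_eq_sub]
  exact h2

/-- The Witt addition polynomials: `w_I(addPoly) = w_I(X) + w_I(Y)` for all `I`. -/
def addPoly (n : ℕ) : Idx n → MvPolynomial (Idx n ⊕ Idx n) ℤ := (exists_addPoly n).choose

/-- The polynomials of the Witt vector negation: `w_I(negPoly) = - w_I(X)` for all `I`. -/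
def negPoly (n : ℕ) : Idx n → MvPolynomial (Idx n) ℤ := (exists_negPoly n).choose

/-- The Witt vectors of a ring `B` on the truncation set `ℤ_{≥0}^n - 0`: families
`(r_J)_{J ∈ ℤ_{≥0}^n - 0}` of elements of `B`. Below they get the additive group structure of the
Witt ring: the unique functorial one for which all ghost components are additive. -/
@[ext]
structure Witt (n : ℕ) (B : Type*) where
  /-- The components of a Witt vector. -/
  coeff : Idx n → B

namespace Witt

variable {n : ℕ} {B C : Type*} [CommRing B] [CommRing C]

instance : Add (Witt n B) :=
  ⟨fun x y => ⟨fun I => MvPolynomial.aeval (Sum.elim x.coeff y.coeff) (addPoly n I)⟩⟩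

instance : Neg (Witt n B) := ⟨fun x => ⟨fun I => MvPolynomial.aeval x.coeff (negPoly n I)⟩⟩

instance : Zero (Witt n B) := ⟨⟨fun _ => 0⟩⟩

theorem ghost_add (x y : Witt n B) (I : Idx n) :
    ghost (x + y).coeff I = ghost x.coeff I + ghost y.coeff I := by
  have h := congrArg (MvPolynomial.aeval (Sum.elim x.coeff y.coeff) : _ →ₐ[ℤ] B).toRingHom
    ((exists_addPoly n).choose_spec I)
  rw [map_add, map_ghost, map_ghost, map_ghost] at h
  simpa using! h

theorem ghost_neg (x : Witt n B) (I : Idx n) : ghost (-x).coeff I = - ghost x.coeff I := by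
  have h := congrArg (MvPolynomial.aeval x.coeff : _ →ₐ[ℤ] B).toRingHom
    ((exists_negPoly n).choose_spec I)
  rw [map_neg, map_ghost, map_ghost] at h
  simpa using! h

theorem ghost_zero (I : Idx n) : ghost (0 : Witt n B).coeff I = 0 := by
  refine Finset.sum_eq_zero fun p hp => ?_
  have : (0 : Witt n B).coeff p.2 = 0 := rfl
  rw [this, zero_pow (pos_of_mem_pairs hp).ne', mul_zero]

/-- Functoriality of the Witt vectors. -/
def map (f : B →+* C) (x : Witt n B) : Witt n C := ⟨fun I => f (x.coeff I)⟩

theorem map_add' (f : B →+* C) (x y : Witt n B) : map f (x + y) = map f x + map f y := by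
  ext I
  change f (MvPolynomial.aeval _ _) = MvPolynomial.aeval _ _
  rw [MvPolynomial.aeval_def, MvPolynomial.aeval_def, MvPolynomial.hom_eval₂]
  congr 1
  · exact Subsingleton.elim _ _
  · ext (i | i) <;> rfl

theorem map_neg' (f : B →+* C) (x : Witt n B) : map f (-x) = - map f x := by
  ext I
  change f (MvPolynomial.aeval _ _) = MvPolynomial.aeval _ _
  rw [MvPolynomial.aeval_def, MvPolynomial.aeval_def, MvPolynomial.hom_eval₂]
  congr 1
  exact Subsingleton.elim _ _

theorem map_zero' (f : B →+* C) : map f (0 : Witt n B) = 0 := by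
  ext I
  exact map_zero f

theorem ghost_injective [IsDomain B] [CharZero B] {x y : Witt n B}
    (h : ∀ I, ghost x.coeff I = ghost y.coeff I) : x = y := by
  ext I
  induction hd : I.1.degree using Nat.strong_induction_on generalizing I with
  | _ d ih =>
  subst hd
  have h1 := h I
  rw [ghost_eq, ghost_eq] at h1
  have h2 : ∑ p ∈ (pairs I).erase (1, I), (gcdIdx p.2 : B) * x.coeff p.2 ^ p.1
      = ∑ p ∈ (pairs I).erase (1, I), (gcdIdx p.2 : B) * y.coeff p.2 ^ p.1 :=
    Finset.sum_congr rfl fun p hp => by rw [ih _ (degree_lt hp) p.2 rfl]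
  rw [h2] at h1
  exact mul_left_cancel₀ (Nat.cast_ne_zero.2 (gcdIdx_pos I).ne') (add_right_cancel h1)

/-- The `i`-th vector of indeterminates. -/
def univ (n : ℕ) (ι : Type) (i : ι) : Witt n (MvPolynomial (ι × Idx n) ℤ) :=
  ⟨fun J => MvPolynomial.X (i, J)⟩

/-- Specialization of the indeterminates. -/
def spec {ι : Type} (x : ι → Witt n B) : MvPolynomial (ι × Idx n) ℤ →+* B :=
  (MvPolynomial.aeval (fun p : ι × Idx n => (x p.1).coeff p.2) : _ →ₐ[ℤ] B).toRingHom

theorem map_spec {ι : Type} (x : ι → Witt n B) (i : ι) : map (spec x) (univ n ι i) = x i := by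
  ext J
  simp [map, spec, univ]

instance : AddCommGroup (Witt n B) where
  add_assoc x y z := by
    have h : univ n (Fin 3) 0 + univ n (Fin 3) 1 + univ n (Fin 3) 2 =
        univ n (Fin 3) 0 + (univ n (Fin 3) 1 + univ n (Fin 3) 2) :=
      ghost_injective fun I => by simp only [ghost_add, add_assoc]
    simpa only [map_add', map_spec] using! congrArg (map (spec ![x, y, z])) h
  zero_add x := by
    have h : 0 + univ n (Fin 1) 0 = univ n (Fin 1) 0 :=
      ghost_injective fun I => by simp only [ghost_add, ghost_zero, zero_add]
    simpa only [map_add', map_zero', map_spec] using! congrArg (map (spec ![x])) h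
  add_zero x := by
    have h : univ n (Fin 1) 0 + 0 = univ n (Fin 1) 0 :=
      ghost_injective fun I => by simp only [ghost_add, ghost_zero, add_zero]
    simpa only [map_add', map_zero', map_spec] using! congrArg (map (spec ![x])) h
  add_comm x y := by
    have h : univ n (Fin 2) 0 + univ n (Fin 2) 1 = univ n (Fin 2) 1 + univ n (Fin 2) 0 :=
      ghost_injective fun I => by simp only [ghost_add, add_comm]
    simpa only [map_add', map_spec] using! congrArg (map (spec ![x, y])) h
  neg_add_cancel x := by
    have h : -univ n (Fin 1) 0 + univ n (Fin 1) 0 = 0 :=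
      ghost_injective fun I => by simp only [ghost_add, ghost_neg, ghost_zero, neg_add_cancel]
    simpa only [map_add', map_neg', map_zero', map_spec] using! congrArg (map (spec ![x])) h
  nsmul := nsmulRec
  zsmul := zsmulRec

end Witt

/-! ### The Hopf algebra of the additive group scheme of the Witt vectors -/

/-- The coordinate ring `R[a_J : J ∈ ℤ_{≥0}^n - 0]` of the additive group scheme
`B ↦ (Witt n B, +)` over `R`: homomorphisms `WittCoord R n → B` are Witt vectors over `B`
(`map_lift`, `hom_ext`), and the comultiplication induces their addition (`map_lift_comulHom`). -/
def WittCoord (R : Type u) [CommRing R] (n : ℕ) : Type u := MvPolynomial (Idx n) R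

namespace WittCoord

variable (R : Type u) [CommRing R] (n : ℕ)

instance : CommRing (WittCoord R n) := inferInstanceAs (CommRing (MvPolynomial (Idx n) R))

instance : Algebra R (WittCoord R n) := inferInstanceAs (Algebra R (MvPolynomial (Idx n) R))

instance : Module.Free R (WittCoord R n) :=
  inferInstanceAs (Module.Free R (MvPolynomial (Idx n) R))

/-- The universal Witt vector `(a_J)_J`. -/
def gen : Witt n (WittCoord R n) := ⟨fun J => (MvPolynomial.X J : MvPolynomial (Idx n) R)⟩

variable {R n}

/-- The homomorphism `R[a_J] → B` that corresponds to a Witt vector over the `R`-algebra `B`. -/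
def lift {B : Type*} [CommRing B] [Algebra R B] (x : Witt n B) : WittCoord R n →ₐ[R] B :=
  (MvPolynomial.aeval x.coeff : MvPolynomial (Idx n) R →ₐ[R] B)

theorem map_lift {B : Type*} [CommRing B] [Algebra R B] (x : Witt n B) :
    Witt.map (lift (R := R) x).toRingHom (gen R n) = x := by
  ext J
  exact MvPolynomial.aeval_X (R := R) x.coeff J

theorem hom_ext {B : Type*} [CommRing B] [Algebra R B] {f g : WittCoord R n →ₐ[R] B}
    (h : Witt.map f.toRingHom (gen R n) = Witt.map g.toRingHom (gen R n)) : f = g := by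
  refine MvPolynomial.algHom_ext (R := R) (σ := Idx n) fun J => ?_
  exact congrFun (congrArg Witt.coeff h) J

theorem map_comp {B C : Type*} [CommRing B] [Algebra R B] [CommRing C] [Algebra R C]
    (g : B →ₐ[R] C) (f : WittCoord R n →ₐ[R] B) :
    Witt.map (g.comp f).toRingHom (gen R n)
      = Witt.map g.toRingHom (Witt.map f.toRingHom (gen R n)) := rfl

variable (R n)

/-- The comultiplication, `a ↦ a ⊗ 1 + 1 ⊗ a` with the sum taken in the Witt vectors. -/
def comulHom : WittCoord R n →ₐ[R] WittCoord R n ⊗[R] WittCoord R n :=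
  lift (Witt.map (Algebra.TensorProduct.includeLeft : _ →ₐ[R] _).toRingHom (gen R n)
    + Witt.map (Algebra.TensorProduct.includeRight : _ →ₐ[R] _).toRingHom (gen R n))

/-- The counit, the zero Witt vector. -/
def counitHom : WittCoord R n →ₐ[R] R := lift 0

/-- The antipode, the negative of the universal Witt vector. -/
def antipodeHom : WittCoord R n →ₐ[R] WittCoord R n := lift (- gen R n)

theorem map_comp_comulHom {C : Type*} [CommRing C] [Algebra R C]
    (g : WittCoord R n ⊗[R] WittCoord R n →ₐ[R] C) :
    Witt.map (g.comp (comulHom R n)).toRingHom (gen R n) =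
      Witt.map (g.comp Algebra.TensorProduct.includeLeft).toRingHom (gen R n)
        + Witt.map (g.comp Algebra.TensorProduct.includeRight).toRingHom (gen R n) := by
  rw [map_comp, comulHom, map_lift, Witt.map_add']
  rfl

theorem map_comp_counitHom {C : Type*} [CommRing C] [Algebra R C] (g : R →ₐ[R] C) :
    Witt.map (g.comp (counitHom R n)).toRingHom (gen R n) = 0 := by
  rw [map_comp, counitHom, map_lift, Witt.map_zero']

instance : Bialgebra R (WittCoord R n) :=
  Bialgebra.ofAlgHom (comulHom R n) (counitHom R n)
    (by
      have e1 : ((Algebra.TensorProduct.assoc R R R (WittCoord R n) (WittCoord R n)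
            (WittCoord R n)).toAlgHom.comp
          (Algebra.TensorProduct.map (comulHom R n) (.id R _))).comp
            Algebra.TensorProduct.includeLeft =
          ((Algebra.TensorProduct.assoc R R R (WittCoord R n) (WittCoord R n)
            (WittCoord R n)).toAlgHom.comp Algebra.TensorProduct.includeLeft).comp
              (comulHom R n) := by
        ext x; simp
      have e2 : (Algebra.TensorProduct.map (.id R _) (comulHom R n)).comp
            Algebra.TensorProduct.includeRight =
          (Algebra.TensorProduct.includeRight : _ →ₐ[R] WittCoord R n ⊗[R] _).comp
            (comulHom R n) := by
        ext x; simp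
      apply hom_ext
      rw [← AlgHom.comp_assoc, map_comp_comulHom, map_comp_comulHom, e1, e2,
        map_comp_comulHom, map_comp_comulHom, add_assoc]
      congr 2
      · ext x; simp [Algebra.TensorProduct.one_def]
      · congr 1
        ext x
        simp [Algebra.TensorProduct.one_def])
    (by
      have e1 : (Algebra.TensorProduct.map (counitHom R n) (.id R (WittCoord R n))).comp
            Algebra.TensorProduct.includeLeft =
          (Algebra.TensorProduct.includeLeft : R →ₐ[R] R ⊗[R] WittCoord R n).comp
            (counitHom R n) := by
        ext x; simp
      apply hom_ext
      rw [map_comp_comulHom, e1, map_comp_counitHom, zero_add]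
      ext; simp [Witt.map])
    (by
      have e1 : (Algebra.TensorProduct.map (.id R (WittCoord R n)) (counitHom R n)).comp
            Algebra.TensorProduct.includeRight =
          (Algebra.TensorProduct.includeRight : R →ₐ[R] WittCoord R n ⊗[R] R).comp
            (counitHom R n) := by
        ext x; simp
      apply hom_ext
      rw [map_comp_comulHom, e1, map_comp_counitHom, add_zero]
      ext; simp [Witt.map])

theorem comulAlgHom_eq : Bialgebra.comulAlgHom R (WittCoord R n) = comulHom R n := rfl

theorem counitAlgHom_eq : Bialgebra.counitAlgHom R (WittCoord R n) = counitHom R n := rfl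

theorem map_antipodeHom : Witt.map (antipodeHom R n).toRingHom (gen R n) = - gen R n :=
  map_lift _

theorem map_lift_comulHom {C : Type*} [CommRing C] [Algebra R C] (f g : WittCoord R n →ₐ[R] C) :
    Witt.map ((Algebra.TensorProduct.lift f g fun _ _ => Commute.all _ _).comp
      (comulHom R n)).toRingHom (gen R n) =
      Witt.map f.toRingHom (gen R n) + Witt.map g.toRingHom (gen R n) := by
  rw [map_comp_comulHom]
  congr 1 <;> congr 2 <;> ext x <;> simp

instance : HopfAlgebra R (WittCoord R n) :=
  HopfAlgebra.ofAlgHom (antipodeHom R n)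
    (by
      apply hom_ext
      refine (map_lift_comulHom R n _ _).trans (Eq.trans ?_ (map_comp_counitHom R n _).symm)
      rw [map_antipodeHom]
      exact neg_add_cancel (gen R n))
    (by
      apply hom_ext
      refine (map_lift_comulHom R n _ _).trans (Eq.trans ?_ (map_comp_counitHom R n _).symm)
      rw [map_antipodeHom]
      exact add_neg_cancel (gen R n))

instance : Coalgebra.IsCocomm R (WittCoord R n) where
  comm_comp_comul := by
    have h : (Algebra.TensorProduct.comm R (WittCoord R n) (WittCoord R n)).toAlgHom.comp
        (comulHom R n) = comulHom R n := by
      apply hom_ext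
      rw [map_comp_comulHom]
      conv_rhs => rw [comulHom, map_lift, add_comm]
      rfl
    exact congrArg AlgHom.toLinearMap h

end WittCoord

/-! ### Formal schemes over `R` as functors on commutative `R`-algebras -/

/-- The continuous `R`-algebra homomorphisms from a topological `R`-algebra `A` to the `R`-algebra
`B` with the discrete topology, i.e. the `B`-points of `Spf A`. -/
def SpfPoints (R A B : Type*) [CommRing R] [CommRing A] [Algebra R A] [TopologicalSpace A]
    [CommRing B] [Algebra R B] : Type _ :=
  {f : A →ₐ[R] B // @Continuous A B _ ⊥ f}

/-- Functoriality of `SpfPoints R A B` in `B`. -/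
def SpfPoints.map {R A B C : Type*} [CommRing R] [CommRing A] [Algebra R A] [TopologicalSpace A]
    [CommRing B] [Algebra R B] [CommRing C] [Algebra R C] (u : B →ₐ[R] C)
    (f : SpfPoints R A B) : SpfPoints R A C :=
  ⟨u.comp f.1, by
    let : TopologicalSpace B := ⊥
    let : TopologicalSpace C := ⊥
    have : DiscreteTopology B := ⟨rfl⟩
    exact (continuous_of_discreteTopology (f := u)).comp f.2⟩

/-- The functor of points of the formal scheme `Spf A` over `R`. -/
def spf (R : Type u) [CommRing R] (A : Type u) [CommRing A] [Algebra R A] [TopologicalSpace A] :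
    CommAlgCat.{u} R ⥤ Type u where
  obj B := SpfPoints R A B
  map u := TypeCat.ofHom (SpfPoints.map u.hom)
  map_id _ := rfl
  map_comp _ _ := rfl

/-- The topological `R`-algebras that are the function algebras of affine formal schemes:
complete Hausdorff linearly topologized algebras whose topology is defined by `R`-submodules
with finitely generated projective quotients. (The ring `R` is discrete, and `IsLinearTopology A A`
says that the open ideals are a basis of neighbourhoods of `0`.) -/
structure IsFormalAlgebra (R A : Type*) [CommRing R] [CommRing A] [Algebra R A]
    [TopologicalSpace A] : Prop where
  isTopologicalRing : IsTopologicalRing A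
  isLinearTopology : IsLinearTopology A A
  t2Space : T2Space A
  completeSpace : @CompleteSpace A (IsTopologicalAddGroup.rightUniformSpace A)
  exists_submodule : ∀ U ∈ nhds (0 : A), ∃ N : Submodule R A, IsOpen (N : Set A) ∧ (N : Set A) ⊆ U ∧
    Module.Finite R (A ⧸ N) ∧ Module.Projective R (A ⧸ N)

/-- Restriction of scalars from `R'`-algebras to `R`-algebras. -/
def restrictAlg (R R' : Type u) [CommRing R] [CommRing R'] [Algebra R R'] :
    CommAlgCat.{u} R' ⥤ CommAlgCat.{u} R where
  obj B := letI := Algebra.compHom B (algebraMap R R'); CommAlgCat.of R B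
  map {B C} f :=
    letI := Algebra.compHom B (algebraMap R R')
    letI := Algebra.compHom C (algebraMap R R')
    CommAlgCat.ofHom { f.hom.toRingHom with
      commutes' := fun r => f.hom.commutes (algebraMap R R' r) }

/-- Zariski descent for a functor `G` on commutative `R`-algebras: for elements `b ∈ s` generating
the unit ideal of `B`, sections over the `B[1/b]` that are compatible glue uniquely. -/
def IsZariskiSheaf {R : Type u} [CommRing R] (G : CommAlgCat.{u} R ⥤ Type u) : Prop :=
  ∀ (B : CommAlgCat.{u} R) (s : Finset B), Ideal.span (s : Set B) = ⊤ →
    ∀ x : (∀ b : s, G.obj (CommAlgCat.of R (Localization.Away (b : B)))),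
      (∀ (b c : s) (C : CommAlgCat.{u} R) (p : CommAlgCat.of R (Localization.Away (b : B)) ⟶ C)
        (q : CommAlgCat.of R (Localization.Away (c : B)) ⟶ C),
        CommAlgCat.ofHom (IsScalarTower.toAlgHom R B (Localization.Away (b : B))) ≫ p =
          CommAlgCat.ofHom (IsScalarTower.toAlgHom R B (Localization.Away (c : B))) ≫ q →
        G.map p (x b) = G.map q (x c)) →
      ∃! y : G.obj B, ∀ b : s,
        G.map (CommAlgCat.ofHom (IsScalarTower.toAlgHom R B (Localization.Away (b : B)))) y = x b

/-- `G` is, locally on `Spec R`, an affine formal scheme. -/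
def IsLocallyAffine {R : Type u} [CommRing R] (G : CommAlgCat.{u} R ⥤ Type u) : Prop :=
  ∃ s : Set R, Ideal.span s = ⊤ ∧ ∀ f ∈ s,
    ∃ (Rf : Type u) (_ : CommRing Rf) (_ : Algebra R Rf) (_ : IsLocalization.Away f Rf)
      (A : Type u) (_ : CommRing A) (_ : Algebra Rf A) (_ : TopologicalSpace A)
      (_ : IsFormalAlgebra Rf A), Nonempty (restrictAlg R Rf ⋙ G ≅ spf Rf A)

/-- A commutative formal group over `R`: an abelian group object `G` in formal schemes over `R`,
given by its functor of points, which is affine locally on `Spec R`. -/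
def IsCommFormalGroup (R : Type u) [CommRing R] :
    ObjectProperty (CommAlgCat.{u} R ⥤ AddCommGrpCat.{u}) := fun G =>
  IsZariskiSheaf (G ⋙ forget AddCommGrpCat.{u}) ∧ IsLocallyAffine (G ⋙ forget AddCommGrpCat.{u})

/-- The category of commutative formal groups over `R`; the morphisms `Mor_fg` are the natural
transformations of group-valued functors, and they are added pointwise. -/
abbrev CommFormalGroup (R : Type u) [CommRing R] : Type (u + 1) :=
  (IsCommFormalGroup R).FullSubcategory

/-! ### Pointed maps from formal affine space -/

/-- The topology of `R[[t_1, …, t_n]]` that defines `Spf`: the `(t_1, …, t_n)`-adic topology, which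
is the topology of coefficientwise convergence for the discrete topology on `R`. -/
abbrev powerSeriesTopology (R : Type u) [CommRing R] (n : ℕ) :
    TopologicalSpace (MvPowerSeries (Fin n) R) :=
  (Ideal.span (Set.range (MvPowerSeries.X : Fin n → MvPowerSeries (Fin n) R))).adicTopology

/-- The functor of points of formal affine `n`-space `Spf R[[t_1, …, t_n]]`. -/
def formalAffineSpace (R : Type u) [CommRing R] (n : ℕ) : CommAlgCat.{u} R ⥤ Type u :=
  letI := powerSeriesTopology R n
  spf R (MvPowerSeries (Fin n) R)

/-- The homomorphism `R[[t_1, …, t_n]] → R → B` that takes the constant coefficient. -/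
def constantCoeffHom (R : Type u) [CommRing R] (n : ℕ) (B : Type u) [CommRing B] [Algebra R B] :
    MvPowerSeries (Fin n) R →ₐ[R] B :=
  { (algebraMap R B).comp (MvPowerSeries.constantCoeff (σ := Fin n) (R := R)) with
    commutes' := fun r => by
      simp [MvPowerSeries.algebraMap_apply] }

theorem continuous_constantCoeffHom (R : Type u) [CommRing R] (n : ℕ) (B : Type u) [CommRing B]
    [Algebra R B] : @Continuous _ B (powerSeriesTopology R n) ⊥ (constantCoeffHom R n B) := by
  let I : Ideal (MvPowerSeries (Fin n) R) := Ideal.span (Set.range MvPowerSeries.X)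
  let : TopologicalSpace (MvPowerSeries (Fin n) R) := I.adicTopology
  let : TopologicalSpace B := ⊥
  have : DiscreteTopology B := ⟨rfl⟩
  have : NonarchimedeanRing (MvPowerSeries (Fin n) R) := I.nonarchimedean
  refine continuous_of_continuousAt_zero (constantCoeffHom R n B) ?_
  have h1 : (I : Set (MvPowerSeries (Fin n) R)) ∈ nhds (0 : MvPowerSeries (Fin n) R) := by
    have := I.hasBasis_nhds_zero_adic.mem_of_mem (i := 1) trivial
    simpa using this
  have h2 : I ≤ RingHom.ker (constantCoeffHom R n B) := by
    refine Ideal.span_le.2 ?_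
    rintro _ ⟨i, rfl⟩
    change algebraMap R B (MvPowerSeries.constantCoeff (MvPowerSeries.X i)) = 0
    simp
  rw [ContinuousAt, map_zero, nhds_discrete B, Filter.tendsto_pure]
  exact Filter.mem_of_superset h1 h2

/-- The base point of `formalAffineSpace R n`, given by the ideal `(t_1, …, t_n)`. -/
def basePoint (R : Type u) [CommRing R] (n : ℕ) (B : CommAlgCat.{u} R) :
    (formalAffineSpace R n).obj B :=
  letI := powerSeriesTopology R n
  ⟨constantCoeffHom R n B, continuous_constantCoeffHom R n B⟩

/-- The group `Mor_fs(Â^n, G)` of morphisms of pointed formal schemes from `Â^n` to a commutative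
formal group `G`, pointed by its identity: the natural transformations `Â^n → G` that map the base
point to `0`, with the pointwise addition. -/
def pointedMor (R : Type u) [CommRing R] (n : ℕ) (G : CommAlgCat.{u} R ⥤ AddCommGrpCat.{u}) :
    AddSubgroup (∀ B : CommAlgCat.{u} R, (formalAffineSpace R n).obj B → G.obj B) where
  carrier := {η | (∀ (B C : CommAlgCat.{u} R) (u : B ⟶ C) (t : (formalAffineSpace R n).obj B),
      η C ((formalAffineSpace R n).map u t) = G.map u (η B t)) ∧ ∀ B, η B (basePoint R n B) = 0}
  zero_mem' := ⟨fun _ _ _ _ => by simp, fun _ => rfl⟩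
  add_mem' {η θ} h h' := ⟨fun B C u t => by simp [h.1, h'.1], fun B => by simp [h.2, h'.2]⟩
  neg_mem' {η} h := ⟨fun B C u t => by simp [h.1], fun B => by simp [h.2]⟩

/-- The functor `G ↦ Mor_fs(Â^n, G)` from commutative formal groups over `R` to abelian groups. -/
def morFs (R : Type u) [CommRing R] (n : ℕ) : CommFormalGroup R ⥤ AddCommGrpCat.{u + 1} where
  obj G := AddCommGrpCat.of (pointedMor R n G.obj)
  map {G G'} φ := AddCommGrpCat.ofHom
    { toFun := fun η => ⟨fun B t => φ.hom.app B (η.1 B t),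
        fun B C u t => by
          refine (congrArg (φ.hom.app C) (η.2.1 B C u t)).trans ?_
          exact ConcreteCategory.congr_hom (φ.hom.naturality u) (η.1 B t),
        fun B => (congrArg (φ.hom.app B) (η.2.2 B)).trans (map_zero _)⟩
      map_zero' := by
        ext B t
        exact map_zero _
      map_add' := fun η θ => by
        ext B t
        exact map_add _ _ _ }

/-! ### Cartier duality -/

/-- The Cartier dual `Mor_R(H, R)` of a coalgebra `H` over `R`, with the product that is dual to
the comultiplication of `H` (convolution). -/
def CartierDual (R H : Type u) [CommRing R] [AddCommGroup H] [Module R H] : Type u :=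
  WithConv (H →ₗ[R] R)

namespace CartierDual

variable (R H : Type u) [CommRing R] [CommRing H] [HopfAlgebra R H]

instance [Coalgebra.IsCocomm R H] : CommRing (CartierDual R H) :=
  inferInstanceAs (CommRing (WithConv (H →ₗ[R] R)))

instance [Coalgebra.IsCocomm R H] : Algebra R (CartierDual R H) :=
  inferInstanceAs (Algebra R (WithConv (H →ₗ[R] R)))

variable {R H} in
/-- The underlying linear form of an element of the Cartier dual. -/
def toLin (φ : CartierDual R H) : H →ₗ[R] R := WithConv.ofConv φ

variable {R H} in
/-- A linear form, as an element of the Cartier dual. -/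
def ofLin (φ : H →ₗ[R] R) : CartierDual R H := WithConv.toConv φ

/-- The topology of pointwise convergence, for the discrete topology on `R`. -/
instance : TopologicalSpace (CartierDual R H) :=
  .induced (fun (φ : CartierDual R H) (h : H) => φ.toLin h)
    (@Pi.topologicalSpace H (fun _ => R) fun _ => ⊥)

variable {R H}

/-- The extension of scalars `B ⊗ H → B` of a linear form `φ` on `H`. -/
def pairing (B : Type u) [CommRing B] [Algebra R B] (φ : H →ₗ[R] R) : B ⊗[R] H →ₗ[B] B :=
  (AlgebraTensorModule.rid R B B).toLinearMap ∘ₗ φ.baseChange B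

variable {B C : Type u} [CommRing B] [Algebra R B] [CommRing C] [Algebra R C]

theorem pairing_tmul (φ : H →ₗ[R] R) (b : B) (h : H) :
    pairing B φ (b ⊗ₜ h) = φ h • b := by
  simp [pairing]

theorem map_pairing (u : B →ₐ[R] C) (φ : H →ₗ[R] R) (x : B ⊗[R] H) :
    u (pairing B φ x) = pairing C φ (Algebra.TensorProduct.map u (AlgHom.id R H) x) := by
  induction x with
  | zero => simp
  | add x y hx hy => simp only [map_add, hx, hy]
  | tmul b h => simp [pairing_tmul]

theorem basis_repr_eq_pairing {ι : Type*} (e : Module.Basis ι R H) (z : B ⊗[R] H) (i : ι) :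
    (Algebra.TensorProduct.basis B e).repr z i = pairing B (e.coord i) z := by
  induction z with
  | zero => simp
  | add x y hx hy => simp only [map_add, Finsupp.add_apply, hx, hy]
  | tmul b h => simp [pairing_tmul, Algebra.smul_def, mul_comm]

theorem pairing_ext [Module.Free R H] {x y : B ⊗[R] H}
    (h : ∀ φ : H →ₗ[R] R, pairing B φ x = pairing B φ y) : x = y := by
  let e := Module.Free.chooseBasis R H
  refine (Algebra.TensorProduct.basis B e).ext_elem fun i => ?_
  rw [basis_repr_eq_pairing, basis_repr_eq_pairing, h]

theorem pairing_add (φ ψ : H →ₗ[R] R) (x : B ⊗[R] H) :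
    pairing B (φ + ψ) x = pairing B φ x + pairing B ψ x := by
  simp [pairing, LinearMap.baseChange_add]

theorem pairing_smul (r : R) (φ : H →ₗ[R] R) (x : B ⊗[R] H) :
    pairing B (r • φ) x = r • pairing B φ x := by
  simp only [pairing, LinearMap.baseChange_smul, LinearMap.comp_apply, LinearMap.smul_apply]
  exact LinearMap.map_smul_of_tower _ r _

theorem pairing_counit (x : B ⊗[R] H) :
    pairing B (Coalgebra.counit : H →ₗ[R] R) x = Coalgebra.counit (R := B) x := by
  induction x with
  | zero => simp
  | add x y hx hy => simp only [map_add, hx, hy]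
  | tmul b h => simp [pairing_tmul]

theorem continuous_pairing (x : B ⊗[R] H) :
    @Continuous (CartierDual R H) B _ ⊥ fun φ => pairing B φ.toLin x := by
  let : TopologicalSpace R := ⊥
  let : TopologicalSpace B := ⊥
  have : DiscreteTopology R := ⟨rfl⟩
  have : DiscreteTopology B := ⟨rfl⟩
  induction x with
  | zero => simpa using continuous_const
  | add x y hx hy => 
    have h := hx.add hy
    simp only [map_add]
    exact h
  | tmul b h =>
    simp only [pairing_tmul]
    have h1 : Continuous fun φ : CartierDual R H => φ.toLin h :=
      (continuous_apply h).comp continuous_induced_dom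
    exact (continuous_of_discreteTopology (f := fun r : R => r • b)).comp h1

variable [Coalgebra.IsCocomm R H]

theorem pairing_one (x : B ⊗[R] H) :
    pairing B (1 : CartierDual R H).toLin x = Coalgebra.counit (R := B) x :=
  pairing_counit x

theorem pairing_mul (φ ψ : CartierDual R H) (x : B ⊗[R] H) :
    pairing B (φ * ψ).toLin x = LinearMap.mul' B B
      (TensorProduct.map (pairing B φ.toLin) (pairing B ψ.toLin)
        (Coalgebra.comul (R := B) x)) := by
  induction x with
  | zero => simp
  | add x y hx hy => simp only [map_add, hx, hy]
  | tmul b h =>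
    rw [pairing_tmul]
    have e : (φ * ψ).toLin h =
      LinearMap.mul' R R (TensorProduct.map φ.toLin ψ.toLin (Coalgebra.comul h)) := rfl
    rw [e, TensorProduct.comul_tmul]
    generalize (Coalgebra.comul h : H ⊗[R] H) = z
    induction z with
    | zero => simp
    | add x y hx hy => simp only [map_add, tmul_add, add_smul, hx, hy]
    | tmul x y =>
      simp [pairing_tmul, mul_smul]
      exact smul_comm _ _ _

/-- The `B`-point of `Spf H^⋆` given by a group-like element `∑ b_i ⊗ h_i` of the `B`-Hopf algebra
`B ⊗ H`: the homomorphism `φ ↦ ∑ φ(h_i) b_i`. -/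
def ofGroupLike (x : GroupLike B (B ⊗[R] H)) : SpfPoints R (CartierDual R H) B :=
  ⟨AlgHom.ofLinearMap
    { toFun := fun φ => pairing B φ.toLin x.val
      map_add' := fun φ ψ => pairing_add φ.toLin ψ.toLin x.val
      map_smul' := fun r φ => pairing_smul r φ.toLin x.val }
    ((pairing_one x.val).trans x.2.counit_eq_one)
    (fun φ ψ => (pairing_mul φ ψ x.val).trans (by
      rw [x.2.comul_eq_tmul_self, TensorProduct.map_tmul, LinearMap.mul'_apply]; rfl)), continuous_pairing x.val⟩

/-- A continuous form on the dual only depends on finitely many coordinates. -/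
theorem exists_finset_of_continuous {ι : Type*} (e : Module.Basis ι R H)
    (f : SpfPoints R (CartierDual R H) B) : ∃ K : Finset ι, ∀ φ : CartierDual R H,
      (∀ i ∈ K, φ.toLin (e i) = 0) → f.1 φ = 0 := by
  classical
  let : TopologicalSpace R := ⊥
  let : TopologicalSpace B := ⊥
  have : DiscreteTopology R := ⟨rfl⟩
  have : DiscreteTopology B := ⟨rfl⟩
  have hf : Continuous f.1 := f.2
  have h0 : f.1 ⁻¹' {0} ∈ nhds (0 : CartierDual R H) :=
    (isOpen_discrete ({0} : Set B)).preimage hf |>.mem_nhds (map_zero f.1)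
  rw [nhds_induced, Filter.mem_comap] at h0
  obtain ⟨U, hU, hUf⟩ := h0
  rw [nhds_pi, Filter.mem_pi'] at hU
  obtain ⟨T, V, hV, hTV⟩ := hU
  refine ⟨T.biUnion fun h => (e.repr h).support, fun φ hφ => hUf (hTV fun h hh => ?_)⟩
  have hz : φ.toLin h = 0 := by
    rw [← e.linearCombination_repr h, Finsupp.linearCombination_apply, Finsupp.sum, map_sum]
    refine Finset.sum_eq_zero fun i hi => ?_
    rw [map_smul, hφ i (Finset.mem_biUnion.2 ⟨h, hh, hi⟩), smul_zero]
  change φ.toLin h ∈ V h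
  rw [hz]
  exact mem_of_mem_nhds (hV h)

theorem exists_pairing_eq [Module.Free R H] (f : SpfPoints R (CartierDual R H) B) :
    ∃ x : B ⊗[R] H, ∀ φ : CartierDual R H, pairing B φ.toLin x = f.1 φ := by
  classical
  let e := Module.Free.chooseBasis R H
  obtain ⟨K, hK⟩ := exists_finset_of_continuous e f
  refine ⟨∑ i ∈ K, f.1 (ofLin (e.coord i)) ⊗ₜ e i, fun φ => ?_⟩
  have h1 : f.1 (φ - ∑ i ∈ K, φ.toLin (e i) • ofLin (e.coord i)) = 0 := by
    refine hK _ fun j hj => ?_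
    have h2 : (φ - ∑ i ∈ K, φ.toLin (e i) • ofLin (e.coord i)).toLin =
        φ.toLin - ∑ i ∈ K, φ.toLin (e i) • e.coord i := by
      let L : CartierDual R H →+ (H →ₗ[R] R) :=
        { toFun := toLin, map_zero' := rfl, map_add' := fun _ _ => rfl }
      exact (_root_.map_sub L _ _).trans (congrArg _ (_root_.map_sum L _ _))
    rw [h2]
    simp [Finsupp.single_apply, hj]
  rw [map_sub, sub_eq_zero] at h1
  rw [h1]
  simp [pairing_tmul]

theorem ofGroupLike_bijective [Module.Free R H] :
    Function.Bijective (ofGroupLike : GroupLike B (B ⊗[R] H) → SpfPoints R (CartierDual R H) B) := by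
  constructor
  · intro x y h
    refine GroupLike.val_injective (pairing_ext fun φ => ?_)
    exact DFunLike.congr_fun (congrArg Subtype.val h) (ofLin φ)
  · intro f
    obtain ⟨x, hx⟩ := exists_pairing_eq f
    refine ⟨⟨x, ?_, ?_⟩, Subtype.ext (AlgHom.ext hx)⟩
    · rw [← pairing_one, hx, map_one]
    · let e := Module.Free.chooseBasis R H
      let eB := Algebra.TensorProduct.basis B e
      have key : ∀ (z : (B ⊗[R] H) ⊗[B] (B ⊗[R] H)) i j, (eB.tensorProduct eB).repr z (i, j) =
          LinearMap.mul' B B (TensorProduct.map (pairing B (e.coord i))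
            (pairing B (e.coord j)) z) := by
        intro z i j
        induction z with
        | zero => simp
        | add x y hx hy => simp only [map_add, Finsupp.add_apply, hx, hy]
        | tmul x y =>
          simp [eB, Module.Basis.tensorProduct_repr_tmul_apply, basis_repr_eq_pairing, mul_comm]
      refine (eB.tensorProduct eB).ext_elem fun ⟨i, j⟩ => ?_
      rw [key, key]
      have h1 := pairing_mul (ofLin (e.coord i)) (ofLin (e.coord j)) x
      rw [hx, map_mul, ← hx, ← hx] at h1
      rw [TensorProduct.map_tmul, LinearMap.mul'_apply]
      exact h1.symm

variable [Module.Free R H]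

/-- The `B`-points of `Spf H^⋆` are the group-like elements of `B ⊗ H`. -/
def groupLikeEquiv : GroupLike B (B ⊗[R] H) ≃ SpfPoints R (CartierDual R H) B :=
  Equiv.ofBijective ofGroupLike ofGroupLike_bijective

/-- The group law of the formal group `Spf H^⋆`, dual to the multiplication of `H`:
if `f` is evaluation at `∑ b_i ⊗ h_i` and `g` is evaluation at `∑ c_j ⊗ k_j`, then `f + g` is
evaluation at the product `∑ b_i c_j ⊗ h_i k_j` (see `add_apply_of_comul`). -/
instance : AddCommGroup (SpfPoints R (CartierDual R H) B) :=
  (groupLikeEquiv.symm.trans Additive.ofMul).addCommGroup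

theorem ofGroupLike_mul (x y : GroupLike B (B ⊗[R] H)) :
    ofGroupLike (x * y) = ofGroupLike x + ofGroupLike y := by
  let E := (groupLikeEquiv (R := R) (H := H) (B := B)).symm.trans Additive.ofMul
  have h : ∀ z, E (ofGroupLike z) = Additive.ofMul z := fun z =>
    congrArg Additive.ofMul (groupLikeEquiv.symm_apply_apply z)
  apply E.injective
  have h2 : E (ofGroupLike x + ofGroupLike y) = E (ofGroupLike x) + E (ofGroupLike y) :=
    E.apply_symm_apply _
  rw [h2, h, h, h]
  rfl

/-- `f + g` is the composite of `f ⊗ g` with the transpose `H^⋆ → (H ⊗ H)^⋆` of the multiplication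
of `H`: if `φ (h k) = ∑ α_i(h) β_i(k)`, then `(f + g) φ = ∑ f(α_i) g(β_i)`. -/
theorem add_apply_of_comul (f g : SpfPoints R (CartierDual R H) B) (φ : CartierDual R H)
    {ι : Type*} (s : Finset ι) (α β : ι → CartierDual R H)
    (h : ∀ x y : H, φ.toLin (x * y) = ∑ i ∈ s, (α i).toLin x * (β i).toLin y) :
    (f + g).1 φ = ∑ i ∈ s, f.1 (α i) * g.1 (β i) := by
  obtain ⟨x, rfl⟩ := ofGroupLike_bijective.2 f
  obtain ⟨y, rfl⟩ := ofGroupLike_bijective.2 g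
  rw [← ofGroupLike_mul]
  change pairing B φ.toLin (x.val * y.val) =
    ∑ i ∈ s, pairing B (α i).toLin x.val * pairing B (β i).toLin y.val
  generalize x.val = a
  generalize y.val = b
  induction a with
  | zero => simp
  | add a a' ha ha' => simp only [add_mul, map_add, ha, ha', Finset.sum_add_distrib]
  | tmul c h1 =>
    induction b with
    | zero => simp
    | add a a' ha ha' => simp only [mul_add, map_add, ha, ha', Finset.sum_add_distrib]
    | tmul d h2 =>
      simp only [Algebra.TensorProduct.tmul_mul_tmul, pairing_tmul, h, Finset.sum_smul,
        smul_mul_smul_comm]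

theorem map_ofGroupLike_val (u : B →ₐ[R] C) (x : GroupLike B (B ⊗[R] H))
    (z : GroupLike C (C ⊗[R] H)) (h : ofGroupLike z = SpfPoints.map u (ofGroupLike x)) :
    z.val = Algebra.TensorProduct.map u (AlgHom.id R H) x.val := by
  refine pairing_ext fun φ => ?_
  rw [← map_pairing]
  exact DFunLike.congr_fun (congrArg Subtype.val h) (ofLin φ)

theorem map_add (u : B →ₐ[R] C) (f g : SpfPoints R (CartierDual R H) B) :
    SpfPoints.map u (f + g) = SpfPoints.map u f + SpfPoints.map u g := by
  obtain ⟨x, rfl⟩ := ofGroupLike_bijective.2 f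
  obtain ⟨y, rfl⟩ := ofGroupLike_bijective.2 g
  obtain ⟨x', hx⟩ := ofGroupLike_bijective.2 (SpfPoints.map u (ofGroupLike x))
  obtain ⟨y', hy⟩ := ofGroupLike_bijective.2 (SpfPoints.map u (ofGroupLike y))
  obtain ⟨z', hz⟩ := ofGroupLike_bijective.2 (SpfPoints.map u (ofGroupLike x + ofGroupLike y))
  rw [← hx, ← hy, ← hz, ← ofGroupLike_mul]
  congr 1
  rw [← ofGroupLike_mul] at hz
  refine GroupLike.val_injective ?_
  rw [GroupLike.val_mul, map_ofGroupLike_val u _ _ hx, map_ofGroupLike_val u _ _ hy,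
    map_ofGroupLike_val u _ _ hz, GroupLike.val_mul, map_mul]

end CartierDual

/-- The formal group `Spf H^⋆` over `R` that is the Cartier dual of the affine commutative group
scheme with Hopf algebra `H`. -/
def cartierDual (R H : Type u) [CommRing R] [CommRing H] [HopfAlgebra R H]
    [Coalgebra.IsCocomm R H] [Module.Free R H] : CommAlgCat.{u} R ⥤ AddCommGrpCat.{u} where
  obj B := AddCommGrpCat.of (SpfPoints R (CartierDual R H) B)
  map u := AddCommGrpCat.ofHom (AddMonoidHom.mk' (SpfPoints.map u.hom) (CartierDual.map_add u.hom))
  map_id _ := rfl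
  map_comp _ _ := rfl

end CartierWitt

end

/-!
The dual `Spf H^⋆` of the Witt vectors, with `H = R[a_J]`, is the free commutative formal group on
the pointed formal scheme `Spf R[[t_1, …, t_n]]`. The proof realizes it as the colimit of the
symmetric powers of formal affine space.

*Coordinates.* The map `x ↦ E(x) = ∏ (1 - x_K t^K)` turns addition of Witt vectors into
multiplication of power series (`wittSeries_add`): minus the logarithmic derivative of `E(x)` has
the ghost components of `x` as coefficients, up to integral factors, and in characteristic zero a
power series with constant term `1` is determined by its logarithmic derivative. As every power
series with constant term `1` is `E(x)` for a unique `x`, the coefficients `d_J`, `J ≠ 0`, of the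
universal `E(a)` are polynomial generators of `H` (`dcoordEquiv`), and they satisfy
`Δ d_I = ∑_{J + K = I} d_J ⊗ d_K` (`comul_dcoord`). So `ψ ↦ ∑ ψ(d_J) t^J` is a homomorphism
`H^⋆ → R[[t]]`; it defines the universal pointed morphism `universalMor`.

*Symmetric powers.* Let `T` be the polynomial ring in `t_{i,j}`, `i < e`, `j < n`, truncated by
`t_{i,j}^(e+1) = 0`. The sum of the values of `universalMor` at its `e` tautological points is a
homomorphism `theta : H^⋆ → T`. Since the monomials in the `d_J` are dual to the monomial symmetric
functions (`tcoeff_theta`), `theta` maps `H^⋆` onto the ring of symmetric elements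
(`thetaSym_symSection`). The kernels of these maps are a basis of neighbourhoods of `0`
(`hasBasis_ker_theta`). Hence `H^⋆` is a formal algebra, and every point of `Spf H^⋆` is an image of
one of the points `thetaSym` over the rings of symmetric elements (`exists_factor`).

*Universal property.* A formal group `G` is a Zariski sheaf and locally of the form `Spf A`.
Therefore it maps injections of algebras to injections (`push_injective`) and preserves rings of
invariants (`exists_push_eq`). For a pointed morphism `η` from formal affine space to `G`, the
symmetric element `∑ η(t_i)` of `G(T)` thus comes from a unique element of `G` over the symmetric
elements. These elements are compatible for varying `e`, as `η` maps the base point to `0`, and they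
define the extension of `η` to `Spf H^⋆` (`extend`). Its additivity and its uniqueness can be checked
after the injections into `T` and `T ⊗ T`, where every point in question is a sum of values of
`universalMor`.
-/

noncomputable section

namespace CartierWitt

/-! ### The exponential `E(x) = ∏ (1 - x_K t^K)` of a Witt vector -/

/-- The finite set of non-zero exponents `K ≤ J`. -/
def below {n : ℕ} (J : Fin n →₀ ℕ) : Finset (Idx n) := (Finset.Iic J).subtype (· ≠ 0)

theorem mem_below {n : ℕ} {J : Fin n →₀ ℕ} {K : Idx n} : K ∈ below J ↔ K.1 ≤ J := by
  simp [below]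

section WittSeries

open MvPowerSeries (monomial coeff)

variable {n : ℕ} {B C : Type*} [CommRing B] [CommRing C]

/-- The finite product `∏_{K ∈ S} (1 - x_K t^K)`. -/
def partialProd (x : Idx n → B) (S : Finset (Idx n)) : MvPowerSeries (Fin n) B :=
  ∏ K ∈ S, (1 - monomial K.1 (x K))

theorem coeff_mul_one_sub (p : MvPowerSeries (Fin n) B) (K J : Fin n →₀ ℕ) (b : B) :
    coeff J (p * (1 - monomial K b)) = coeff J p - if K ≤ J then coeff (J - K) p * b else 0 := by
  classical
  rw [mul_sub, mul_one, map_sub, MvPowerSeries.coeff_mul_monomial]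

theorem coeff_partialProd (x : Idx n → B) (J : Fin n →₀ ℕ) {S : Finset (Idx n)}
    (h : below J ⊆ S) : coeff J (partialProd x S) = coeff J (partialProd x (below J)) := by
  classical
  induction S using Finset.strongInduction with
  | _ S ih =>
  by_cases hS : S ⊆ below J
  · rw [hS.antisymm h]
  · obtain ⟨K, hK, hKJ⟩ := Finset.not_subset.1 hS
    rw [mem_below] at hKJ
    have h1 : below J ⊆ S.erase K := fun L hL => Finset.mem_erase.2
      ⟨fun e => hKJ (by rw [← e]; exact mem_below.1 hL), h hL⟩
    rw [← ih _ (Finset.erase_ssubset hK) h1, partialProd, ← Finset.prod_erase_mul _ _ hK,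
      coeff_mul_one_sub, if_neg hKJ, sub_zero]
    rfl

/-- The power series `∏_K (1 - x_K t^K)` attached to a Witt vector; its coefficient at `t^J` only
involves the factors with `K ≤ J`. -/
def wittSeries (x : Idx n → B) : MvPowerSeries (Fin n) B :=
  fun J => coeff J (partialProd x (below J))

theorem coeff_wittSeries (x : Idx n → B) (J : Fin n →₀ ℕ) {S : Finset (Idx n)}
    (h : below J ⊆ S) : coeff J (wittSeries x) = coeff J (partialProd x S) :=
  (coeff_partialProd x J h).symm

theorem map_wittSeries (f : B →+* C) (x : Idx n → B) :
    MvPowerSeries.map f (wittSeries x) = wittSeries fun J => f (x J) := by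
  ext J
  rw [MvPowerSeries.coeff_map, coeff_wittSeries x J subset_rfl, coeff_wittSeries _ J subset_rfl,
    ← MvPowerSeries.coeff_map]
  simp [partialProd, MvPowerSeries.map_monomial]

theorem coeff_zero_partialProd (x : Idx n → B) (S : Finset (Idx n)) :
    coeff 0 (partialProd x S) = 1 := by
  classical
  rw [MvPowerSeries.coeff_zero_eq_constantCoeff, partialProd, map_prod]
  refine Finset.prod_eq_one fun K _ => ?_
  rw [map_sub, map_one, ← MvPowerSeries.coeff_zero_eq_constantCoeff_apply,
    MvPowerSeries.coeff_monomial, if_neg (Ne.symm K.2), sub_zero]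

theorem coeff_zero_wittSeries (x : Idx n → B) : coeff 0 (wittSeries x) = 1 := by
  rw [coeff_wittSeries x 0 subset_rfl, coeff_zero_partialProd]

/-- The coefficient of `E(x)` at `t^J` is `-x_J` plus a polynomial in the `x_K` with `K < J`. -/
theorem coeff_wittSeries_eq (x : Idx n → B) (J : Idx n) :
    coeff J.1 (wittSeries x) = coeff J.1 (partialProd x ((below J.1).erase J)) - x J := by
  classical
  have hJ : J ∈ below J.1 := mem_below.2 le_rfl
  rw [coeff_wittSeries x J.1 subset_rfl, partialProd, ← Finset.prod_erase_mul _ _ hJ,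
    coeff_mul_one_sub, if_pos le_rfl, tsub_self]
  change _ - coeff 0 (partialProd x _) * _ = _
  rw [coeff_zero_partialProd, one_mul]
  rfl

theorem degree_lt_of_mem_below {J K : Idx n} (h : K ∈ (below J.1).erase J) :
    K.1.degree < J.1.degree := by
  rw [Finset.mem_erase, mem_below] at h
  have h1 : K.1 + (J.1 - K.1) = J.1 := add_tsub_cancel_of_le h.2
  have h2 : J.1 - K.1 ≠ 0 := fun h0 => h.1 (Subtype.ext (by rw [h0, add_zero] at h1; exact h1))
  rw [← h1, map_add]
  have := (Finsupp.degree_eq_zero_iff (J.1 - K.1)).not.2 h2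
  omega

theorem wittSeries_injective {x y : Idx n → B} (h : wittSeries x = wittSeries y) : x = y := by
  ext J
  induction hd : J.1.degree using Nat.strong_induction_on generalizing J with
  | _ d ih =>
  subst hd
  have h1 := congrArg (coeff J.1) h
  rw [coeff_wittSeries_eq, coeff_wittSeries_eq] at h1
  have h2 : partialProd x ((below J.1).erase J) = partialProd y ((below J.1).erase J) :=
    Finset.prod_congr rfl fun K hK => by rw [ih _ (degree_lt_of_mem_below hK) K rfl]
  rw [h2] at h1
  exact sub_right_injective h1

/-- The Witt vector `x` for which `E(x)` has the given coefficients `c`. -/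
def wittRoot (c : Idx n → B) (J : Idx n) : B :=
  coeff J.1 (∏ K ∈ ((below J.1).erase J).attach, (1 - monomial K.1.1 (wittRoot c K.1))) - c J
termination_by J.1.degree
decreasing_by exact degree_lt_of_mem_below K.2

theorem coeff_wittSeries_wittRoot (c : Idx n → B) (J : Idx n) :
    coeff J.1 (wittSeries (wittRoot c)) = c J := by
  rw [coeff_wittSeries_eq]
  conv_lhs => rw [wittRoot]
  rw [Finset.prod_attach ((below J.1).erase J) (fun K => 1 - monomial K.1 (wittRoot c K))]
  exact sub_sub_cancel _ _

/-- The Euler derivation `∑ t_i ∂/∂t_i`. -/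
def euler (p : MvPowerSeries (Fin n) B) : MvPowerSeries (Fin n) B :=
  fun J => (J.degree : B) * coeff J p

theorem coeff_euler (p : MvPowerSeries (Fin n) B) (J : Fin n →₀ ℕ) :
    coeff J (euler p) = (J.degree : B) * coeff J p := rfl

theorem euler_mul (p q : MvPowerSeries (Fin n) B) :
    euler (p * q) = euler p * q + p * euler q := by
  classical
  ext J
  rw [coeff_euler, map_add, MvPowerSeries.coeff_mul, MvPowerSeries.coeff_mul,
    MvPowerSeries.coeff_mul, Finset.mul_sum, ← Finset.sum_add_distrib]
  refine Finset.sum_congr rfl fun a ha => ?_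
  rw [coeff_euler, coeff_euler, ← Finset.HasAntidiagonal.mem_antidiagonal.1 ha, map_add]
  push_cast
  ring

theorem euler_one_sub_monomial (K : Fin n →₀ ℕ) (b : B) :
    euler (1 - monomial K b) = - ((K.degree : B) • monomial K b) := by
  classical
  ext J
  rw [coeff_euler, map_sub, map_neg, map_smul, MvPowerSeries.coeff_one,
    MvPowerSeries.coeff_monomial]
  by_cases hJ : J = 0
  · subst hJ
    by_cases h : (0 : Fin n →₀ ℕ) = K
    · subst h; simp
    · simp [h]
  · by_cases h : J = K
    · subst h; simp [hJ]
    · simp [h, hJ]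

/-- The geometric series `∑_{k ≥ 1} x^k t^{kK}`. -/
def geom (K : Idx n) (b : B) : MvPowerSeries (Fin n) B :=
  fun J => if h : J ≠ 0 then ∑ p ∈ (pairs ⟨J, h⟩).filter (fun p => p.2 = K), b ^ p.1 else 0

theorem coeff_geom (K : Idx n) (b : B) (J : Fin n →₀ ℕ) : coeff J (geom K b) =
    if h : J ≠ 0 then ∑ p ∈ (pairs ⟨J, h⟩).filter (fun p => p.2 = K), b ^ p.1 else 0 := rfl

theorem smul_right_inj {K : Idx n} {k l : ℕ} (h : k • K.1 = l • K.1) : k = l := by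
  obtain ⟨i, hi⟩ : ∃ i, K.1 i ≠ 0 := by
    by_contra! h
    exact K.2 (Finsupp.ext h)
  have := DFunLike.congr_fun h i
  simp only [Finsupp.smul_apply, smul_eq_mul] at this
  exact Nat.eq_of_mul_eq_mul_right (Nat.pos_of_ne_zero hi) this

theorem coeff_geom_smul (K : Idx n) (b : B) (k : ℕ) :
    coeff ((k + 1) • K.1) (geom K b) = b ^ (k + 1) := by
  have h : (k + 1) • K.1 ≠ 0 := smul_ne_zero (by omega) K.2
  rw [coeff_geom, dif_pos h]
  have : (pairs ⟨(k + 1) • K.1, h⟩).filter (fun p => p.2 = K) = {(k + 1, K)} := by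
    ext ⟨l, L⟩
    rw [Finset.mem_filter, mem_pairs, Finset.mem_singleton, Prod.mk.injEq]
    constructor
    · rintro ⟨h1, rfl : L = K⟩
      exact ⟨smul_right_inj h1, rfl⟩
    · rintro ⟨rfl, rfl⟩
      exact ⟨rfl, rfl⟩
  rw [this, Finset.sum_singleton]

theorem coeff_geom_eq_zero (K : Idx n) (b : B) (J : Fin n →₀ ℕ)
    (hJ : ∀ k : ℕ, J ≠ (k + 1) • K.1) : coeff J (geom K b) = 0 := by
  rw [coeff_geom]
  split_ifs with h
  · refine Finset.sum_eq_zero fun p hp => ?_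
    rw [Finset.mem_filter] at hp
    have h1 := pos_of_mem_pairs hp.1
    have h2 := mem_pairs.1 hp.1
    rw [hp.2] at h2
    refine absurd h2.symm ?_
    have := hJ (p.1 - 1)
    rwa [Nat.sub_add_cancel h1] at this
  · rfl

theorem geom_mul_one_sub (K : Idx n) (b : B) :
    geom K b * (1 - monomial K.1 b) = monomial K.1 b := by
  classical
  ext J
  rw [coeff_mul_one_sub, MvPowerSeries.coeff_monomial]
  by_cases hJ : ∃ k : ℕ, J = (k + 1) • K.1
  · obtain ⟨k, rfl⟩ := hJ
    have hle : K.1 ≤ (k + 1) • K.1 := by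
      rw [add_smul, one_smul]; exact le_add_self
    have hsub : (k + 1) • K.1 - K.1 = k • K.1 := by
      rw [add_smul, one_smul, add_tsub_cancel_right]
    rw [if_pos hle, hsub, coeff_geom_smul]
    cases k with
    | zero =>
      rw [zero_smul, coeff_geom_eq_zero, zero_mul, sub_zero, if_pos (by simp)]
      · simp
      · intro k h
        exact smul_ne_zero (by omega) K.2 h.symm
    | succ k =>
      rw [coeff_geom_smul, if_neg, ← pow_succ, sub_self]
      intro h
      have := smul_right_inj (h.trans (one_smul ℕ K.1).symm)
      omega
  · push Not at hJ
    have hK : J ≠ K.1 := by simpa using hJ 0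
    rw [coeff_geom_eq_zero K b J hJ, if_neg hK, zero_sub, neg_eq_zero]
    split_ifs with h
    · rw [coeff_geom_eq_zero, zero_mul]
      intro k hk
      refine hJ (k + 1) ?_
      rw [← tsub_add_cancel_of_le h, hk, ← succ_nsmul]
    · rfl

theorem euler_partialProd (x : Idx n → B) (S : Finset (Idx n)) : euler (partialProd x S) =
    - (partialProd x S * ∑ K ∈ S, (K.1.degree : B) • geom K (x K)) := by
  classical
  induction S using Finset.induction_on with
  | empty =>
    ext J
    simp only [partialProd, Finset.prod_empty, Finset.sum_empty, mul_zero, neg_zero, map_zero,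
      coeff_euler, MvPowerSeries.coeff_one]
    split_ifs with h
    · simp [h]
    · simp
  | insert K S hK ih =>
    have e : partialProd x (insert K S) = (1 - monomial K.1 (x K)) * partialProd x S :=
      Finset.prod_insert hK
    rw [e, euler_mul, ih, Finset.sum_insert hK, euler_one_sub_monomial]
    have h := geom_mul_one_sub K (x K)
    simp only [Algebra.smul_def]
    linear_combination (algebraMap B (MvPowerSeries (Fin n) B) K.1.degree *
      partialProd x S) * h

/-- Minus the logarithmic derivative of `E(x)`, with coefficients `∑_{kJ = I} |J| x_J^k`. -/
def logDeriv (x : Idx n → B) : MvPowerSeries (Fin n) B :=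
  fun I => if h : I ≠ 0 then ∑ p ∈ pairs ⟨I, h⟩, (p.2.1.degree : B) * x p.2 ^ p.1 else 0

theorem coeff_zero_logDeriv (x : Idx n → B) : coeff 0 (logDeriv x) = 0 := by
  have h : coeff 0 (logDeriv x) = if h : (0 : Fin n →₀ ℕ) ≠ 0 then
    ∑ p ∈ pairs ⟨0, h⟩, (p.2.1.degree : B) * x p.2 ^ p.1 else 0 := rfl
  rw [h, dif_neg (by simp)]

theorem coeff_logDeriv (x : Idx n → B) (I : Idx n) :
    coeff I.1 (logDeriv x) = ∑ p ∈ pairs I, (p.2.1.degree : B) * x p.2 ^ p.1 :=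
  dif_pos I.2

/-- Up to the factor `|I| / gcd(I)`, the coefficients of the logarithmic derivative of `E(x)` are
the ghost components of `x`. -/
theorem gcdIdx_mul_coeff_logDeriv (x : Idx n → B) (I : Idx n) :
    (gcdIdx I : B) * coeff I.1 (logDeriv x) = (I.1.degree : B) * ghost x I := by
  rw [coeff_logDeriv, ghost, Finset.mul_sum, Finset.mul_sum]
  refine Finset.sum_congr rfl fun p hp => ?_
  have h := mem_pairs.1 hp
  rw [gcdIdx_smul h, ← h, map_nsmul]
  simp only [smul_eq_mul]
  push_cast
  ring

theorem coeff_sum_geom (x : Idx n → B) (J : Fin n →₀ ℕ) {S : Finset (Idx n)} (h : below J ⊆ S) :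
    coeff J (∑ K ∈ S, (K.1.degree : B) • geom K (x K)) = coeff J (logDeriv x) := by
  classical
  rw [map_sum]
  by_cases hJ : J = 0
  · subst hJ
    rw [coeff_zero_logDeriv]
    refine Finset.sum_eq_zero fun K _ => ?_
    rw [map_smul, coeff_geom, dif_neg (by simp), smul_zero]
  · have e := coeff_logDeriv x ⟨J, hJ⟩
    refine Eq.trans ?_ e.symm
    have hmaps : ∀ p ∈ pairs ⟨J, hJ⟩, p.2 ∈ S := by
      intro p hp
      refine h (mem_below.2 ?_)
      have h1 := pos_of_mem_pairs hp
      have h2 : p.1 • p.2.1 = J := mem_pairs.1 hp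
      rw [← h2]
      intro j
      simpa using Nat.le_mul_of_pos_left (p.2.1 j) h1
    rw [← Finset.sum_fiberwise_of_maps_to hmaps]
    refine Finset.sum_congr rfl fun K _ => ?_
    rw [map_smul, coeff_geom, dif_pos hJ, smul_eq_mul, Finset.mul_sum]
    refine Finset.sum_congr rfl fun p hp => ?_
    rw [(Finset.mem_filter.1 hp).2]

theorem below_mono {J K : Fin n →₀ ℕ} (h : J ≤ K) : below J ⊆ below K := fun _ hL =>
  mem_below.2 ((mem_below.1 hL).trans h)

theorem euler_wittSeries (x : Idx n → B) :
    euler (wittSeries x) = - (wittSeries x * logDeriv x) := by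
  classical
  ext I
  rw [coeff_euler, coeff_wittSeries x I subset_rfl, ← coeff_euler, euler_partialProd, map_neg,
    map_neg, MvPowerSeries.coeff_mul, MvPowerSeries.coeff_mul]
  congr 1
  refine Finset.sum_congr rfl fun a ha => ?_
  have h := Finset.HasAntidiagonal.mem_antidiagonal.1 ha
  rw [coeff_sum_geom x a.2 (below_mono (h ▸ le_add_self)),
    coeff_wittSeries x a.1 (below_mono (h ▸ le_self_add))]

/-- In characteristic zero a power series with constant coefficient `1` is determined by its
logarithmic derivative. -/
theorem eq_of_euler_eq [IsDomain B] [CharZero B] {p q l : MvPowerSeries (Fin n) B}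
    (h0 : coeff 0 p = coeff 0 q) (hl : coeff 0 l = 0)
    (hp : euler p = - (p * l)) (hq : euler q = - (q * l)) : p = q := by
  classical
  ext I
  induction hd : I.degree using Nat.strong_induction_on generalizing I with
  | _ d ih =>
  subst hd
  by_cases hI : I = 0
  · rw [hI, h0]
  have h1 := congrArg (coeff I) hp
  have h2 := congrArg (coeff I) hq
  rw [coeff_euler, map_neg, MvPowerSeries.coeff_mul] at h1 h2
  refine mul_left_cancel₀ (Nat.cast_ne_zero.2 ((Finsupp.degree_eq_zero_iff I).not.2 hI))
    (h1.trans (Eq.trans ?_ h2.symm))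
  congr 1
  refine Finset.sum_congr rfl fun a ha => ?_
  have h := Finset.HasAntidiagonal.mem_antidiagonal.1 ha
  by_cases ha2 : a.2 = 0
  · rw [ha2, hl, mul_zero, mul_zero]
  · rw [ih a.1.degree ?_ a.1 rfl]
    have := (Finsupp.degree_eq_zero_iff a.2).not.2 ha2
    rw [← h, map_add]
    omega

theorem wittSeries_add_of_charZero [IsDomain B] [CharZero B] (x y : Witt n B) :
    wittSeries (x + y).coeff = wittSeries x.coeff * wittSeries y.coeff := by
  refine eq_of_euler_eq ?_ (coeff_zero_logDeriv (x + y).coeff) (euler_wittSeries _) ?_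
  · have h := fun z : Witt n B => coeff_zero_wittSeries z.coeff
    simp only [MvPowerSeries.coeff_zero_eq_constantCoeff_apply] at h ⊢
    rw [map_mul, h, h, h, mul_one]
  · have h : logDeriv (x + y).coeff = logDeriv x.coeff + logDeriv y.coeff := by
      ext I
      rw [map_add]
      by_cases hI : I = 0
      · subst hI
        simp only [coeff_zero_logDeriv, add_zero]
      · refine mul_left_cancel₀ (Nat.cast_ne_zero.2 (gcdIdx_pos (⟨I, hI⟩ : Idx n)).ne') ?_
        rw [mul_add]
        have e := fun z : Idx n → B => gcdIdx_mul_coeff_logDeriv z ⟨I, hI⟩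
        refine (e _).trans (Eq.trans ?_ (congrArg₂ _ (e _) (e _)).symm)
        rw [Witt.ghost_add, mul_add]
    rw [h, euler_mul, euler_wittSeries, euler_wittSeries]
    ring

/-- `E` turns the addition of Witt vectors into the multiplication of power series. -/
theorem wittSeries_add (x y : Witt n B) :
    wittSeries (x + y).coeff = wittSeries x.coeff * wittSeries y.coeff := by
  have h := congrArg (MvPowerSeries.map (Witt.spec ![x, y]))
    (wittSeries_add_of_charZero (Witt.univ n (Fin 2) 0) (Witt.univ n (Fin 2) 1))
  have e : ∀ z : Witt n (MvPolynomial (Fin 2 × Idx n) ℤ),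
      MvPowerSeries.map (Witt.spec ![x, y]) (wittSeries z.coeff) =
        wittSeries (Witt.map (Witt.spec ![x, y]) z).coeff := fun z => map_wittSeries _ _
  rw [map_mul, e, e, e, Witt.map_add', Witt.map_spec, Witt.map_spec] at h
  exact h

end WittSeries

/-! ### Polynomial coordinates of the Hopf algebra with simple comultiplication -/

section Coordinates

variable (R : Type u) [CommRing R] (n : ℕ)

/-- The coefficient `d_J` of `E(a)`, for the universal Witt vector `a` over `R[a_J]`. -/
def dcoord (J : Fin n →₀ ℕ) : WittCoord R n :=
  MvPowerSeries.coeff J (wittSeries (WittCoord.gen R n).coeff)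

theorem dcoord_zero : dcoord R n 0 = 1 := coeff_zero_wittSeries _

variable {R n} in
theorem map_dcoord {B : Type*} [CommRing B] (f : WittCoord R n →+* B)
    (J : Fin n →₀ ℕ) :
    f (dcoord R n J) = MvPowerSeries.coeff J (wittSeries (Witt.map f (WittCoord.gen R n)).coeff) := by
  rw [dcoord, ← MvPowerSeries.coeff_map, map_wittSeries]
  rfl

theorem comul_dcoord (I : Fin n →₀ ℕ) : Coalgebra.comul (R := R) (dcoord R n I) =
    ∑ p ∈ Finset.HasAntidiagonal.antidiagonal I, dcoord R n p.1 ⊗ₜ[R] dcoord R n p.2 := by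
  classical
  have h := map_dcoord (WittCoord.comulHom R n).toRingHom I
  rw [WittCoord.comulHom, WittCoord.map_lift, wittSeries_add, MvPowerSeries.coeff_mul] at h
  refine h.trans (Finset.sum_congr rfl fun p _ => ?_)
  rw [← map_dcoord, ← map_dcoord]
  simp

theorem counit_dcoord (I : Fin n →₀ ℕ) [Decidable (I = 0)] :
    Coalgebra.counit (R := R) (dcoord R n I) = if I = 0 then 1 else 0 := by
  have h := map_dcoord (WittCoord.counitHom R n).toRingHom I
  refine h.trans ?_
  rw [WittCoord.counitHom, WittCoord.map_lift]
  have e : wittSeries (0 : Witt n R).coeff = 1 := by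
    have h1 := wittSeries_add (0 : Witt n R) 0
    have h2 : IsUnit (wittSeries (0 : Witt n R).coeff) := by
      rw [MvPowerSeries.isUnit_iff_constantCoeff, ← MvPowerSeries.coeff_zero_eq_constantCoeff_apply,
        coeff_zero_wittSeries]
      exact isUnit_one
    rw [add_zero] at h1
    exact (h2.mul_eq_left.1 h1.symm)
  classical
  rw [e, MvPowerSeries.coeff_one]
  congr

/-- The homomorphism from the polynomial ring that evaluates the variables at the `d_J`. -/
def dcoordHom : MvPolynomial (Idx n) R →ₐ[R] WittCoord R n :=
  MvPolynomial.aeval fun J => dcoord R n J.1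

/-- The inverse of `dcoordHom`. -/
def dcoordInv : WittCoord R n →ₐ[R] MvPolynomial (Idx n) R :=
  WittCoord.lift ⟨wittRoot MvPolynomial.X⟩

theorem dcoordInv_dcoord (J : Idx n) : dcoordInv R n (dcoord R n J.1) = MvPolynomial.X J := by
  refine (map_dcoord (dcoordInv R n).toRingHom J.1).trans ?_
  rw [dcoordInv, WittCoord.map_lift, coeff_wittSeries_wittRoot]

theorem wittSeries_ext {B : Type*} [CommRing B] {x y : Witt n B}
    (h : ∀ J : Idx n, MvPowerSeries.coeff J.1 (wittSeries x.coeff) =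
      MvPowerSeries.coeff J.1 (wittSeries y.coeff)) : x = y := by
  refine Witt.ext (wittSeries_injective (MvPowerSeries.ext fun J => ?_))
  by_cases hJ : J = 0
  · rw [hJ, coeff_zero_wittSeries, coeff_zero_wittSeries]
  · exact h ⟨J, hJ⟩

/-- `R[a_J]` is a polynomial ring in the `d_J` with `J ≠ 0`, because a Witt vector `x` can be
recovered from the coefficients of `E(x)`, which may be arbitrary. -/
def dcoordEquiv : MvPolynomial (Idx n) R ≃ₐ[R] WittCoord R n :=
  AlgEquiv.ofAlgHom (dcoordHom R n) (dcoordInv R n)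
    (WittCoord.hom_ext (wittSeries_ext n fun J => by
      rw [← map_dcoord, ← map_dcoord]
      change dcoordHom R n (dcoordInv R n (dcoord R n J.1)) = dcoord R n J.1
      rw [dcoordInv_dcoord]
      exact MvPolynomial.aeval_X _ J))
    (MvPolynomial.algHom_ext fun J => by
      change dcoordInv R n (dcoordHom R n (MvPolynomial.X J)) = MvPolynomial.X J
      rw [dcoordHom, MvPolynomial.aeval_X, dcoordInv_dcoord])

/-- The basis of `R[a_J]` that consists of the monomials in the `d_J`. -/
def dbasis : Module.Basis (Idx n →₀ ℕ) R (WittCoord R n) :=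
  (MvPolynomial.basisMonomials (Idx n) R).map (dcoordEquiv R n).toLinearEquiv

theorem dbasis_add (M N : Idx n →₀ ℕ) :
    dbasis R n (M + N) = dbasis R n M * dbasis R n N := by
  simp only [dbasis, Module.Basis.map_apply, MvPolynomial.coe_basisMonomials]
  change dcoordEquiv R n _ = dcoordEquiv R n _ * dcoordEquiv R n _
  rw [← map_mul, MvPolynomial.monomial_mul, one_mul]

theorem dbasis_zero : dbasis R n 0 = 1 := by
  simp only [dbasis, Module.Basis.map_apply, MvPolynomial.coe_basisMonomials]
  exact map_one (dcoordEquiv R n)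

theorem dbasis_single (J : Idx n) : dbasis R n (Finsupp.single J 1) = dcoord R n J.1 := by
  refine Eq.trans ?_ (MvPolynomial.aeval_X (R := R) (fun J : Idx n => dcoord R n J.1) J)
  simp only [dbasis, Module.Basis.map_apply, MvPolynomial.coe_basisMonomials]
  rfl

variable {n} in
/-- The multiset of the non-zero entries of a tuple of exponents, as a finitely supported
function. -/
def mult {e : ℕ} (τ : Fin e → Fin n →₀ ℕ) : Idx n →₀ ℕ :=
  ∑ i, if h : τ i ≠ 0 then Finsupp.single ⟨τ i, h⟩ 1 else 0

theorem dbasis_mult {e : ℕ} (τ : Fin e → Fin n →₀ ℕ) :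
    dbasis R n (mult τ) = ∏ i, dcoord R n (τ i) := by
  have h : ∀ s : Finset (Fin e), dbasis R n
      (∑ i ∈ s, if h : τ i ≠ 0 then Finsupp.single ⟨τ i, h⟩ 1 else 0) =
        ∏ i ∈ s, dcoord R n (τ i) := by
    classical
    intro s
    induction s using Finset.induction_on with
    | empty => exact dbasis_zero R n
    | insert i s hi ih =>
      rw [Finset.sum_insert hi, Finset.prod_insert hi, dbasis_add, ih]
      congr 1
      split_ifs with h
      · exact dbasis_single R n _
      · rw [not_not.1 h, dbasis_zero, dcoord_zero]
  exact h _

variable {n}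

theorem mult_apply {e : ℕ} (τ : Fin e → Fin n →₀ ℕ) (J : Idx n) [DecidableEq (Fin n →₀ ℕ)] :
    mult τ J = (Finset.univ.filter fun i => τ i = J.1).card := by
  classical
  rw [mult, Finsupp.finsetSum_apply, Finset.card_filter]
  refine Finset.sum_congr rfl fun i _ => ?_
  split_ifs with h1 h2 h2
  · rw [Finsupp.single_apply, if_pos (Subtype.ext h2)]
  · rw [Finsupp.single_apply, if_neg fun h => h2 (congrArg Subtype.val h)]
  · exact absurd (h2 ▸ J.2) h1
  · rfl

/-- Two tuples with the same non-zero entries differ by a permutation. -/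
theorem exists_perm_of_mult_eq {e : ℕ} {τ τ' : Fin e → Fin n →₀ ℕ} (h : mult τ = mult τ') :
    ∃ σ : Equiv.Perm (Fin e), ∀ i, τ' (σ i) = τ i := by
  classical
  have key : ∀ J, (Finset.univ.filter fun i => τ i = J).card =
      (Finset.univ.filter fun i => τ' i = J).card := by
    have h0 : ∀ J, J ≠ 0 → (Finset.univ.filter fun i => τ i = J).card =
        (Finset.univ.filter fun i => τ' i = J).card := fun J hJ => by
      rw [← mult_apply τ ⟨J, hJ⟩, ← mult_apply τ' ⟨J, hJ⟩, h]
    intro J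
    by_cases hJ : J = 0
    · subst hJ
      let A := Finset.univ.image τ ∪ Finset.univ.image τ' ∪ {0}
      have h1 : ∑ J ∈ A, (Finset.univ.filter fun i => τ i = J).card = e := by
        rw [← Finset.card_eq_sum_card_fiberwise (fun i _ => by simp [A]), Finset.card_univ,
          Fintype.card_fin]
      have h2 : ∑ J ∈ A, (Finset.univ.filter fun i => τ' i = J).card = e := by
        rw [← Finset.card_eq_sum_card_fiberwise (fun i _ => by simp [A]), Finset.card_univ,
          Fintype.card_fin]
      have hA : (0 : Fin n →₀ ℕ) ∈ A := by simp [A]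
      rw [← Finset.add_sum_erase _ _ hA] at h1 h2
      rw [Finset.sum_congr rfl fun J hJ => h0 J (Finset.ne_of_mem_erase hJ)] at h1
      omega
    · exact h0 J hJ
  have e1 : ∀ J, Nonempty ({i // τ i = J} ≃ {i // τ' i = J}) := fun J => by
    refine Fintype.card_eq.1 ?_
    rw [Fintype.card_subtype, Fintype.card_subtype, key]
  let σ : Equiv.Perm (Fin e) := (Equiv.sigmaFiberEquiv τ).symm.trans
    ((Equiv.sigmaCongrRight fun J => (e1 J).some).trans (Equiv.sigmaFiberEquiv τ'))
  refine ⟨σ, fun i => ?_⟩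
  exact ((e1 (τ i)).some ⟨i, rfl⟩).2

variable (n) in
/-- The exponents `J` with all entries at most `e`. -/
def box (e : ℕ) : Finset (Fin n →₀ ℕ) := Finset.Iic (Finsupp.equivFunOnFinite.symm fun _ => e)

theorem mem_box {e : ℕ} {J : Fin n →₀ ℕ} : J ∈ box n e ↔ ∀ j, J j ≤ e := by
  simp only [box, Finset.mem_Iic]
  exact Iff.rfl

theorem box_mono {e e' : ℕ} (h : e ≤ e') : box n e ⊆ box n e' := fun _ hJ =>
  mem_box.2 fun j => (mem_box.1 hJ j).trans h

theorem zero_mem_box (e : ℕ) : 0 ∈ box n e := mem_box.2 fun _ => Nat.zero_le _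

theorem exists_mult_eq_mono {e e' : ℕ} (h : e ≤ e') {M : Idx n →₀ ℕ}
    (hM : ∃ τ : Fin e → Fin n →₀ ℕ, (∀ i, τ i ∈ box n e) ∧ mult τ = M) :
    ∃ τ : Fin e' → Fin n →₀ ℕ, (∀ i, τ i ∈ box n e') ∧ mult τ = M := by
  induction e', h using Nat.le_induction with
  | base => exact hM
  | succ e' h ih =>
    obtain ⟨τ, h1, h2⟩ := ih
    refine ⟨Fin.cons 0 τ, fun i => ?_, ?_⟩
    · refine Fin.cases (zero_mem_box _) (fun i => ?_) i
      exact box_mono (Nat.le_succ _) (h1 i)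
    · unfold mult at h2 ⊢
      rw [Fin.sum_univ_succ]
      simpa using h2

/-- Every monomial in the `d_J` comes from a tuple of exponents. -/
theorem exists_mult_eq (M : Idx n →₀ ℕ) :
    ∃ e, ∃ τ : Fin e → Fin n →₀ ℕ, (∀ i, τ i ∈ box n e) ∧ mult τ = M := by
  have h : ∃ e, ∃ τ : Fin e → Fin n →₀ ℕ, mult τ = M := by
    induction M using Finsupp.induction_linear with
    | zero => exact ⟨0, Fin.elim0, by simp [mult]⟩
    | add f g hf hg =>
      obtain ⟨e, τ, rfl⟩ := hf
      obtain ⟨e', τ', rfl⟩ := hg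
      refine ⟨e + e', Fin.append τ τ', ?_⟩
      unfold mult
      rw [Fin.sum_univ_add]
      simp
    | single J k =>
      refine ⟨k, fun _ => J.1, ?_⟩
      simp [mult, J.2]
  obtain ⟨e, τ, rfl⟩ := h
  let m := Finset.univ.sup fun i => Finset.univ.sup (τ i)
  have hm : ∀ e', m ≤ e' → ∀ i, τ i ∈ box n e' := fun e' he' i => mem_box.2 fun j =>
    (Finset.le_sup (f := τ i) (Finset.mem_univ j)).trans
      ((Finset.le_sup (f := fun i => Finset.univ.sup (τ i)) (Finset.mem_univ i)).trans he')
  refine ⟨m + e, Fin.append (fun _ : Fin m => 0) τ, fun i => ?_, ?_⟩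
  · refine Fin.addCases (fun i => ?_) (fun i => ?_) i
    · rw [Fin.append_left]; exact zero_mem_box _
    · rw [Fin.append_right]; exact hm _ (Nat.le_add_right _ _) i
  · unfold mult
    rw [Fin.sum_univ_add]
    simp

theorem exists_forall_mult_eq (K : Finset (Idx n →₀ ℕ)) :
    ∃ e, ∀ e', e ≤ e' → ∀ M ∈ K, ∃ τ : Fin e' → Fin n →₀ ℕ,
      (∀ i, τ i ∈ box n e') ∧ mult τ = M := by
  choose e he using exists_mult_eq (n := n)
  exact ⟨K.sup e, fun e' h M hM => exists_mult_eq_mono ((Finset.le_sup hM).trans h) (he M)⟩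

end Coordinates

/-! ### The topology of the Cartier dual -/

namespace CartierDual

variable {R H : Type u} [CommRing R] [CommRing H] [HopfAlgebra R H] [Coalgebra.IsCocomm R H]

theorem toLin_mul (φ ψ : CartierDual R H) (h : H) : (φ * ψ).toLin h =
    LinearMap.mul' R R (TensorProduct.map φ.toLin ψ.toLin (Coalgebra.comul h)) := rfl

/-- Evaluation of linear forms, as a homomorphism to the functions on `H`. -/
def evalHom : CartierDual R H →+ (H → R) where
  toFun φ h := φ.toLin h
  map_zero' := rfl
  map_add' _ _ := rfl

theorem mem_nhds_zero_iff {U : Set (CartierDual R H)} : U ∈ nhds (0 : CartierDual R H) ↔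
    ∃ T : Finset H, ∀ φ : CartierDual R H, (∀ h ∈ T, φ.toLin h = 0) → φ ∈ U := by
  let : TopologicalSpace R := ⊥
  have : DiscreteTopology R := ⟨rfl⟩
  rw [nhds_induced, Filter.mem_comap]
  constructor
  · rintro ⟨V, hV, hVU⟩
    rw [nhds_pi, Filter.mem_pi'] at hV
    obtain ⟨T, W, hW, hTW⟩ := hV
    refine ⟨T, fun φ hφ => hVU (hTW fun h hh => ?_)⟩
    change φ.toLin h ∈ W h
    rw [hφ h hh]
    exact mem_of_mem_nhds (hW h)
  · rintro ⟨T, hT⟩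
    refine ⟨(T : Set H).pi fun _ => {0}, ?_, fun φ hφ => hT φ fun h hh => hφ h hh⟩
    refine set_pi_mem_nhds T.finite_toSet fun h _ => ?_
    exact (isOpen_discrete _).mem_nhds (by exact rfl)

instance isTopologicalRing : IsTopologicalRing (CartierDual R H) := by
  let : TopologicalSpace R := ⊥
  have : DiscreteTopology R := ⟨rfl⟩
  have he : ∀ h : H, Continuous fun φ : CartierDual R H => φ.toLin h := fun h =>
    (continuous_apply h).comp continuous_induced_dom
  have hadd : ContinuousAdd (CartierDual R H) :=
    ⟨continuous_induced_rng.2 (continuous_pi fun h =>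
      ((he h).comp continuous_fst).add ((he h).comp continuous_snd))⟩
  have hmul : ContinuousMul (CartierDual R H) := by
    refine ⟨continuous_induced_rng.2 (continuous_pi fun h => ?_)⟩
    have h1 : ∀ z : H ⊗[R] H, Continuous fun p : CartierDual R H × CartierDual R H =>
        LinearMap.mul' R R (TensorProduct.map p.1.toLin p.2.toLin z) := by
      intro z
      induction z with
      | zero => simpa using continuous_const
      | add x y hx hy =>
        simp only [_root_.map_add]
        exact hx.add hy
      | tmul x y =>
        simp only [TensorProduct.map_tmul, LinearMap.mul'_apply]
        exact ((he x).comp continuous_fst).mul ((he y).comp continuous_snd)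
    exact h1 _
  have hneg : ContinuousNeg (CartierDual R H) :=
    ⟨continuous_induced_rng.2 (continuous_pi fun h => (he h).neg)⟩
  exact { hadd, hmul, hneg with }

/-- A homomorphism to a discrete algebra is continuous if it only depends on finitely many values
of the linear form. -/
theorem continuous_of_finset {B : Type*} [CommRing B] [Algebra R B] (f : CartierDual R H →ₐ[R] B)
    (T : Finset H) (hT : ∀ φ : CartierDual R H, (∀ h ∈ T, φ.toLin h = 0) → f φ = 0) :
    @Continuous _ B _ ⊥ f := by
  let : TopologicalSpace B := ⊥
  have : DiscreteTopology B := ⟨rfl⟩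
  refine continuous_of_continuousAt_zero f ?_
  rw [ContinuousAt, map_zero, nhds_discrete B, Filter.tendsto_pure]
  exact mem_nhds_zero_iff.2 ⟨T, hT⟩

theorem ofGroupLike_one [Module.Free R H] {B : Type u} [CommRing B] [Algebra R B] :
    ofGroupLike (1 : GroupLike B (B ⊗[R] H)) = 0 := by
  have h := ofGroupLike_mul (1 : GroupLike B (B ⊗[R] H)) 1
  rw [mul_one] at h
  exact left_eq_add.1 h

theorem ofGroupLike_prod [Module.Free R H] {B : Type u} [CommRing B] [Algebra R B] {κ : Type*}
    (s : Finset κ) (x : κ → GroupLike B (B ⊗[R] H)) :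
    ofGroupLike (∏ i ∈ s, x i) = ∑ i ∈ s, ofGroupLike (x i) := by
  classical
  induction s using Finset.induction_on with
  | empty => exact ofGroupLike_one
  | insert i s hi ih => rw [Finset.prod_insert hi, Finset.sum_insert hi, ofGroupLike_mul, ih]

end CartierDual

/-! ### Points of formal affine space -/

section Points

variable {R : Type u} [CommRing R] {n : ℕ}

theorem aeval_eq_zero_of_coeff {σ : Type*} {B : Type*} [CommRing B] [Algebra R B] (b : σ → B)
    (m : ℕ) (hb : ∀ i, b i ^ (m + 1) = 0) (q : MvPolynomial σ R)
    (hq : ∀ J : σ →₀ ℕ, (∀ i, J i ≤ m) → MvPolynomial.coeff J q = 0) :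
    MvPolynomial.aeval b q = 0 := by
  rw [MvPolynomial.aeval_def, MvPolynomial.eval₂_eq]
  refine Finset.sum_eq_zero fun J hJ => ?_
  obtain ⟨i, hi⟩ : ∃ i, m < J i := by
    by_contra! h
    exact (MvPolynomial.mem_support_iff.1 hJ) (hq J h)
  have h1 : i ∈ J.support := Finsupp.mem_support_iff.2 (by omega)
  rw [Finset.prod_eq_zero h1, mul_zero]
  rw [← Nat.sub_add_cancel (Nat.succ_le_of_lt hi), pow_add]
  change _ * b i ^ (m + 1) = 0
  rw [hb, mul_zero]

/-- A power series without small monomials lies in the ideal of the powers of the variables. -/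
theorem mem_span_X_pow (m : ℕ) (p : MvPowerSeries (Fin n) R)
    (hp : ∀ J ∈ box n m, MvPowerSeries.coeff J p = 0) :
    p ∈ Ideal.span (Set.range fun i : Fin n =>
      (MvPowerSeries.X i : MvPowerSeries (Fin n) R) ^ (m + 1)) := by
  classical
  let c : (Fin n →₀ ℕ) → Option (Fin n) := fun J =>
    if h : ∃ i, m < J i then some h.choose else none
  let q : Fin n → MvPowerSeries (Fin n) R := fun i J =>
    if c J = some i then MvPowerSeries.coeff J p else 0
  have hq : ∀ i J, MvPowerSeries.coeff J (q i) =
    if c J = some i then MvPowerSeries.coeff J p else 0 := fun _ _ => rfl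
  have hsum : p = ∑ i, q i := by
    ext J
    rw [map_sum, Finset.sum_congr rfl fun i _ => hq i J]
    by_cases h : ∃ i, m < J i
    · have hc : c J = some h.choose := dif_pos h
      simp [hc]
    · have hc : c J = none := dif_neg h
      push Not at h
      simp [hc, hp J (mem_box.2 h)]
  rw [hsum]
  refine Ideal.sum_mem _ fun i _ => ?_
  have hdvd : (MvPowerSeries.X i : MvPowerSeries (Fin n) R) ^ (m + 1) ∣ q i := by
    rw [MvPowerSeries.X_pow_dvd_iff]
    intro J hJ
    rw [hq, if_neg]
    intro hc
    by_cases h : ∃ i, m < J i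
    · have hc' : c J = some h.choose := dif_pos h
      rw [hc'] at hc
      have := h.choose_spec
      rw [Option.some.inj hc] at this
      omega
    · have hc' : c J = none := dif_neg h
      rw [hc'] at hc
      exact absurd hc (by simp)
  exact Ideal.mem_of_dvd _ hdvd (Ideal.subset_span ⟨i, rfl⟩)

variable (R n) in
/-- The `B`-points of formal affine `n`-space over `R`. -/
abbrev AffinePoints (B : Type u) [CommRing B] [Algebra R B] : Type u :=
  @SpfPoints R (MvPowerSeries (Fin n) R) B _ _ _ (powerSeriesTopology R n) _ _

variable {B C : Type u} [CommRing B] [Algebra R B] [CommRing C] [Algebra R C]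

theorem continuous_of_isNilpotent (f : MvPowerSeries (Fin n) R →ₐ[R] B)
    (hf : ∀ i, IsNilpotent (f (MvPowerSeries.X i))) :
    @Continuous _ B (powerSeriesTopology R n) ⊥ f := by
  let I : Ideal (MvPowerSeries (Fin n) R) := Ideal.span (Set.range MvPowerSeries.X)
  let : TopologicalSpace (MvPowerSeries (Fin n) R) := I.adicTopology
  let : TopologicalSpace B := ⊥
  have : DiscreteTopology B := ⟨rfl⟩
  have : NonarchimedeanRing (MvPowerSeries (Fin n) R) := I.nonarchimedean
  refine continuous_of_continuousAt_zero f ?_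
  rw [ContinuousAt, map_zero, nhds_discrete B, Filter.tendsto_pure]
  have h1 : I.map f ≤ nilradical B := by
    rw [Ideal.map_span, Ideal.span_le]
    rintro _ ⟨_, ⟨i, rfl⟩, rfl⟩
    exact hf i
  have h2 : (I.map f).FG := by
    rw [Ideal.map_span]
    exact Submodule.fg_span ((Set.finite_range _).image _)
  obtain ⟨k, hk⟩ := (Ideal.FG.isNilpotent_iff_le_nilradical h2).2 h1
  refine Filter.mem_of_superset (I.hasBasis_nhds_zero_adic.mem_of_mem (i := k) trivial) ?_
  intro p hp
  have h3 : f p ∈ (I ^ k).map f := Ideal.mem_map_of_mem _ hp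
  rw [Ideal.map_pow, hk] at h3
  exact h3

theorem AffinePoints.isNilpotent (f : AffinePoints R n B) (i : Fin n) :
    IsNilpotent (f.1 (MvPowerSeries.X i)) := by
  let I : Ideal (MvPowerSeries (Fin n) R) := Ideal.span (Set.range MvPowerSeries.X)
  let : TopologicalSpace (MvPowerSeries (Fin n) R) := I.adicTopology
  let : TopologicalSpace B := ⊥
  have : DiscreteTopology B := ⟨rfl⟩
  have hf : Continuous f.1 := f.2
  have h0 : f.1 ⁻¹' {0} ∈ nhds (0 : MvPowerSeries (Fin n) R) :=
    (isOpen_discrete ({0} : Set B)).preimage hf |>.mem_nhds (map_zero f.1)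
  obtain ⟨k, -, hk⟩ := I.hasBasis_nhds_zero_adic.mem_iff.1 h0
  refine ⟨k, ?_⟩
  rw [← map_pow]
  exact hk (Ideal.pow_mem_pow (Ideal.subset_span (Set.mem_range_self i)) k)

/-- Finitely many points of formal affine space have coordinates of bounded nilpotency. -/
theorem AffinePoints.exists_pow_eq_zero {κ : Type*} [Finite κ] (f : κ → AffinePoints R n B) :
    ∃ m, ∀ m', m ≤ m' → ∀ i j, (f i).1 (MvPowerSeries.X j) ^ (m' + 1) = 0 := by
  have := Fintype.ofFinite κ
  choose k hk using fun (p : κ × Fin n) => AffinePoints.isNilpotent (f p.1) p.2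
  refine ⟨Finset.univ.sup k, fun m' h i j => pow_eq_zero_of_le ?_ (hk (i, j))⟩
  exact ((Finset.le_sup (Finset.mem_univ (i, j))).trans h).trans (Nat.le_succ _)

theorem AffinePoints.apply_eq (f : AffinePoints R n B) (m : ℕ)
    (hm : ∀ j, f.1 (MvPowerSeries.X j) ^ (m + 1) = 0) (p : MvPowerSeries (Fin n) R) :
    f.1 p = ∑ J ∈ box n m, MvPowerSeries.coeff J p • ∏ j, f.1 (MvPowerSeries.X j) ^ J j := by
  classical
  let q : MvPolynomial (Fin n) R := ∑ J ∈ box n m,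
    MvPolynomial.monomial J (MvPowerSeries.coeff J p)
  have h1 : f.1 (p - (q : MvPowerSeries (Fin n) R)) = 0 := by
    have h := mem_span_X_pow m (p - (q : MvPowerSeries (Fin n) R)) fun J hJ => by
      rw [map_sub, MvPolynomial.coeff_coe, sub_eq_zero]
      simp [q, MvPolynomial.coeff_sum, MvPolynomial.coeff_monomial, hJ]
    have h2 : Ideal.span (Set.range fun i : Fin n =>
      (MvPowerSeries.X i : MvPowerSeries (Fin n) R) ^ (m + 1)) ≤ RingHom.ker f.1 := by
      rw [Ideal.span_le]
      rintro _ ⟨i, rfl⟩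
      change f.1 _ = 0
      rw [map_pow, hm]
    exact h2 h
  rw [map_sub, sub_eq_zero] at h1
  rw [h1]
  have h3 : ∀ q : MvPolynomial (Fin n) R, f.1 (q : MvPowerSeries (Fin n) R) =
      MvPolynomial.aeval (fun j => f.1 (MvPowerSeries.X j)) q := fun q => by
    have : f.1.comp (MvPolynomial.coeToMvPowerSeries.algHom R) =
      MvPolynomial.aeval (fun j => f.1 (MvPowerSeries.X j)) := by
      ext j
      simp
    have h4 := DFunLike.congr_fun this q
    simpa using h4
  rw [h3, map_sum]
  refine Finset.sum_congr rfl fun J _ => ?_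
  rw [MvPolynomial.aeval_monomial, Algebra.smul_def, Finsupp.prod_fintype]
  intro i
  exact pow_zero _

theorem AffinePoints.ext {f g : AffinePoints R n B}
    (h : ∀ j, f.1 (MvPowerSeries.X j) = g.1 (MvPowerSeries.X j)) : f = g := by
  obtain ⟨m, hm⟩ := AffinePoints.exists_pow_eq_zero (fun _ : Unit => f)
  have hf := hm m le_rfl ()
  refine Subtype.ext (AlgHom.ext fun p => ?_)
  rw [f.apply_eq m hf, g.apply_eq m fun j => by rw [← h]; exact hf j]
  simp only [h]

/-- Every tuple of nilpotent elements is the tuple of coordinates of a point. -/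
theorem AffinePoints.exists_of_isNilpotent (b : Fin n → B) (m : ℕ) (hb : ∀ i, b i ^ (m + 1) = 0) :
    ∃ f : AffinePoints R n B, ∀ i, f.1 (MvPowerSeries.X i) = b i := by
  classical
  let c : Fin n →₀ ℕ := Finsupp.equivFunOnFinite.symm fun _ => m + 1
  have hc : ∀ J : Fin n →₀ ℕ, (∀ i, J i ≤ m) → J ≤ c := fun J hJ i => (hJ i).trans (Nat.le_succ m)
  let T := MvPowerSeries.trunc' R c
  let f : MvPowerSeries (Fin n) R →ₐ[R] B := AlgHom.ofLinearMap
    ((MvPolynomial.aeval b).toLinearMap ∘ₗ T) (by simp [T]) (fun p q => by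
      change MvPolynomial.aeval b (T (p * q)) =
        MvPolynomial.aeval b (T p) * MvPolynomial.aeval b (T q)
      rw [← map_mul, ← sub_eq_zero, ← map_sub]
      refine aeval_eq_zero_of_coeff b m hb _ fun J hJ => ?_
      rw [MvPolynomial.coeff_sub, sub_eq_zero, MvPowerSeries.coeff_trunc', if_pos (hc J hJ),
        MvPowerSeries.coeff_trunc'_mul_trunc'_eq_coeff_mul _ _ _ (hc J hJ)])
  have hf : ∀ i, f (MvPowerSeries.X i) = b i := fun i => by
    have h : T (MvPowerSeries.X i) = MvPolynomial.X i := by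
      refine MvPolynomial.ext _ _ fun J => ?_
      rw [MvPowerSeries.coeff_trunc', MvPowerSeries.coeff_X, MvPolynomial.coeff_X]
      by_cases hJ : J = Finsupp.single i 1
      · subst hJ
        rw [if_pos, if_pos rfl]
        intro j
        rw [Finsupp.single_apply]
        change _ ≤ m + 1
        split_ifs <;> omega
      · rw [if_neg hJ, if_neg (Ne.symm hJ), ite_self]
    change MvPolynomial.aeval b (T _) = _
    rw [h, MvPolynomial.aeval_X]
  exact ⟨⟨f, continuous_of_isNilpotent f fun i => ⟨m + 1, by rw [hf, hb]⟩⟩, hf⟩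

/-! ### The universal pointed morphism -/

variable (R n) in
/-- The homomorphism `H^⋆ → R[[t]]`, `ψ ↦ ∑ ψ(d_J) t^J`. -/
def universalHom : CartierDual R (WittCoord R n) →ₐ[R] MvPowerSeries (Fin n) R :=
  AlgHom.ofLinearMap
    { toFun := fun ψ J => ψ.toLin (dcoord R n J)
      map_add' := fun _ _ => rfl
      map_smul' := fun _ _ => rfl }
    (by
      classical
      ext J
      rw [MvPowerSeries.coeff_one]
      exact counit_dcoord R n J)
    (fun φ ψ => by
      classical
      ext J
      rw [MvPowerSeries.coeff_mul]
      refine (CartierDual.toLin_mul φ ψ (dcoord R n J)).trans ?_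
      rw [comul_dcoord, map_sum, map_sum]
      rfl)

theorem coeff_universalHom (ψ : CartierDual R (WittCoord R n)) (J : Fin n →₀ ℕ) :
    MvPowerSeries.coeff J (universalHom R n ψ) = ψ.toLin (dcoord R n J) := rfl

/-- The universal pointed morphism from formal affine space to the dual of the Witt vectors. -/
def universalMor (f : AffinePoints R n B) : SpfPoints R (CartierDual R (WittCoord R n)) B :=
  ⟨f.1.comp (universalHom R n), by
    classical
    obtain ⟨m, hm⟩ := AffinePoints.exists_pow_eq_zero (fun _ : Unit => f)
    refine CartierDual.continuous_of_finset _ ((box n m).image (dcoord R n)) fun φ hφ => ?_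
    rw [AlgHom.comp_apply, f.apply_eq m (hm m le_rfl ())]
    refine Finset.sum_eq_zero fun J hJ => ?_
    rw [coeff_universalHom, hφ _ (Finset.mem_image_of_mem _ hJ), zero_smul]⟩

/-- An explicit formula for a sum of values of the universal morphism. -/
theorem sum_universalMor_apply {κ : Type*} [Fintype κ] [DecidableEq κ] (f : κ → AffinePoints R n B)
    (m : ℕ) (hm : ∀ i j, (f i).1 (MvPowerSeries.X j) ^ (m + 1) = 0)
    (ψ : CartierDual R (WittCoord R n)) :
    (∑ i, universalMor (f i)).1 ψ = ∑ τ ∈ Fintype.piFinset fun _ : κ => box n m,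
      ψ.toLin (∏ i, dcoord R n (τ i)) • ∏ i, ∏ j, (f i).1 (MvPowerSeries.X j) ^ τ i j := by
  classical
  choose x hx using fun i => CartierDual.ofGroupLike_bijective.2 (universalMor (f i))
  have hv : ∀ i, (x i).val = ∑ J ∈ box n m,
      (∏ j, (f i).1 (MvPowerSeries.X j) ^ J j) ⊗ₜ[R] dcoord R n J := by
    intro i
    refine CartierDual.pairing_ext fun φ => ?_
    have h := DFunLike.congr_fun (congrArg Subtype.val (hx i)) (CartierDual.ofLin φ)
    refine Eq.trans h ?_
    change (f i).1 (universalHom R n _) = _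
    rw [(f i).apply_eq m (hm i), map_sum]
    refine Finset.sum_congr rfl fun J _ => ?_
    rw [CartierDual.pairing_tmul]
    rfl
  simp only [← hx]
  rw [← CartierDual.ofGroupLike_prod]
  change CartierDual.pairing B ψ.toLin (∏ i, x i).val = _
  have h1 : (∏ i, x i).val = ∏ i, (x i).val :=
    map_prod (GroupLike.valMonoidHom B (B ⊗[R] WittCoord R n)) x _
  have h2 : ∀ (s : Finset κ) (b : κ → B) (h : κ → WittCoord R n),
      ∏ i ∈ s, (b i ⊗ₜ[R] h i) = (∏ i ∈ s, b i) ⊗ₜ[R] (∏ i ∈ s, h i) := by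
    intro s b h
    induction s using Finset.induction_on with
    | empty => rfl
    | insert i s hi ih => simp [Finset.prod_insert hi, ih]
  rw [h1]
  simp only [hv]
  rw [Finset.prod_univ_sum, map_sum]
  refine Finset.sum_congr rfl fun τ _ => ?_
  rw [h2, CartierDual.pairing_tmul]

end Points

/-! ### The dual of the Witt vectors as a colimit of symmetric powers of formal affine space -/

theorem continuous_of_comp_injective {A B C : Type*} [TopologicalSpace A] (f : A → B) (u : B → C)
    (hu : Function.Injective u) (h : @Continuous A C _ ⊥ (u ∘ f)) : @Continuous A B _ ⊥ f := by
  let : TopologicalSpace B := ⊥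
  let : TopologicalSpace C := ⊥
  have : DiscreteTopology B := ⟨rfl⟩
  have : DiscreteTopology C := ⟨rfl⟩
  refine continuous_def.2 fun s _ => ?_
  rw [← Set.preimage_image_eq s hu, ← Set.preimage_comp]
  exact (isOpen_discrete _).preimage h

/-- Points of `Spf A` over `C` with values in the image of an injection `B → C` come from `B`. -/
theorem SpfPoints.exists_map_eq {R A B C : Type*} [CommRing R] [CommRing A] [Algebra R A]
    [TopologicalSpace A] [CommRing B] [Algebra R B] [CommRing C] [Algebra R C] (u : B →ₐ[R] C)
    (hu : Function.Injective u) (f : SpfPoints R A C) (hf : ∀ a, f.1 a ∈ u.range) :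
    ∃ g : SpfPoints R A B, SpfPoints.map u g = f := by
  let g : A →ₐ[R] B := (AlgEquiv.ofInjective u hu).symm.toAlgHom.comp (f.1.codRestrict u.range hf)
  have hg : u.comp g = f.1 := AlgHom.ext fun a =>
    congrArg Subtype.val ((AlgEquiv.ofInjective u hu).apply_symm_apply ⟨f.1 a, hf a⟩)
  refine ⟨⟨g, continuous_of_comp_injective g u hu ?_⟩, Subtype.ext hg⟩
  rw [show (u ∘ g) = f.1 from funext fun a => DFunLike.congr_fun hg a]
  exact f.2

theorem SpfPoints.map_injective {R A B C : Type*} [CommRing R] [CommRing A] [Algebra R A]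
    [TopologicalSpace A] [CommRing B] [Algebra R B] [CommRing C] [Algebra R C] (u : B →ₐ[R] C)
    (hu : Function.Injective u) : Function.Injective (SpfPoints.map u : SpfPoints R A B → _) :=
  fun _ _ h => Subtype.ext (AlgHom.ext fun a =>
    hu (DFunLike.congr_fun (congrArg Subtype.val h) a))

/-- A linear form as an element of the Cartier dual, linearly in the form. -/
def CartierDual.ofLinₗ {R H : Type u} [CommRing R] [CommRing H] [HopfAlgebra R H]
    [Coalgebra.IsCocomm R H] : (H →ₗ[R] R) →ₗ[R] CartierDual R H where
  toFun := CartierDual.ofLin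
  map_add' _ _ := rfl
  map_smul' _ _ := rfl

section Sym

variable (R : Type u) [CommRing R] (n e : ℕ)

/-- The ideal of the polynomials in the variables `t_{i,j}`, `i < e`, `j < n`, all of whose
monomials have an exponent greater than `e`. -/
def boxIdeal : Ideal (MvPolynomial (Fin e × Fin n) R) :=
  MvPolynomial.restrictSupportIdeal R {T : Fin e × Fin n →₀ ℕ | ∃ p, e < T p}
    (fun _ _ h ⟨p, hp⟩ => ⟨p, hp.trans_le (h p)⟩)

variable {R n e} in
theorem mem_boxIdeal {q : MvPolynomial (Fin e × Fin n) R} : q ∈ boxIdeal R n e ↔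
    ∀ T : Fin e × Fin n →₀ ℕ, (∀ p, T p ≤ e) → MvPolynomial.coeff T q = 0 := by
  change q ∈ MvPolynomial.restrictSupport R _ ↔ _
  rw [MvPolynomial.mem_restrictSupport_iff]
  constructor
  · intro h T hT
    by_contra h0
    obtain ⟨p, hp⟩ := h (MvPolynomial.mem_support_iff.2 h0)
    exact absurd (hT p) (not_le.2 hp)
  · intro h T hT
    by_contra h0
    simp only [Set.mem_ofPred_eq, not_exists, not_lt] at h0
    exact MvPolynomial.mem_support_iff.1 hT (h T h0)

/-- The function algebra of the `e`-th power of a truncation of formal affine `n`-space, with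
coordinates `t_{i,j}`, `i < e`, `j < n`, such that `t_{i,j}^(e+1) = 0`. -/
abbrev TruncRing : Type u := MvPolynomial (Fin e × Fin n) R ⧸ boxIdeal R n e

variable {R n e}

/-- A tuple of exponents as an exponent in the variables `t_{i,j}`. -/
def expo (τ : Fin e → Fin n →₀ ℕ) : Fin e × Fin n →₀ ℕ :=
  Finsupp.equivFunOnFinite.symm fun p => τ p.1 p.2

theorem expo_apply (τ : Fin e → Fin n →₀ ℕ) (p : Fin e × Fin n) : expo τ p = τ p.1 p.2 := rfl

theorem expo_injective : Function.Injective (expo : (Fin e → Fin n →₀ ℕ) → _) := fun _ _ h =>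
  funext fun i => Finsupp.ext fun j => DFunLike.congr_fun h (i, j)

/-- The coefficient at `t^τ` of an element of the truncated polynomial ring. -/
def tcoeff (τ : Fin e → Fin n →₀ ℕ) (h : ∀ i, τ i ∈ box n e) : TruncRing R n e →ₗ[R] R :=
  Submodule.liftQ ((boxIdeal R n e).restrictScalars R) (MvPolynomial.lcoeff R (expo τ))
    (fun _ hq => mem_boxIdeal.1 hq _ fun p => mem_box.1 (h p.1) p.2) ∘ₗ
  (Submodule.Quotient.restrictScalarsEquiv R (boxIdeal R n e)).symm.toLinearMap

theorem tcoeff_mk (τ : Fin e → Fin n →₀ ℕ) (h : ∀ i, τ i ∈ box n e)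
    (q : MvPolynomial (Fin e × Fin n) R) :
    tcoeff τ h (Ideal.Quotient.mkₐ R (boxIdeal R n e) q) = MvPolynomial.coeff (expo τ) q := rfl

theorem tcoeff_ext {x y : TruncRing R n e}
    (h : ∀ τ (hτ : ∀ i, τ i ∈ box n e), tcoeff τ hτ x = tcoeff τ hτ y) : x = y := by
  obtain ⟨p, rfl⟩ := Ideal.Quotient.mkₐ_surjective R _ x
  obtain ⟨q, rfl⟩ := Ideal.Quotient.mkₐ_surjective R _ y
  refine Ideal.Quotient.eq.2 (mem_boxIdeal.2 fun T hT => ?_)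
  let τ : Fin e → Fin n →₀ ℕ := fun i => Finsupp.equivFunOnFinite.symm fun j => T (i, j)
  have hτ : expo τ = T := Finsupp.ext fun _ => rfl
  have := h τ fun i => mem_box.2 fun j => hT (i, j)
  rw [tcoeff_mk, tcoeff_mk, hτ] at this
  rw [MvPolynomial.coeff_sub, this, sub_self]

theorem mk_X_pow (p : Fin e × Fin n) :
    (Ideal.Quotient.mkₐ R (boxIdeal R n e) (MvPolynomial.X p)) ^ (e + 1) = 0 := by
  classical
  rw [← map_pow]
  refine Ideal.Quotient.eq_zero_iff_mem.2 (mem_boxIdeal.2 fun T hT => ?_)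
  rw [MvPolynomial.X_pow_eq_monomial, MvPolynomial.coeff_monomial, if_neg]
  rintro rfl
  have := hT p
  rw [Finsupp.single_eq_same] at this
  omega

variable (R n e) in
theorem exists_tpoint (i : Fin e) : ∃ f : AffinePoints R n (TruncRing R n e), ∀ j,
    f.1 (MvPowerSeries.X j) = Ideal.Quotient.mkₐ R (boxIdeal R n e) (MvPolynomial.X (i, j)) :=
  AffinePoints.exists_of_isNilpotent _ e fun _ => mk_X_pow _

variable (R n e) in
/-- The `i`-th tautological point of formal affine space over the truncated polynomial ring. -/
def tpoint (i : Fin e) : AffinePoints R n (TruncRing R n e) := (exists_tpoint R n e i).choose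

theorem tpoint_X (i : Fin e) (j : Fin n) : (tpoint R n e i).1 (MvPowerSeries.X j) =
    Ideal.Quotient.mkₐ R (boxIdeal R n e) (MvPolynomial.X (i, j)) :=
  (exists_tpoint R n e i).choose_spec j

variable {B C : Type u} [CommRing B] [Algebra R B] [CommRing C] [Algebra R C]

/-- The homomorphism from the truncated polynomial ring that is given by `e` points of formal
affine space. -/
def tlift (c : Fin e → AffinePoints R n C)
    (hc : ∀ i j, (c i).1 (MvPowerSeries.X j) ^ (e + 1) = 0) : TruncRing R n e →ₐ[R] C :=
  Ideal.Quotient.liftₐ (boxIdeal R n e) (MvPolynomial.aeval fun p : Fin e × Fin n =>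
    (c p.1).1 (MvPowerSeries.X p.2 : MvPowerSeries (Fin n) R))
    fun q hq => aeval_eq_zero_of_coeff
      (fun p : Fin e × Fin n => (c p.1).1 (MvPowerSeries.X p.2 : MvPowerSeries (Fin n) R)) e
      (fun p => hc p.1 p.2) q (mem_boxIdeal.1 hq)

theorem tlift_mk (c : Fin e → AffinePoints R n C)
    (hc : ∀ i j, (c i).1 (MvPowerSeries.X j) ^ (e + 1) = 0) (q : MvPolynomial (Fin e × Fin n) R) :
    tlift c hc (Ideal.Quotient.mkₐ R (boxIdeal R n e) q) =
      MvPolynomial.aeval (fun p => (c p.1).1 (MvPowerSeries.X p.2)) q := rfl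

/-- The map on points of formal affine space that is induced by a homomorphism. -/
def AffinePoints.map (u : B →ₐ[R] C) (f : AffinePoints R n B) : AffinePoints R n C :=
  letI := powerSeriesTopology R n
  SpfPoints.map u f

theorem map_tpoint (c : Fin e → AffinePoints R n C)
    (hc : ∀ i j, (c i).1 (MvPowerSeries.X j) ^ (e + 1) = 0) (i : Fin e) :
    AffinePoints.map (tlift c hc) (tpoint R n e i) = c i := by
  refine AffinePoints.ext fun j => ?_
  change tlift c hc ((tpoint R n e i).1 (MvPowerSeries.X j)) = _
  rw [tpoint_X, tlift_mk, MvPolynomial.aeval_X]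

theorem map_sum_universalMor {κ : Type*} (s : Finset κ) (u : B →ₐ[R] C)
    (c : κ → AffinePoints R n B) : SpfPoints.map u (∑ i ∈ s, universalMor (c i)) =
      ∑ i ∈ s, universalMor (AffinePoints.map u (c i)) := by
  let L : SpfPoints R (CartierDual R (WittCoord R n)) B →+
      SpfPoints R (CartierDual R (WittCoord R n)) C :=
    AddMonoidHom.mk' (SpfPoints.map u) (CartierDual.map_add u)
  exact map_sum L _ _

variable (R n e) in
/-- The sum of the values of the universal morphism at the `e` tautological points. -/
def theta : SpfPoints R (CartierDual R (WittCoord R n)) (TruncRing R n e) :=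
  ∑ i, universalMor (tpoint R n e i)

theorem map_tlift_theta (c : Fin e → AffinePoints R n C)
    (hc : ∀ i j, (c i).1 (MvPowerSeries.X j) ^ (e + 1) = 0) :
    SpfPoints.map (tlift c hc) (theta R n e) = ∑ i, universalMor (c i) := by
  rw [theta, map_sum_universalMor]
  simp only [map_tpoint]

/-- The monomials in the `d_J` are dual to the monomial symmetric functions. -/
theorem tcoeff_theta (ψ : CartierDual R (WittCoord R n)) (τ : Fin e → Fin n →₀ ℕ)
    (h : ∀ i, τ i ∈ box n e) :
    tcoeff τ h ((theta R n e).1 ψ) = ψ.toLin (dbasis R n (mult τ)) := by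
  classical
  have hm : ∀ i j, (tpoint R n e i).1 (MvPowerSeries.X j) ^ (e + 1) = 0 := fun i j => by
    rw [tpoint_X, mk_X_pow]
  rw [theta, sum_universalMor_apply _ e hm, map_sum, dbasis_mult]
  have key : ∀ τ' : Fin e → Fin n →₀ ℕ, tcoeff τ h (ψ.toLin (∏ i, dcoord R n (τ' i)) •
      ∏ i, ∏ j, (tpoint R n e i).1 (MvPowerSeries.X j) ^ τ' i j) =
      if τ' = τ then ψ.toLin (∏ i, dcoord R n (τ i)) else 0 := by
    intro τ'
    have e1 : ∏ i, ∏ j, (tpoint R n e i).1 (MvPowerSeries.X j) ^ τ' i j =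
        Ideal.Quotient.mkₐ R (boxIdeal R n e) (MvPolynomial.monomial (expo τ') 1) := by
      simp only [tpoint_X, ← map_pow, ← map_prod]
      congr 1
      rw [MvPolynomial.monomial_eq, Finsupp.prod_fintype _ _ (fun _ => pow_zero _), map_one,
        one_mul, Fintype.prod_prod_type]
      rfl
    rw [e1, map_smul, tcoeff_mk, MvPolynomial.coeff_monomial, smul_eq_mul]
    by_cases ht : τ' = τ
    · subst ht; simp
    · rw [if_neg ht, if_neg fun h => ht (expo_injective h), mul_zero]
  rw [Finset.sum_congr rfl fun τ' _ => key τ', Finset.sum_ite_eq', if_pos]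
  exact Fintype.mem_piFinset.2 h

/-- The action of a permutation of the `e` factors. -/
def permHom (σ : Equiv.Perm (Fin e)) : TruncRing R n e →ₐ[R] TruncRing R n e :=
  tlift (fun i => tpoint R n e (σ i)) fun i j => by rw [tpoint_X, mk_X_pow]

theorem tcoeff_permHom (σ : Equiv.Perm (Fin e)) (τ τ' : Fin e → Fin n →₀ ℕ)
    (h : ∀ i, τ i ∈ box n e) (h' : ∀ i, τ' i ∈ box n e) (hσ : ∀ i, τ (σ i) = τ' i)
    (x : TruncRing R n e) : tcoeff τ h (permHom σ x) = tcoeff τ' h' x := by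
  obtain ⟨q, rfl⟩ := Ideal.Quotient.mkₐ_surjective R _ x
  let f : Fin e × Fin n → Fin e × Fin n := Prod.map σ id
  have hf : Function.Injective f := σ.injective.prodMap Function.injective_id
  have h1 : permHom σ (Ideal.Quotient.mkₐ R (boxIdeal R n e) q) =
      Ideal.Quotient.mkₐ R (boxIdeal R n e) (MvPolynomial.rename f q) := by
    have : (permHom σ).comp (Ideal.Quotient.mkₐ R (boxIdeal R n e)) =
        (Ideal.Quotient.mkₐ R (boxIdeal R n e)).comp (MvPolynomial.rename f) := by
      refine MvPolynomial.algHom_ext fun p => ?_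
      rw [AlgHom.comp_apply, permHom, tlift_mk, MvPolynomial.aeval_X, tpoint_X,
        AlgHom.comp_apply, MvPolynomial.rename_X]
      rfl
    exact DFunLike.congr_fun this q
  have h2 : expo τ = Finsupp.mapDomain f (expo τ') := by
    ext p
    obtain ⟨p, rfl⟩ : ∃ p', f p' = p := ⟨(σ.symm p.1, p.2), by simp [f]⟩
    rw [Finsupp.mapDomain_apply hf, expo_apply, expo_apply, ← hσ]
    rfl
  rw [h1, tcoeff_mk, tcoeff_mk, h2, MvPolynomial.coeff_rename_mapDomain _ hf]

variable (R n e) in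
/-- The symmetric elements: the function algebra of the `e`-th symmetric power of a truncation of
formal affine `n`-space. -/
def symAlg : Subalgebra R (TruncRing R n e) :=
  ⨅ σ : Equiv.Perm (Fin e), AlgHom.equalizer (permHom σ) (AlgHom.id R _)

theorem mem_symAlg {x : TruncRing R n e} : x ∈ symAlg R n e ↔ ∀ σ, permHom σ x = x := by
  simp [symAlg, Algebra.mem_iInf, AlgHom.mem_equalizer]

theorem map_permHom_theta (σ : Equiv.Perm (Fin e)) :
    SpfPoints.map (permHom σ) (theta R n e) = theta R n e := by
  rw [permHom, map_tlift_theta, theta]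
  exact Equiv.sum_comp σ fun i => universalMor (tpoint R n e i)

theorem theta_mem_symAlg (ψ : CartierDual R (WittCoord R n)) :
    (theta R n e).1 ψ ∈ symAlg R n e :=
  mem_symAlg.2 fun σ => DFunLike.congr_fun (congrArg Subtype.val (map_permHom_theta σ)) ψ

variable (R n e) in
theorem exists_thetaSym : ∃ g : SpfPoints R (CartierDual R (WittCoord R n)) (symAlg R n e),
    SpfPoints.map (symAlg R n e).val g = theta R n e :=
  SpfPoints.exists_map_eq _ Subtype.val_injective _ fun ψ => by
    rw [Subalgebra.range_val]
    exact theta_mem_symAlg ψ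

variable (R n e) in
/-- The point `theta` with values in the symmetric elements. -/
def thetaSym : SpfPoints R (CartierDual R (WittCoord R n)) (symAlg R n e) :=
  (exists_thetaSym R n e).choose

theorem map_val_thetaSym : SpfPoints.map (symAlg R n e).val (thetaSym R n e) = theta R n e :=
  (exists_thetaSym R n e).choose_spec

theorem val_thetaSym (ψ : CartierDual R (WittCoord R n)) :
    ((thetaSym R n e).1 ψ : TruncRing R n e) = (theta R n e).1 ψ :=
  DFunLike.congr_fun (congrArg Subtype.val map_val_thetaSym) ψ

variable (R n e) in
open Classical in
/-- A linear section of `theta` over the symmetric elements: the linear form whose value at a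
monomial in the `d_J` is the coefficient at a tuple enumerating the factors of that monomial. -/
def symSection : TruncRing R n e →ₗ[R] CartierDual R (WittCoord R n) :=
  CartierDual.ofLinₗ ∘ₗ ((dbasis R n).constr R).toLinearMap ∘ₗ LinearMap.pi fun M =>
    if h : ∃ τ : Fin e → Fin n →₀ ℕ, (∀ i, τ i ∈ box n e) ∧ mult τ = M then
      tcoeff h.choose h.choose_spec.1 else 0

theorem theta_symSection {x : TruncRing R n e} (hx : x ∈ symAlg R n e) :
    (theta R n e).1 (symSection R n e x) = x := by
  classical
  refine tcoeff_ext fun τ h => ?_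
  rw [tcoeff_theta]
  have hM : ∃ τ' : Fin e → Fin n →₀ ℕ, (∀ i, τ' i ∈ box n e) ∧ mult τ' = mult τ := ⟨τ, h, rfl⟩
  have h1 : (symSection R n e x).toLin (dbasis R n (mult τ)) =
      tcoeff hM.choose hM.choose_spec.1 x :=
    ((dbasis R n).constr_basis R _ _).trans (LinearMap.congr_fun (dif_pos hM) x)
  obtain ⟨σ, hσ⟩ := exists_perm_of_mult_eq hM.choose_spec.2
  rw [h1, ← tcoeff_permHom σ τ _ h _ hσ, mem_symAlg.1 hx]

theorem thetaSym_symSection (x : symAlg R n e) :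
    (thetaSym R n e).1 (symSection R n e x) = x :=
  Subtype.ext ((val_thetaSym _).trans (theta_symSection x.2))

theorem thetaSym_surjective : Function.Surjective (thetaSym R n e).1 := fun x =>
  ⟨_, thetaSym_symSection x⟩

theorem theta_eq_zero_iff {ψ : CartierDual R (WittCoord R n)} : (theta R n e).1 ψ = 0 ↔
    ∀ τ : Fin e → Fin n →₀ ℕ, (∀ i, τ i ∈ box n e) → ψ.toLin (dbasis R n (mult τ)) = 0 := by
  constructor
  · intro h τ hτ
    rw [← tcoeff_theta ψ τ hτ, h, map_zero]
  · intro h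
    refine tcoeff_ext fun τ hτ => ?_
    rw [tcoeff_theta, h τ hτ, map_zero]

/-- The kernels of the `theta` are cofinal among the sets of linear forms that vanish at finitely
many given elements. -/
theorem exists_theta_eq_zero_imp (K : Finset (Idx n →₀ ℕ)) : ∃ e, ∀ e', e ≤ e' →
    ∀ ψ : CartierDual R (WittCoord R n), (theta R n e').1 ψ = 0 →
      ∀ M ∈ K, ψ.toLin (dbasis R n M) = 0 := by
  obtain ⟨e, he⟩ := exists_forall_mult_eq K
  refine ⟨e, fun e' h ψ hψ M hM => ?_⟩
  obtain ⟨τ, hτ, rfl⟩ := he e' h M hM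
  exact theta_eq_zero_iff.1 hψ τ hτ

/-- A point that vanishes on the kernel of `theta` is the image of the universal point over the
symmetric elements. -/
theorem exists_map_thetaSym_eq (g : SpfPoints R (CartierDual R (WittCoord R n)) B)
    (hg : ∀ ψ, (theta R n e).1 ψ = 0 → g.1 ψ = 0) :
    ∃ u : symAlg R n e →ₐ[R] B, SpfPoints.map u (thetaSym R n e) = g := by
  have key : ∀ ψ, g.1 (symSection R n e ((thetaSym R n e).1 ψ)) = g.1 ψ := by
    intro ψ
    rw [← sub_eq_zero, ← map_sub]
    refine hg _ ?_
    rw [map_sub, theta_symSection ((thetaSym R n e).1 ψ).2, val_thetaSym, sub_self]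
  let u : symAlg R n e →ₐ[R] B := AlgHom.ofLinearMap
    (g.1.toLinearMap ∘ₗ symSection R n e ∘ₗ (symAlg R n e).val.toLinearMap)
    (by
      have h := key 1
      rw [map_one, map_one] at h
      exact h)
    (fun x y => by
      obtain ⟨φ, rfl⟩ := thetaSym_surjective x
      obtain ⟨ψ, rfl⟩ := thetaSym_surjective y
      rw [← map_mul]
      change g.1 (symSection R n e ((thetaSym R n e).1 (φ * ψ))) =
        g.1 (symSection R n e ((thetaSym R n e).1 φ)) *
          g.1 (symSection R n e ((thetaSym R n e).1 ψ))
      rw [key, key, key, map_mul])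
  exact ⟨u, Subtype.ext (AlgHom.ext key)⟩

theorem exists_factor (g : SpfPoints R (CartierDual R (WittCoord R n)) B) : ∃ e, ∀ e', e ≤ e' →
    ∃ u : symAlg R n e' →ₐ[R] B, SpfPoints.map u (thetaSym R n e') = g := by
  obtain ⟨K, hK⟩ := CartierDual.exists_finset_of_continuous (dbasis R n) g
  obtain ⟨e, he⟩ := exists_theta_eq_zero_imp (R := R) K
  exact ⟨e, fun e' h => exists_map_thetaSym_eq g fun ψ hψ => hK ψ (he e' h ψ hψ)⟩

variable (R n e) in
theorem map_val_injective : Function.Injective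
    (Algebra.TensorProduct.map (symAlg R n e).val (symAlg R n e).val) := by
  let r : TruncRing R n e →ₗ[R] symAlg R n e :=
    (thetaSym R n e).1.toLinearMap ∘ₗ symSection R n e
  have hr : r ∘ₗ (symAlg R n e).val.toLinearMap = LinearMap.id :=
    LinearMap.ext thetaSym_symSection
  refine Function.LeftInverse.injective (g := TensorProduct.map r r) fun x => ?_
  have h : TensorProduct.map r r ∘ₗ
      TensorProduct.map (symAlg R n e).val.toLinearMap (symAlg R n e).val.toLinearMap =
        LinearMap.id := by
    rw [← TensorProduct.map_comp, hr, TensorProduct.map_id]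
  exact LinearMap.congr_fun h x

end Sym

/-! ### The dual of the Witt vectors is a formal group -/

section FormalGroup

variable {R : Type u} [CommRing R]

/-- The functor of points of a formal spectrum is a Zariski sheaf. -/
theorem isZariskiSheaf_spf (A : Type u) [CommRing A] [Algebra R A] [TopologicalSpace A] :
    IsZariskiSheaf (spf R A) := by
  intro B s hs x hx
  let : ∀ b : s, TopologicalSpace (Localization.Away (b : B)) := fun _ => ⊥
  have : ∀ b : s, DiscreteTopology (Localization.Away (b : B)) := fun _ => ⟨rfl⟩
  let P := ∀ b : s, Localization.Away (b : B)
  let x' : ∀ b : s, SpfPoints R A (Localization.Away (b : B)) := x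
  let u : B →ₐ[R] P := AlgHom.pi fun b => IsScalarTower.toAlgHom R B (Localization.Away (b : B))
  have hu : Function.Injective u := fun a a' h =>
    Localization.algebraMap_injective_of_span_eq_top (s : Set B) hs h
  let f : SpfPoints R A P := ⟨AlgHom.pi fun b => (x' b).1, by
    have h : Continuous fun a : A => (fun b => (x' b).1 a : P) := continuous_pi fun b => (x' b).2
    rw [(inferInstance : DiscreteTopology P).eq_bot] at h
    exact h⟩
  have hf : ∀ a, f.1 a ∈ u.range := by
    intro a
    obtain ⟨r, hr, -⟩ := Localization.existsUnique_algebraMap_eq_of_span_eq_top (s : Set B) hs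
      (fun b => (x' b).1 a) (by
        intro b c
        let L := Localization.Away ((b : B) * c)
        let p : Localization.Away (b : B) →ₐ[R] L :=
          { IsLocalization.Away.awayToAwayRight (P := L) (b : B) c with
            commutes' := fun r => by
              change IsLocalization.Away.awayToAwayRight (P := L) (b : B) c _ = _
              rw [IsScalarTower.algebraMap_apply R B (Localization.Away (b : B)),
                IsLocalization.Away.awayToAwayRight_eq, ← IsScalarTower.algebraMap_apply] }
        let q : Localization.Away (c : B) →ₐ[R] L :=
          { IsLocalization.Away.awayToAwayLeft (P := L) (c : B) b with
            commutes' := fun r => by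
              change IsLocalization.Away.awayToAwayLeft (P := L) (c : B) b _ = _
              rw [IsScalarTower.algebraMap_apply R B (Localization.Away (c : B)),
                IsLocalization.Away.awayToAwayLeft_eq, ← IsScalarTower.algebraMap_apply] }
        have h := hx b c (CommAlgCat.of R L) (CommAlgCat.ofHom p) (CommAlgCat.ofHom q) (by
          ext r
          change p (algebraMap B _ r) = q (algebraMap B _ r)
          exact (IsLocalization.Away.awayToAwayRight_eq (b : B) c r).trans
            (IsLocalization.Away.awayToAwayLeft_eq (c : B) b r).symm)
        exact DFunLike.congr_fun (congrArg Subtype.val h) a)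
    exact ⟨r, funext hr⟩
  obtain ⟨g, hg⟩ := SpfPoints.exists_map_eq u hu f hf
  have key : ∀ (g : SpfPoints R A B), SpfPoints.map u g = f ↔ ∀ b : s, (spf R A).map
      (CommAlgCat.ofHom (IsScalarTower.toAlgHom R B (Localization.Away (b : B)))) g = x b := by
    intro g
    constructor
    · intro h b
      exact Subtype.ext (AlgHom.ext fun a =>
        congrFun (DFunLike.congr_fun (congrArg Subtype.val h) a) b)
    · intro h
      exact Subtype.ext (AlgHom.ext fun a => funext fun b =>
        DFunLike.congr_fun (congrArg Subtype.val (h b)) a)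
  exact ⟨g, (key g).1 hg, fun g' hg' =>
    SpfPoints.map_injective u hu (((key g').2 hg').trans hg.symm)⟩

variable (R) (n : ℕ)

theorem CartierDual.completeSpace (H : Type u) [CommRing H] [HopfAlgebra R H]
    [Coalgebra.IsCocomm R H] : @CompleteSpace (CartierDual R H)
      (IsTopologicalAddGroup.rightUniformSpace (CartierDual R H)) := by
  let : UniformSpace R := ⊥
  have : DiscreteTopology R := ⟨rfl⟩
  let : UniformSpace (CartierDual R H) := IsTopologicalAddGroup.rightUniformSpace _
  have : IsUniformAddGroup (CartierDual R H) := isUniformAddGroup_of_addCommGroup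
  have h1 : Topology.IsInducing (CartierDual.evalHom : CartierDual R H →+ (H → R)) := ⟨rfl⟩
  have h2 := AddMonoidHom.isUniformInducing_of_isInducing h1
  refine (completeSpace_iff_isComplete_range h2).2 (IsClosed.isComplete ?_)
  have h3 : Set.range (CartierDual.evalHom : CartierDual R H →+ (H → R)) =
      Set.range (DFunLike.coe : (H →ₗ[R] R) → H → R) :=
    Set.ext fun _ => ⟨fun ⟨φ, h⟩ => ⟨φ.toLin, h⟩, fun ⟨φ, h⟩ => ⟨CartierDual.ofLin φ, h⟩⟩
  rw [h3]
  exact LinearMap.isClosed_range_coe H R (RingHom.id R)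

theorem hasBasis_ker_theta : (nhds (0 : CartierDual R (WittCoord R n))).HasBasis (fun _ : ℕ => True)
    fun e => (RingHom.ker (theta R n e).1 : Set (CartierDual R (WittCoord R n))) := by
  classical
  refine ⟨fun U => ?_⟩
  rw [CartierDual.mem_nhds_zero_iff]
  constructor
  · rintro ⟨T, hT⟩
    obtain ⟨e, he⟩ := exists_theta_eq_zero_imp (R := R)
      (T.biUnion fun h => ((dbasis R n).repr h).support)
    refine ⟨e, trivial, fun ψ hψ => hT ψ fun h hh => ?_⟩
    rw [← (dbasis R n).linearCombination_repr h, Finsupp.linearCombination_apply, Finsupp.sum,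
      map_sum]
    refine Finset.sum_eq_zero fun M hM => ?_
    rw [map_smul, he e le_rfl ψ hψ M (Finset.mem_biUnion.2 ⟨h, hh, hM⟩), smul_zero]
  · rintro ⟨e, -, he⟩
    refine ⟨(Fintype.piFinset fun _ : Fin e => box n e).image fun τ => dbasis R n (mult τ),
      fun ψ hψ => he (theta_eq_zero_iff.2 fun τ hτ => hψ _ ?_)⟩
    exact Finset.mem_image_of_mem _ (Fintype.mem_piFinset.2 hτ)

theorem isFormalAlgebra_cartierDual : IsFormalAlgebra R (CartierDual R (WittCoord R n)) where
  isTopologicalRing := inferInstance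
  isLinearTopology := IsLinearTopology.mk_of_hasBasis _ (hasBasis_ker_theta R n)
  t2Space := by
    let : TopologicalSpace R := ⊥
    have : DiscreteTopology R := ⟨rfl⟩
    refine T2Space.of_injective_continuous
      (f := (CartierDual.evalHom : CartierDual R (WittCoord R n) →+ _)) (fun φ ψ h => ?_)
      continuous_induced_dom
    exact congrArg CartierDual.ofLin (LinearMap.ext fun x => congrFun h x)
  completeSpace := CartierDual.completeSpace R _
  exists_submodule U hU := by
    classical
    rw [CartierDual.mem_nhds_zero_iff] at hU
    obtain ⟨T, hT⟩ := hU
    let K := T.biUnion fun h => ((dbasis R n).repr h).support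
    let L : CartierDual R (WittCoord R n) →ₗ[R] (K → R) :=
      { toFun := fun ψ M => ψ.toLin (dbasis R n M)
        map_add' := fun _ _ => rfl
        map_smul' := fun _ _ => rfl }
    have hL : Function.Surjective L := fun c => by
      refine ⟨CartierDual.ofLin ((dbasis R n).constr R fun M => if h : M ∈ K then c ⟨M, h⟩ else 0),
        funext fun M => ?_⟩
      exact ((dbasis R n).constr_basis R _ _).trans (dif_pos M.2)
    let E := L.quotKerEquivOfSurjective hL
    refine ⟨LinearMap.ker L, ?_, fun ψ hψ => hT ψ fun h hh => ?_,
      Module.Finite.equiv E.symm, Module.Projective.of_equiv E.symm⟩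
    · refine AddSubgroup.isOpen_of_mem_nhds (LinearMap.ker L).toAddSubgroup (g := 0) ?_
      refine CartierDual.mem_nhds_zero_iff.2 ⟨K.image (dbasis R n), fun ψ hψ => ?_⟩
      exact funext fun M => hψ _ (Finset.mem_image_of_mem _ M.2)
    · rw [← (dbasis R n).linearCombination_repr h, Finsupp.linearCombination_apply, Finsupp.sum,
        map_sum]
      refine Finset.sum_eq_zero fun M hM => ?_
      rw [map_smul]
      have := congrFun hψ ⟨M, Finset.mem_biUnion.2 ⟨h, hh, hM⟩⟩
      exact (congrArg _ this).trans (smul_zero _)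

theorem isCommFormalGroup_cartierDual :
    IsCommFormalGroup R (cartierDual R (WittCoord R n)) := by
  refine ⟨isZariskiSheaf_spf (CartierDual R (WittCoord R n)), {1}, by simp, ?_⟩
  rintro _ rfl
  refine ⟨R, inferInstance, inferInstance, IsLocalization.away_of_isUnit_of_bijective _ isUnit_one
    Function.bijective_id, CartierDual R (WittCoord R n), inferInstance, inferInstance,
    inferInstance, isFormalAlgebra_cartierDual R n, ⟨?_⟩⟩
  refine NatIso.ofComponents (fun B => Equiv.toIso
    { toFun := fun f => ⟨{ f.1.toRingHom with commutes' := f.1.commutes }, f.2⟩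
      invFun := fun f => ⟨{ f.1.toRingHom with commutes' := f.1.commutes }, f.2⟩
      left_inv := fun f => rfl
      right_inv := fun f => rfl }) fun u => rfl

end FormalGroup

/-! ### Formal groups as left exact functors -/

section LeftExact

variable {R : Type u} [CommRing R]

/-- The map `G(X) → G(Y)` induced by a homomorphism `X → Y`. -/
def push (G : CommAlgCat.{u} R ⥤ Type u) {X Y : Type u} [CommRing X] [Algebra R X] [CommRing Y]
    [Algebra R Y] (u : X →ₐ[R] Y) (x : G.obj (CommAlgCat.of R X)) : G.obj (CommAlgCat.of R Y) :=
  G.map (CommAlgCat.ofHom u) x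

section Push

variable (G : CommAlgCat.{u} R ⥤ Type u) {X Y Z : Type u} [CommRing X] [Algebra R X] [CommRing Y]
  [Algebra R Y] [CommRing Z] [Algebra R Z]

theorem push_push (v : Y →ₐ[R] Z) (u : X →ₐ[R] Y) (x : G.obj (CommAlgCat.of R X)) :
    push G v (push G u x) = push G (v.comp u) x :=
  (G.map_comp_apply (CommAlgCat.ofHom u) (CommAlgCat.ofHom v) x).symm

end Push

/-- An algebra over `R'`, regarded as an `R`-algebra by restriction of scalars. -/
def restrictIso (R R' : Type u) [CommRing R] [CommRing R'] [Algebra R R'] (X : Type u) [CommRing X]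
    [Algebra R X] [Algebra R' X] [IsScalarTower R R' X] :
    (restrictAlg R R').obj (CommAlgCat.of R' X) ≅ CommAlgCat.of R X where
  hom := @CommAlgCat.ofHom R _ X X _ (Algebra.compHom X (algebraMap R R')) _ _
    (@AlgHom.mk R X X _ _ _ (Algebra.compHom X (algebraMap R R')) _ (RingHom.id X)
      fun r => (IsScalarTower.algebraMap_apply R R' X r).symm)
  inv := @CommAlgCat.ofHom R _ X X _ _ _ (Algebra.compHom X (algebraMap R R'))
    (@AlgHom.mk R X X _ _ _ _ (Algebra.compHom X (algebraMap R R')) (RingHom.id X)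
      fun r => (IsScalarTower.algebraMap_apply R R' X r))
  hom_inv_id := rfl
  inv_hom_id := rfl

section Affine

variable {R' : Type u} [CommRing R'] [Algebra R R'] {A : Type u} [CommRing A] [Algebra R' A]
  [TopologicalSpace A] (G : CommAlgCat.{u} R ⥤ Type u) (i : restrictAlg R R' ⋙ G ≅ spf R' A)
  {X Y : Type u} [CommRing X] [Algebra R X] [Algebra R' X] [IsScalarTower R R' X]
  [CommRing Y] [Algebra R Y] [Algebra R' Y] [IsScalarTower R R' Y]

/-- The points of `G` over an `R'`-algebra, if `G` is isomorphic to `Spf A` over `R'`. -/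
def affinePts (X : Type u) [CommRing X] [Algebra R X] [Algebra R' X] [IsScalarTower R R' X] :
    G.obj (CommAlgCat.of R X) ≃ SpfPoints R' A X :=
  ((G.mapIso (restrictIso R R' X)).symm.trans (i.app (CommAlgCat.of R' X))).toEquiv

theorem affinePts_push (u : X →ₐ[R'] Y) (x : G.obj (CommAlgCat.of R X)) :
    affinePts G i Y (push G (u.restrictScalars R) x) = SpfPoints.map u (affinePts G i X x) := by
  have h1 : CommAlgCat.ofHom (u.restrictScalars R) ≫ (restrictIso R R' Y).inv =
      (restrictIso R R' X).inv ≫ (restrictAlg R R').map (CommAlgCat.ofHom u) := rfl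
  have h2 := i.hom.naturality (CommAlgCat.ofHom u)
  have h3 := ConcreteCategory.congr_hom h2 (G.map (restrictIso R R' X).inv x)
  refine Eq.trans ?_ h3
  change i.hom.app _ (G.map (restrictIso R R' Y).inv (G.map (CommAlgCat.ofHom _) x)) =
    i.hom.app _ (G.map ((restrictAlg R R').map (CommAlgCat.ofHom u))
      (G.map (restrictIso R R' X).inv x))
  rw [← G.map_comp_apply, ← G.map_comp_apply, h1]

include i in
theorem push_injective_of_affine (u : X →ₐ[R'] Y) (hu : Function.Injective u) :
    Function.Injective (push G (u.restrictScalars R)) := fun x y h => by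
  refine (affinePts G i X).injective (SpfPoints.map_injective u hu ?_)
  rw [← affinePts_push, ← affinePts_push, h]

include i in
theorem exists_push_eq_of_affine {ι : Type*} (u : X →ₐ[R'] Y) (hu : Function.Injective u)
    (v : ι → Y →ₐ[R'] Y) (huv : ∀ y, (∀ k, v k y = y) → y ∈ u.range)
    (y : G.obj (CommAlgCat.of R Y)) (hy : ∀ k, push G ((v k).restrictScalars R) y = y) :
    ∃ x, push G (u.restrictScalars R) x = y := by
  obtain ⟨g, hg⟩ := SpfPoints.exists_map_eq u hu (affinePts G i Y y) fun a => huv _ fun k => by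
    have := affinePts_push G i (v k) y
    rw [hy k] at this
    exact (DFunLike.congr_fun (congrArg Subtype.val this) a).symm
  refine ⟨(affinePts G i X).symm g, (affinePts G i Y).injective ?_⟩
  rw [affinePts_push, Equiv.apply_symm_apply, hg]

end Affine

/-- An `R`-algebra in which `f` is invertible is an algebra over the localization of `R` at `f`. -/
theorem exists_algebra_of_isUnit {f : R} {R' : Type u} [CommRing R'] [Algebra R R']
    [IsLocalization.Away f R'] (X : Type u) [CommRing X] [Algebra R X]
    (h : IsUnit (algebraMap R X f)) : ∃ _ : Algebra R' X, IsScalarTower R R' X := by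
  let φ : R' →+* X := IsLocalization.Away.lift f h
  let : Algebra R' X := φ.toAlgebra
  exact ⟨inferInstance, IsScalarTower.of_algebraMap_eq fun r =>
    (IsLocalization.Away.lift_eq f h r).symm⟩

/-- Over `R'`-algebras for a localization `R'` of `R`, every `R`-linear homomorphism is
`R'`-linear. -/
theorem exists_restrictScalars_eq {f : R} {R' : Type u} [CommRing R'] [Algebra R R']
    [IsLocalization.Away f R'] {X Y : Type u} [CommRing X] [Algebra R X] [Algebra R' X]
    [IsScalarTower R R' X] [CommRing Y] [Algebra R Y] [Algebra R' Y] [IsScalarTower R R' Y]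
    (u : X →ₐ[R] Y) : ∃ u' : X →ₐ[R'] Y, u'.restrictScalars R = u := by
  have h : u.toRingHom.comp (algebraMap R' X) = algebraMap R' Y := by
    refine IsLocalization.ringHom_ext (Submonoid.powers f) (RingHom.ext fun r => ?_)
    change u (algebraMap R' X (algebraMap R R' r)) = algebraMap R' Y (algebraMap R R' r)
    rw [← IsScalarTower.algebraMap_apply, ← IsScalarTower.algebraMap_apply, u.commutes]
  exact ⟨{ u.toRingHom with commutes' := fun r => RingHom.congr_fun h r }, rfl⟩

/-- The condition of `IsLocallyAffine` at a single element. -/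
def IsAffineAt (G : CommAlgCat.{u} R ⥤ Type u) (f : R) : Prop :=
  ∃ (Rf : Type u) (_ : CommRing Rf) (_ : Algebra R Rf) (_ : IsLocalization.Away f Rf)
    (A : Type u) (_ : CommRing A) (_ : Algebra Rf A) (_ : TopologicalSpace A)
    (_ : IsFormalAlgebra Rf A), Nonempty (restrictAlg R Rf ⋙ G ≅ spf Rf A)

section

variable {G : CommAlgCat.{u} R ⥤ Type u} {X Y : Type u} [CommRing X] [Algebra R X] [CommRing Y]
  [Algebra R Y]

theorem IsAffineAt.push_injective {f : R} (hf : IsAffineAt G f) (hX : IsUnit (algebraMap R X f))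
    (u : X →ₐ[R] Y) (hu : Function.Injective u) : Function.Injective (push G u) := by
  obtain ⟨R', _, _, _, A, _, _, _, -, ⟨i⟩⟩ := hf
  have hY : IsUnit (algebraMap R Y f) := by
    rw [← u.commutes]
    exact hX.map u
  obtain ⟨_, _⟩ := exists_algebra_of_isUnit (R' := R') X hX
  obtain ⟨_, _⟩ := exists_algebra_of_isUnit (R' := R') Y hY
  obtain ⟨u, rfl⟩ := exists_restrictScalars_eq (f := f) (R' := R') u
  exact push_injective_of_affine G i u hu

theorem IsAffineAt.exists_push_eq {f : R} (hf : IsAffineAt G f) (hX : IsUnit (algebraMap R X f))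
    {ι : Type*} (u : X →ₐ[R] Y) (hu : Function.Injective u)
    (v : ι → Y →ₐ[R] Y) (huv : ∀ y, (∀ k, v k y = y) → y ∈ u.range)
    (y : G.obj (CommAlgCat.of R Y)) (hy : ∀ k, push G (v k) y = y) :
    ∃ x, push G u x = y := by
  obtain ⟨R', _, _, _, A, _, _, _, -, ⟨i⟩⟩ := hf
  have hY : IsUnit (algebraMap R Y f) := by
    rw [← u.commutes]
    exact hX.map u
  obtain ⟨_, _⟩ := exists_algebra_of_isUnit (R' := R') X hX
  obtain ⟨_, _⟩ := exists_algebra_of_isUnit (R' := R') Y hY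
  obtain ⟨u, rfl⟩ := exists_restrictScalars_eq (f := f) (R' := R') u
  choose v' hv' using fun k => exists_restrictScalars_eq (f := f) (R' := R') (v k)
  obtain rfl : (fun k => (v' k).restrictScalars R) = v := funext hv'
  exact exists_push_eq_of_affine G i u hu v' huv y hy

/-- The localization homomorphism `X → X[1/b]`. -/
abbrev locHom (R : Type u) [CommRing R] {X : Type u} [CommRing X] [Algebra R X] (b : X) :
    X →ₐ[R] Localization.Away b := IsScalarTower.toAlgHom R X (Localization.Away b)

theorem exists_locMap (b : X) (u : X →ₐ[R] Y) (h : IsUnit (u b)) :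
    ∃ w : Localization.Away b →ₐ[R] Y, w.comp (locHom R b) = u := by
  have h' : ∀ y : Submonoid.powers b, IsUnit (u y) := by
    rintro ⟨_, k, rfl⟩
    rw [map_pow]
    exact h.pow k
  exact ⟨IsLocalization.liftAlgHom h', AlgHom.ext fun x => IsLocalization.lift_eq h' x⟩

theorem isUnit_locHom_of_dvd {b c : X} (h : b ∣ c) : IsUnit (locHom R c b) :=
  isUnit_of_dvd_unit (map_dvd _ h) (IsLocalization.Away.algebraMap_isUnit c)

theorem locHom_eq_locHom_iff {b : X} {x y : X} :
    locHom R b x = locHom R b y ↔ ∃ k : ℕ, b ^ k * x = b ^ k * y := by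
  change algebraMap X (Localization.Away b) x = algebraMap X (Localization.Away b) y ↔ _
  rw [IsLocalization.eq_iff_exists (Submonoid.powers b)]
  exact ⟨fun ⟨⟨_, k, hk⟩, h⟩ => ⟨k, by rw [show b ^ k = _ from hk]; exact h⟩,
    fun ⟨k, h⟩ => ⟨⟨_, k, rfl⟩, h⟩⟩

theorem isUnit_algebraMap_away (f : R) :
    IsUnit (algebraMap R (Localization.Away (algebraMap R X f)) f) := by
  have h := isUnit_locHom_of_dvd (R := R) (dvd_refl (algebraMap R X f))
  rwa [AlgHom.commutes] at h

theorem exists_locHom_eq (b : X) (x : Localization.Away b) :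
    ∃ (k : ℕ) (y : X), locHom R b (b ^ k) * x = locHom R b y := by
  obtain ⟨k, y, h⟩ := IsLocalization.Away.surj b x
  refine ⟨k, y, ?_⟩
  rw [mul_comm, map_pow]
  exact h

theorem isUnit_locHom_pow (b : X) (k : ℕ) : IsUnit (locHom R b (b ^ k)) := by
  rw [map_pow]
  exact (isUnit_locHom_of_dvd dvd_rfl).pow k

theorem locMap_injective {b : X} {c : Y} (u : X →ₐ[R] Y) (hu : Function.Injective u) (hc : u b = c)
    (w : Localization.Away b →ₐ[R] Localization.Away c)
    (hw : w.comp (locHom R b) = (locHom R c).comp u) : Function.Injective w := by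
  subst hc
  rw [injective_iff_map_eq_zero]
  intro x hx
  obtain ⟨k, y, h⟩ := exists_locHom_eq (R := R) b x
  have h1 : locHom R (u b) (u y) = locHom R (u b) (u 0) := by
    have h2 := DFunLike.congr_fun hw y
    rw [AlgHom.comp_apply, ← h, map_mul, hx, mul_zero] at h2
    rw [map_zero, map_zero]
    exact h2.symm
  obtain ⟨l, hl⟩ := locHom_eq_locHom_iff.1 h1
  rw [map_zero, mul_zero, ← map_pow, ← map_mul] at hl
  have h3 : b ^ l * y = b ^ l * 0 := by
    rw [mul_zero]
    exact hu (hl.trans (map_zero u).symm)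
  rw [locHom_eq_locHom_iff.2 ⟨l, h3⟩, map_zero] at h
  exact (isUnit_locHom_pow b k).mul_right_eq_zero.1 h

/-- Localization preserves invariants under finitely many endomorphisms. -/
theorem mem_range_locMap {b : X} {c : Y} (u : X →ₐ[R] Y) (hc : u b = c)
    {ι : Type*} [Finite ι] (v : ι → Y →ₐ[R] Y) (huv : ∀ y, (∀ k, v k y = y) → y ∈ u.range)
    (hv : ∀ k, v k c = c)
    (w : Localization.Away b →ₐ[R] Localization.Away c)
    (hw : w.comp (locHom R b) = (locHom R c).comp u)
    (v' : ι → Localization.Away c →ₐ[R] Localization.Away c)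
    (hv' : ∀ k, (v' k).comp (locHom R c) = (locHom R c).comp (v k))
    (y : Localization.Away c) (hy : ∀ k, v' k y = y) : y ∈ w.range := by
  have := Fintype.ofFinite ι
  obtain ⟨k, z, h⟩ := exists_locHom_eq (R := R) c y
  have h1 : ∀ i, locHom R c (v i z) = locHom R c z := fun i => by
    have h2 := DFunLike.congr_fun (hv' i) z
    rw [AlgHom.comp_apply, AlgHom.comp_apply] at h2
    rw [← h2, ← h, map_mul, hy]
    have h3 := DFunLike.congr_fun (hv' i) (c ^ k)
    rw [AlgHom.comp_apply, AlgHom.comp_apply, map_pow (v i), hv] at h3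
    rw [h3]
  choose l hl using fun i => locHom_eq_locHom_iff.1 (h1 i)
  let m := Finset.univ.sup l
  have h4 : ∀ i, v i (c ^ m * z) = c ^ m * z := fun i => by
    have h5 : m = (m - l i) + l i := (Nat.sub_add_cancel (Finset.le_sup (Finset.mem_univ i))).symm
    rw [map_mul, map_pow, hv, h5, pow_add, mul_assoc, hl, mul_assoc]
  obtain ⟨x, hx⟩ := huv _ h4
  obtain ⟨a, ha⟩ := isUnit_locHom_pow (R := R) b (m + k)
  have h6 : w (locHom R b (b ^ (m + k))) = locHom R c (c ^ (m + k)) := by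
    have := DFunLike.congr_fun hw (b ^ (m + k))
    rw [AlgHom.comp_apply, AlgHom.comp_apply, map_pow u, hc] at this
    exact this
  refine ⟨↑a⁻¹ * locHom R b x, ?_⟩
  refine (isUnit_locHom_pow (R := R) c (m + k)).mul_left_cancel ?_
  change _ * w (↑a⁻¹ * locHom R b x) = _
  rw [← h6, ← map_mul, ← ha, Units.mul_inv_cancel_left]
  have h7 := DFunLike.congr_fun hw x
  rw [AlgHom.comp_apply, AlgHom.comp_apply] at h7
  rw [h7, ha, h6]
  change locHom R c (u x) = _
  rw [show u x = c ^ m * z from hx, pow_add, map_mul, map_mul, ← h, mul_assoc]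

variable (hs : IsZariskiSheaf G) (ha : IsLocallyAffine G)

include ha in
theorem exists_finset_isAffineAt : ∃ t : Finset R, Ideal.span (t : Set R) = ⊤ ∧
    ∀ f ∈ t, IsAffineAt G f := by
  obtain ⟨s, hs, h⟩ := ha
  obtain ⟨t, hts, ht⟩ := Submodule.mem_span_finite_of_mem_span ((Ideal.eq_top_iff_one _).1 hs)
  exact ⟨t, (Ideal.eq_top_iff_one _).2 ht, fun f hf => h f (hts hf)⟩

theorem span_image_algebraMap [DecidableEq X] {t : Finset R} (ht : Ideal.span (t : Set R) = ⊤) :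
    Ideal.span (t.image (algebraMap R X) : Set X) = ⊤ := by
  rw [Finset.coe_image, ← Ideal.map_span, ht, Ideal.map_top]

include hs in
/-- Sections of a Zariski sheaf are determined locally. -/
theorem eq_of_push_locHom_eq (s : Finset X) (hspan : Ideal.span (s : Set X) = ⊤)
    {x y : G.obj (CommAlgCat.of R X)} (h : ∀ b ∈ s, push G (locHom R b) x = push G (locHom R b) y) :
    x = y := by
  refine (hs (CommAlgCat.of R X) s hspan (fun b => push G (locHom R (b : X)) x) ?_).unique
    (fun b => rfl) fun b => (h b b.2).symm
  intro b c C p q hpq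
  refine (G.map_comp_apply _ _ x).symm.trans (Eq.trans ?_ (G.map_comp_apply _ _ x))
  exact congrArg (fun m => G.map m x) hpq

include hs ha in
/-- A formal group maps injections to injections. -/
theorem push_injective (u : X →ₐ[R] Y) (hu : Function.Injective u) :
    Function.Injective (push G u) := by
  classical
  obtain ⟨t, ht, hta⟩ := exists_finset_isAffineAt ha
  intro x y hxy
  refine eq_of_push_locHom_eq hs _ (span_image_algebraMap ht) fun b hb => ?_
  obtain ⟨f, hf, rfl⟩ := Finset.mem_image.1 hb
  obtain ⟨w, hw⟩ := exists_locMap (algebraMap R X f)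
    ((locHom R (u (algebraMap R X f))).comp u)
    (isUnit_locHom_of_dvd (R := R) (c := u (algebraMap R X f)) dvd_rfl)
  refine (hta f hf).push_injective (isUnit_algebraMap_away f) w (locMap_injective u hu rfl w hw) ?_
  rw [push_push, push_push, hw, ← push_push, ← push_push, hxy]

include hs ha in
/-- A formal group preserves invariants under finitely many endomorphisms. -/
theorem exists_push_eq {ι : Type*} [Finite ι] (u : X →ₐ[R] Y) (hu : Function.Injective u)
    (v : ι → Y →ₐ[R] Y) (huv : ∀ y, (∀ k, v k y = y) → y ∈ u.range)
    (y : G.obj (CommAlgCat.of R Y)) (hy : ∀ k, push G (v k) y = y) : ∃ x, push G u x = y := by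
  classical
  obtain ⟨t, ht, hta⟩ := exists_finset_isAffineAt ha
  have hw : ∀ b : X, ∃ w : Localization.Away b →ₐ[R] Localization.Away (u b),
      w.comp (locHom R b) = (locHom R (u b)).comp u := fun b =>
    exists_locMap b ((locHom R (u b)).comp u) (isUnit_locHom_of_dvd (R := R) (c := u b) dvd_rfl)
  choose w hw using hw
  have hx : ∀ b : t.image (algebraMap R X), ∃ x, push G (w b) x = push G (locHom R (u b)) y := by
    rintro ⟨b, hb⟩
    obtain ⟨f, hf, rfl⟩ := Finset.mem_image.1 hb
    have hvf : ∀ k, v k (u (algebraMap R X f)) = u (algebraMap R X f) := fun k => by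
      rw [u.commutes, (v k).commutes]
    choose v' hv' using fun k => exists_locMap (u (algebraMap R X f))
      ((locHom R (u (algebraMap R X f))).comp (v k)) (by
        rw [AlgHom.comp_apply, hvf]
        exact isUnit_locHom_of_dvd dvd_rfl)
    refine (hta f hf).exists_push_eq (isUnit_algebraMap_away f) _
        (locMap_injective u hu rfl _ (hw _)) v'
      (mem_range_locMap u rfl v huv hvf _ (hw _) v' hv') _ fun k => ?_
    rw [push_push, hv', ← push_push, hy]
  choose x hx using hx
  have key : ∀ (b c : t.image (algebraMap R X)) (d : X) (_ : (b : X) ∣ d)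
      (α : Localization.Away (b : X) →ₐ[R] Localization.Away d)
      (_ : α.comp (locHom R (b : X)) = locHom R d),
      push G (w d) (push G α (x b)) = push G (locHom R (u d)) y := by
    intro b c d hd α hα
    obtain ⟨β, hβ⟩ := exists_locMap (u b) (locHom R (u d)) (isUnit_locHom_of_dvd (map_dvd u hd))
    have h1 : (w d).comp α = β.comp (w b) := by
      have h2 : ((w d).comp α).comp (locHom R (b : X)) = (β.comp (w b)).comp (locHom R (b : X)) := by
        rw [AlgHom.comp_assoc, hα, hw, AlgHom.comp_assoc, hw, ← AlgHom.comp_assoc, hβ]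
      refine AlgHom.coe_ringHom_injective (IsLocalization.ringHom_ext (Submonoid.powers (b : X)) ?_)
      exact RingHom.ext fun z => DFunLike.congr_fun h2 z
    rw [push_push, h1, ← push_push, hx, push_push, hβ]
  obtain ⟨x₀, hx₀, -⟩ := hs (CommAlgCat.of R X) (t.image (algebraMap R X))
    (span_image_algebraMap ht) x (by
      intro b c C p q hpq
      let d : X := b * c
      obtain ⟨α, hα⟩ := exists_locMap (b : X) (locHom R d) (isUnit_locHom_of_dvd ⟨_, rfl⟩)
      obtain ⟨β, hβ⟩ := exists_locMap (c : X) (locHom R d)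
        (isUnit_locHom_of_dvd ⟨_, mul_comm _ _⟩)
      have hpq' : p.hom.comp (locHom R (b : X)) = q.hom.comp (locHom R (c : X)) :=
        congrArg CommAlgCat.Hom.hom hpq
      obtain ⟨r, hr⟩ := exists_locMap d (p.hom.comp (locHom R (b : X))) (by
        rw [map_mul]
        refine IsUnit.mul ?_ ?_
        · exact (isUnit_locHom_of_dvd (R := R) (c := (b : X)) dvd_rfl).map p.hom
        · rw [hpq']
          exact (isUnit_locHom_of_dvd (R := R) (c := (c : X)) dvd_rfl).map q.hom)
      have h1 : r.comp α = p.hom := by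
        have h2 : (r.comp α).comp (locHom R (b : X)) = p.hom.comp (locHom R (b : X)) := by
          rw [AlgHom.comp_assoc, hα, hr]
        refine AlgHom.coe_ringHom_injective
          (IsLocalization.ringHom_ext (Submonoid.powers (b : X)) ?_)
        exact RingHom.ext fun z => DFunLike.congr_fun h2 z
      have h1' : r.comp β = q.hom := by
        have h2 : (r.comp β).comp (locHom R (c : X)) = q.hom.comp (locHom R (c : X)) := by
          rw [AlgHom.comp_assoc, hβ, hr, hpq']
        refine AlgHom.coe_ringHom_injective
          (IsLocalization.ringHom_ext (Submonoid.powers (c : X)) ?_)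
        exact RingHom.ext fun z => DFunLike.congr_fun h2 z
      have h3 : push G α (x b) = push G β (x c) := by
        refine push_injective hs ha (w d) (locMap_injective u hu rfl _ (hw _)) ?_
        rw [key b c d ⟨_, rfl⟩ α hα, key c b d ⟨_, mul_comm _ _⟩ β hβ]
      have h4 : push G r (push G α (x b)) = push G r (push G β (x c)) := by rw [h3]
      rw [push_push, push_push, h1, h1'] at h4
      exact h4)
  refine ⟨x₀, ?_⟩
  refine eq_of_push_locHom_eq hs _ (span_image_algebraMap ht) fun c hc => ?_
  obtain ⟨f, hf, rfl⟩ := Finset.mem_image.1 hc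
  have hb : algebraMap R X f ∈ t.image (algebraMap R X) := Finset.mem_image_of_mem _ hf
  rw [← u.commutes f, push_push, ← hw, ← push_push, ← hx ⟨_, hb⟩]
  exact congrArg _ (hx₀ ⟨_, hb⟩)

end

end LeftExact

/-! ### The universal property -/

section Universal

variable {R : Type u} [CommRing R] {n : ℕ}

/-- The base point of formal affine space. -/
def basePt (R : Type u) [CommRing R] (n : ℕ) (X : Type u) [CommRing X] [Algebra R X] :
    AffinePoints R n X := basePoint R n (CommAlgCat.of R X)

variable {X Y : Type u} [CommRing X] [Algebra R X] [CommRing Y] [Algebra R Y]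

theorem basePt_X (j : Fin n) : (basePt R n X).1 (MvPowerSeries.X j) = 0 := by
  change algebraMap R X (MvPowerSeries.constantCoeff (MvPowerSeries.X j)) = 0
  simp

theorem universalMor_basePt : universalMor (basePt R n X) = 0 := by
  rw [← CartierDual.ofGroupLike_one]
  refine Subtype.ext (AlgHom.ext fun ψ => ?_)
  change algebraMap R X (MvPowerSeries.constantCoeff (universalHom R n ψ)) =
    CartierDual.pairing X ψ.toLin (1 ⊗ₜ 1)
  rw [← MvPowerSeries.coeff_zero_eq_constantCoeff_apply, coeff_universalHom, dcoord_zero,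
    CartierDual.pairing_tmul, Algebra.smul_def, mul_one]

theorem map_map (v : Y →ₐ[R] X) {Z : Type u} [CommRing Z] [Algebra R Z] (u : Z →ₐ[R] Y)
    (g : SpfPoints R (CartierDual R (WittCoord R n)) Z) :
    SpfPoints.map v (SpfPoints.map u g) = SpfPoints.map (v.comp u) g := rfl

theorem eq_of_map_thetaSym_eq {e : ℕ} {u v : symAlg R n e →ₐ[R] X}
    (h : SpfPoints.map u (thetaSym R n e) = SpfPoints.map v (thetaSym R n e)) : u = v := by
  refine AlgHom.ext fun x => ?_
  obtain ⟨ψ, rfl⟩ := thetaSym_surjective x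
  exact DFunLike.congr_fun (congrArg Subtype.val h) ψ

/-- Extension of a tuple of points by base points. -/
def padded {e : ℕ} (c : Fin e → AffinePoints R n X) (k : ℕ) : Fin (e + k) → AffinePoints R n X :=
  Fin.append c fun _ => basePt R n X

theorem padded_X_pow {e : ℕ} (c : Fin e → AffinePoints R n X) (k m : ℕ)
    (hc : ∀ i j, (c i).1 (MvPowerSeries.X j) ^ (m + 1) = 0) (i : Fin (e + k)) (j : Fin n) :
    (padded c k i).1 (MvPowerSeries.X j) ^ (m + 1) = 0 := by
  refine Fin.addCases (fun i => ?_) (fun i => ?_) i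
  · rw [padded, Fin.append_left, hc]
  · rw [padded, Fin.append_right, basePt_X, zero_pow (by omega)]

theorem sum_padded {e : ℕ} (c : Fin e → AffinePoints R n X) (k : ℕ) {M : Type*} [AddCommMonoid M]
    (F : AffinePoints R n X → M) (hF : F (basePt R n X) = 0) :
    ∑ i, F (padded c k i) = ∑ i, F (c i) := by
  simp [Fin.sum_univ_add, padded, hF]

variable (G : CommAlgCat.{u} R ⥤ AddCommGrpCat.{u})

/-- The homomorphism `G(X) → G(Y)` induced by a homomorphism `X → Y`. -/
def gpush (u : X →ₐ[R] Y) : G.obj (CommAlgCat.of R X) →+ G.obj (CommAlgCat.of R Y) :=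
  (G.map (CommAlgCat.ofHom u)).hom

theorem gpush_gpush {Z : Type u} [CommRing Z] [Algebra R Z] (v : Y →ₐ[R] Z) (u : X →ₐ[R] Y)
    (x : G.obj (CommAlgCat.of R X)) : gpush G v (gpush G u x) = gpush G (v.comp u) x :=
  push_push (G ⋙ forget AddCommGrpCat) v u x

variable {G}

theorem gpush_injective (hG : IsCommFormalGroup R G) (u : X →ₐ[R] Y) (hu : Function.Injective u) :
    Function.Injective (gpush G u) :=
  push_injective hG.1 hG.2 u hu

/-- The value of a pointed morphism at a point of formal affine space. -/
def value (η : pointedMor R n G) (f : AffinePoints R n X) : G.obj (CommAlgCat.of R X) :=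
  η.1 (CommAlgCat.of R X) f

theorem gpush_value (η : pointedMor R n G) (u : X →ₐ[R] Y) (f : AffinePoints R n X) :
    gpush G u (value η f) = value η (AffinePoints.map u f) :=
  (η.2.1 _ _ (CommAlgCat.ofHom u) f).symm

theorem value_basePt (η : pointedMor R n G) : value η (basePt R n X) = 0 := η.2.2 _

/-- The symmetric element `∑ η(t_i)` of `G` over the truncated polynomial ring comes from the ring
of symmetric elements, because `G` is left exact. -/
theorem exists_symValue (hG : IsCommFormalGroup R G) (η : pointedMor R n G) (e : ℕ) :
    ∃ y : G.obj (CommAlgCat.of R (symAlg R n e)),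
      gpush G (symAlg R n e).val y = ∑ i, value η (tpoint R n e i) := by
  refine exists_push_eq hG.1 hG.2 (symAlg R n e).val Subtype.val_injective
    (fun σ : Equiv.Perm (Fin e) => permHom σ) (fun y hy => ?_) _ fun σ => ?_
  · rw [Subalgebra.range_val]
    exact mem_symAlg.2 hy
  · change gpush G (permHom σ) _ = _
    rw [map_sum]
    simp only [gpush_value]
    have h : ∀ i, AffinePoints.map (permHom σ) (tpoint R n e i) = tpoint R n e (σ i) :=
      fun i => map_tpoint _ _ i
    simp only [h]
    exact Equiv.sum_comp σ fun i => value η (tpoint R n e i)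

section Extension

variable (hG : IsCommFormalGroup R G) (η : pointedMor R n G)

/-- The element of `G` over the symmetric elements that is given by `∑ η(t_i)`. -/
def symValue (e : ℕ) : G.obj (CommAlgCat.of R (symAlg R n e)) := (exists_symValue hG η e).choose

theorem gpush_val_symValue (e : ℕ) : gpush G (symAlg R n e).val (symValue hG η e) =
    ∑ i, value η (tpoint R n e i) := (exists_symValue hG η e).choose_spec

theorem gpush_tlift_symValue {e : ℕ} (c : Fin e → AffinePoints R n X)
    (hc : ∀ i j, (c i).1 (MvPowerSeries.X j) ^ (e + 1) = 0) :
    gpush G ((tlift c hc).comp (symAlg R n e).val) (symValue hG η e) = ∑ i, value η (c i) := by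
  rw [← gpush_gpush, gpush_val_symValue, map_sum]
  simp only [gpush_value, map_tpoint]

theorem map_tlift_thetaSym {e : ℕ} (c : Fin e → AffinePoints R n X)
    (hc : ∀ i j, (c i).1 (MvPowerSeries.X j) ^ (e + 1) = 0) :
    SpfPoints.map ((tlift c hc).comp (symAlg R n e).val) (thetaSym R n e) =
      ∑ i, universalMor (c i) := by
  rw [← map_map, map_val_thetaSym, map_tlift_theta]

/-- The symmetric powers form a direct system, and `symValue` is compatible with it. -/
theorem exists_transition (e k : ℕ) : ∃ ρ : symAlg R n (e + k) →ₐ[R] symAlg R n e,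
    SpfPoints.map ρ (thetaSym R n (e + k)) = thetaSym R n e ∧
      gpush G ρ (symValue hG η (e + k)) = symValue hG η e := by
  obtain ⟨ρ, hρ⟩ := exists_map_thetaSym_eq (e := e + k) (thetaSym R n e) fun ψ hψ => by
    refine Subtype.ext ((val_thetaSym ψ).trans (theta_eq_zero_iff.2 fun τ hτ => ?_))
    obtain ⟨τ', hτ', h⟩ := exists_mult_eq_mono (Nat.le_add_right e k) ⟨τ, hτ, rfl⟩
    rw [← h]
    exact theta_eq_zero_iff.1 hψ τ' hτ'
  refine ⟨ρ, hρ, ?_⟩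
  let c := padded (tpoint R n e) k
  have hc : ∀ i j, (c i).1 (MvPowerSeries.X j) ^ (e + k + 1) = 0 := by
    refine padded_X_pow _ k (e + k) fun i j => ?_
    rw [tpoint_X]
    exact pow_eq_zero_of_le (by omega) (mk_X_pow _)
  have h1 : (symAlg R n e).val.comp ρ = (tlift c hc).comp (symAlg R n (e + k)).val := by
    refine eq_of_map_thetaSym_eq ?_
    rw [map_tlift_thetaSym, ← map_map, hρ, map_val_thetaSym,
      sum_padded _ _ _ universalMor_basePt, theta]
  refine gpush_injective hG (symAlg R n e).val Subtype.val_injective ?_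
  rw [gpush_gpush, h1, gpush_tlift_symValue, gpush_val_symValue,
    sum_padded _ _ _ (value_basePt η)]

/-- `symValue` depends only on the point that `thetaSym` is mapped to. -/
theorem gpush_symValue_eq {e e' : ℕ} {u : symAlg R n e →ₐ[R] X} {u' : symAlg R n e' →ₐ[R] X}
    (h : SpfPoints.map u (thetaSym R n e) = SpfPoints.map u' (thetaSym R n e')) :
    gpush G u (symValue hG η e) = gpush G u' (symValue hG η e') := by
  wlog hle : e ≤ e' generalizing e e'
  · exact (this h.symm (le_of_not_ge hle)).symm
  obtain ⟨k, rfl⟩ := Nat.exists_eq_add_of_le hle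
  obtain ⟨ρ, h1, h2⟩ := exists_transition hG η e k
  have h3 : u.comp ρ = u' := eq_of_map_thetaSym_eq (by rw [← map_map, h1, h])
  rw [← h3, ← gpush_gpush, h2]

theorem exists_symAlg_hom (g : SpfPoints R (CartierDual R (WittCoord R n)) X) :
    ∃ (e : ℕ) (u : symAlg R n e →ₐ[R] X), SpfPoints.map u (thetaSym R n e) = g := by
  obtain ⟨e, he⟩ := exists_factor g
  exact ⟨e, he e le_rfl⟩

/-- The extension of a pointed morphism from formal affine space to the dual of the Witt
vectors. -/
def extend (g : SpfPoints R (CartierDual R (WittCoord R n)) X) : G.obj (CommAlgCat.of R X) :=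
  gpush G (exists_symAlg_hom g).choose_spec.choose (symValue hG η (exists_symAlg_hom g).choose)

theorem extend_map_thetaSym {e : ℕ} (u : symAlg R n e →ₐ[R] X) :
    extend hG η (SpfPoints.map u (thetaSym R n e)) = gpush G u (symValue hG η e) :=
  gpush_symValue_eq hG η (exists_symAlg_hom _).choose_spec.choose_spec

theorem gpush_extend (v : X →ₐ[R] Y) (g : SpfPoints R (CartierDual R (WittCoord R n)) X) :
    gpush G v (extend hG η g) = extend hG η (SpfPoints.map v g) := by
  obtain ⟨e, u, rfl⟩ := exists_symAlg_hom g
  rw [map_map, extend_map_thetaSym, extend_map_thetaSym, gpush_gpush]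

theorem extend_sum {l : ℕ} (c : Fin l → AffinePoints R n X) :
    extend hG η (∑ i, universalMor (c i)) = ∑ i, value η (c i) := by
  obtain ⟨m, hm⟩ := AffinePoints.exists_pow_eq_zero c
  let c' := padded c m
  have hc : ∀ i j, (c' i).1 (MvPowerSeries.X j) ^ (l + m + 1) = 0 :=
    padded_X_pow c m (l + m) (hm _ (Nat.le_add_left _ _))
  rw [← sum_padded c m universalMor universalMor_basePt, ← sum_padded c m _ (value_basePt η),
    ← map_tlift_thetaSym c' hc, ← gpush_tlift_symValue hG η c' hc, extend_map_thetaSym]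

theorem extend_universalMor (f : AffinePoints R n X) :
    extend hG η (universalMor f) = value η f := by
  have h := extend_sum hG η (l := 1) fun _ => f
  rwa [Fin.sum_univ_one, Fin.sum_univ_one] at h

/-- Additivity of the extension at two images of the universal point. By left exactness of `G` it
can be checked after an injection under which both become sums of values of the universal
morphism. -/
theorem extend_add_of_injective {e : ℕ} (l r : symAlg R n e →ₐ[R] X)
    (l' r' : TruncRing R n e →ₐ[R] Y) (j : X →ₐ[R] Y) (hj : Function.Injective j)
    (hl : j.comp l = l'.comp (symAlg R n e).val) (hr : j.comp r = r'.comp (symAlg R n e).val) :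
    extend hG η (SpfPoints.map l (thetaSym R n e) + SpfPoints.map r (thetaSym R n e)) =
      extend hG η (SpfPoints.map l (thetaSym R n e)) +
        extend hG η (SpfPoints.map r (thetaSym R n e)) := by
  refine gpush_injective hG j hj ?_
  rw [map_add, gpush_extend, gpush_extend, gpush_extend, CartierDual.map_add, map_map, map_map,
    hl, hr, ← map_map, ← map_map, map_val_thetaSym, theta, map_sum_universalMor,
    map_sum_universalMor]
  have happ := extend_sum hG η (Fin.append (fun i => AffinePoints.map l' (tpoint R n e i))
    fun i => AffinePoints.map r' (tpoint R n e i))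
  simp only [Fin.sum_univ_add, Fin.append_left, Fin.append_right] at happ
  rw [happ, extend_sum, extend_sum]

/-- Additivity of `extend` passes from a pair of points over `X` to the image of the pair over an
`X`-algebra `Y`; it therefore suffices to treat the universal pair. -/
theorem extend_add_of_factor {e : ℕ} (u u' : symAlg R n e →ₐ[R] Y) (l r : symAlg R n e →ₐ[R] X)
    (v : X →ₐ[R] Y) (hl : v.comp l = u) (hr : v.comp r = u')
    (h : extend hG η (SpfPoints.map l (thetaSym R n e) + SpfPoints.map r (thetaSym R n e)) =
      extend hG η (SpfPoints.map l (thetaSym R n e)) +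
        extend hG η (SpfPoints.map r (thetaSym R n e))) :
    extend hG η (SpfPoints.map u (thetaSym R n e) + SpfPoints.map u' (thetaSym R n e)) =
      extend hG η (SpfPoints.map u (thetaSym R n e)) +
        extend hG η (SpfPoints.map u' (thetaSym R n e)) := by
  subst hl hr
  have h' := congrArg (gpush G v) h
  rwa [map_add, gpush_extend, gpush_extend, gpush_extend, CartierDual.map_add] at h'

/-- The extension is additive: it suffices to consider the two universal points over the tensor
square of the ring of symmetric elements. -/
theorem extend_add (g g' : SpfPoints R (CartierDual R (WittCoord R n)) X) :
    extend hG η (g + g') = extend hG η g + extend hG η g' := by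
  obtain ⟨e₁, h₁⟩ := exists_factor g
  obtain ⟨e₂, h₂⟩ := exists_factor g'
  obtain ⟨u, rfl⟩ := h₁ (max e₁ e₂) (le_max_left _ _)
  obtain ⟨u', rfl⟩ := h₂ (max e₁ e₂) (le_max_right _ _)
  refine extend_add_of_factor hG η
    (X := symAlg R n (max e₁ e₂) ⊗[R] symAlg R n (max e₁ e₂)) u u' Algebra.TensorProduct.includeLeft
    Algebra.TensorProduct.includeRight
    (Algebra.TensorProduct.lift u u' fun _ _ => Commute.all _ _)
    (Algebra.TensorProduct.lift_comp_includeLeft u u' fun _ _ => Commute.all _ _)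
    (Algebra.TensorProduct.lift_comp_includeRight u u' fun _ _ => Commute.all _ _)
    (extend_add_of_injective hG η
      (Y := TruncRing R n (max e₁ e₂) ⊗[R] TruncRing R n (max e₁ e₂)) _ _
      Algebra.TensorProduct.includeLeft Algebra.TensorProduct.includeRight _
      (map_val_injective R n (max e₁ e₂))
      (AlgHom.ext fun x => ?_) (AlgHom.ext fun x => ?_))
  · simp
  · simp

end Extension

variable (G) in
/-- The restriction of a homomorphism of formal groups along the universal pointed morphism. -/
def restrictHom : (cartierDual R (WittCoord R n) ⟶ G) →+ pointedMor R n G where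
  toFun φ := ⟨fun B t => φ.app B (universalMor t),
    fun _ _ u t => ConcreteCategory.congr_hom (φ.naturality u) (universalMor t),
    fun B => (congrArg (φ.app B) universalMor_basePt).trans (map_zero (φ.app B).hom)⟩
  map_zero' := rfl
  map_add' _ _ := rfl

theorem restrictHom_injective (hG : IsCommFormalGroup R G) :
    Function.Injective (restrictHom (n := n) G) := by
  intro φ φ' h
  have key : ∀ (X : Type u) [CommRing X] [Algebra R X]
      (g : SpfPoints R (CartierDual R (WittCoord R n)) X),
      φ.app (CommAlgCat.of R X) g = φ'.app (CommAlgCat.of R X) g := by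
    intro X _ _ g
    obtain ⟨e, u, rfl⟩ := exists_symAlg_hom g
    have hnat : ∀ (φ : cartierDual R (WittCoord R n) ⟶ G) {X Y : Type u} [CommRing X] [Algebra R X]
        [CommRing Y] [Algebra R Y] (u : X →ₐ[R] Y)
        (g : SpfPoints R (CartierDual R (WittCoord R n)) X),
        φ.app (CommAlgCat.of R Y) (SpfPoints.map u g) = gpush G u (φ.app (CommAlgCat.of R X) g) :=
      fun φ _ _ _ _ _ _ u g => ConcreteCategory.congr_hom (φ.naturality (CommAlgCat.ofHom u)) g
    rw [hnat, hnat]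
    congr 1
    refine gpush_injective hG (symAlg R n e).val Subtype.val_injective ?_
    rw [← hnat, ← hnat, map_val_thetaSym, theta]
    have hsum : ∀ φ : cartierDual R (WittCoord R n) ⟶ G,
        φ.app (CommAlgCat.of R (TruncRing R n e)) (∑ i, universalMor (tpoint R n e i)) =
          ∑ i, value (restrictHom G φ) (tpoint R n e i) := fun φ =>
      map_sum (φ.app (CommAlgCat.of R (TruncRing R n e))).hom _ _
    refine (hsum φ).trans (Eq.trans ?_ (hsum φ').symm)
    rw [h]
  refine NatTrans.ext (funext fun B => ?_)
  ext g
  exact key B g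

theorem restrictHom_surjective (hG : IsCommFormalGroup R G) :
    Function.Surjective (restrictHom (n := n) G) := by
  intro η
  let φ : cartierDual R (WittCoord R n) ⟶ G :=
    { app := fun B => AddCommGrpCat.ofHom (AddMonoidHom.mk' (fun g => extend hG η g)
        (extend_add hG η (X := B)))
      naturality := fun B C u => by
        ext g
        exact (gpush_extend hG η u.hom g).symm }
  refine ⟨φ, Subtype.ext (funext fun B => funext fun t => ?_)⟩
  exact extend_universalMor hG η (X := B) t

end Universal

end CartierWitt

end

theorem mainTheorem2 (R : Type u) [CommRing R] (n : ℕ) :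
    ∃ h : CartierWitt.IsCommFormalGroup R
        (CartierWitt.cartierDual R (CartierWitt.WittCoord R n)),
      Nonempty
        (preadditiveCoyoneda.obj (Opposite.op
            (⟨CartierWitt.cartierDual R (CartierWitt.WittCoord R n), h⟩ :
              CartierWitt.CommFormalGroup R)) ≅
          CartierWitt.morFs R n) := by
  refine ⟨CartierWitt.isCommFormalGroup_cartierDual R n, ⟨NatIso.ofComponents (fun G =>
    AddEquiv.toAddCommGrpIso ((AddEquiv.ofBijective
      ((CartierWitt.restrictHom G.obj).comp
        (AddMonoidHom.mk' (fun φ => φ.hom) fun _ _ => rfl)) ?_))) ?_⟩⟩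
  · have h1 := CartierWitt.restrictHom_injective (n := n) G.property
    have h2 := CartierWitt.restrictHom_surjective (n := n) G.property
    exact ⟨fun φ φ' h => ObjectProperty.hom_ext _ (h1 h), fun η =>
      (h2 η).elim fun φ hφ => ⟨⟨φ⟩, hφ⟩⟩
  · intro G G' ψ
    rfl
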